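/- **Setting.** Let $G=(V,E)$, $V=\{1,\dots,n\}$, be an undirected graph without parallel edges between distinct vertices, in which vertices may carry several self-loops. A self-loop adds $1$ to the degree $d(u)$, and every degree is positive. For $S\subseteq V$ put $\mathrm{vol}(S)=\sum_{u\in S}d(u)$, define $m$ by $\mathrm{vol}(V)=2m$ (the number of edges, if there are no self-loops), and assume $m>1$. Let $\Phi(\emptyset)=1$ and $\Phi(S)=|E(S,V\setminus S)|/\min(\mathrm{vol}(S),\mathrm{vol}(V\setminus S))$ for $S\neq\emptyset$ (this value is only used for sets with $\mathrm{vol}(S)\le\frac56\mathrm{vol}(V)$). Let $A$ be the adjacency matrix ($A(u,u)$ is the number of self-loops at $u$), $D=\mathrm{diag}(d)$ and $M=(AD^{-1}+I)/2$. For $0<\phi<1$ and $b\ge1$ put $$\ell=\lceil\log_2 m\rceil,\quad t_1=\Big\lceil\tfrac{2}{\phi^2}\ln\big(200(\ell+2)\sqrt m\big)\Big\rceil,\quad t_{last}=(\ell+1)t_1,$$ $$f_1(\phi)=\frac1{280(\ell+2)t_{last}},\quad \epsilon_b=\frac1{1800(\ell+2)\,t_{last}\,2^b}.$$ For a vector $p$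 and an integer $j$, $S_j(p)$ is the set of the first $j$ vertices when $V$ is ordered by decreasing $p(u)/d(u)$, ties being broken in favour of the smaller vertex. $I(p,x)$ is the maximum of $\sum_u w(u)p(u)$ over $w\in[0,1]^V$ with $\sum_u w(u)d(u)=x$, and $I_x(p,x)$ is its left derivative in $x$. Truncation: $[p]_\epsilon(u)=p(u)$ if $p(u)\ge d(u)\epsilon$, and $[p]_\epsilon(u)=0$ otherwise. **Nibble$(G,v,\phi,b)$.** Let $q_0=\chi_v$ (the indicator vector of $v$), $r_t=[q_t]_{\epsilon_b}$ and $q_t=Mr_{t-1}$. In each of the rounds $t=1,\dots,t_{last}$ look for a $j$ such that * (C.1) $\Phi(S_j(q_t))\le\phi$; * (C.2) $\mathrm{vol}(S_j(q_t))\le\frac56\mathrm{vol}(V)$; * (C.3) $2^b\le\mathrm{vol}(S_j(q_t))$; * (C.4) $I_x(q_t,2^b)\ge\frac{1}{140(\ell+2)2^b}$; if one is found, return $C=S_j(q_t)$ and stop. If no round returns a set, return $C=\emptyset$. A round has to return a set if some qualifying $S_j(q_t)$ is contained in $\{u:r_t(u)>0\}$. Qualifying sets that are not contained in it may be examined or not,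 and any qualifying set that is examined may be returned. (This covers the procedure that examines all $j$, with any choice among the qualifying ones, and the procedure that only examines sets contained in $\{u : r_t(u)>0\}$.) **RandomNibble$(G,\phi)$.** Choose a vertex $v$ with probability $d(v)/\mathrm{vol}(V)$ and, independently, $b\in\{1,\dots,\lceil\log_2 m\rceil\}$ with probability $2^{-b}/(1-2^{-\lceil\log_2 m\rceil})$; return $C=\mathrm{Nibble}(G,v,\phi,b)$. **Lemma (Random Nibble).** 1. RandomNibble can be implemented so that its expected running time is $O(\log^7 m/\phi^4)$, with an absolute constant. Precisely: the explicit program that stores the vectors sparsely, sorts the vertices with $r_t(u)>0$ by merge sort according to $q_t(u)/d(u)$, and returns the first set $S_j(q_t)\subseteq\{u:r_t(u)>0\}$ that qualifies always computes an output of Nibble as described above, and its expected number of steps is at most $K\log_2^7 m/\phi^4$ for an absolute constant $K$. Steps are counted on a unit-cost random access machine with real arithmetic (including logarithm, square root, rounding and uniformly random numbers) whose memory is initially blank, and to which $G$ is given by degrees, loop counts, adjacency lists, a list of all arcs, and $\mathrm{vol}(V)$. 2. If, in any run of RandomNibble, the output $C$ is non-empty, then (R.1) $\Phi(C)\le\phi$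 and (R.2) $\mathrm{vol}(C)\le\frac56\mathrm{vol}(V)$. 3. (R.3) Let $S\subseteq V$ satisfy $\mathrm{vol}(S)\le\frac23\mathrm{vol}(V)$ and $\Phi(S)\le f_1(\phi)$, and suppose that no vertex of $S$ has a single self-loop as its only edge. Then $\mathbb E[\mathrm{vol}(C\cap S)]\ge\mathrm{vol}(S)/(4\,\mathrm{vol}(V))$. This holds for every way of choosing, for each $(v,b)$, an admissible output of Nibble. -/

import Mathlib

/-- An undirected graph on the vertex set `Fin n`, without parallel edges between distinct
vertices, in which vertex `u` carries `loops u` self-loops. -/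
structure LoopGraph (n : ℕ) where
  graph : SimpleGraph (Fin n)
  loops : Fin n → ℕ

namespace LoopGraph

variable {n : ℕ} (G : LoopGraph n)

/-! ### Degrees, volumes, conductance -/

open Classical in
/-- The adjacency matrix; a self-loop counts once. -/
noncomputable def adjCount (u w : Fin n) : ℕ :=
  if u = w then G.loops u else if G.graph.Adj u w then 1 else 0

noncomputable def deg (u : Fin n) : ℕ := ∑ w, G.adjCount u w

noncomputable def vol (S : Finset (Fin n)) : ℕ := ∑ u ∈ S, G.deg u

/-- The number `m` for which `vol V = 2 m`. -/
noncomputable def edges : ℝ := (G.vol Finset.univ : ℝ) / 2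

/-- The number of edges between `S` and its complement. -/
noncomputable def cut (S : Finset (Fin n)) : ℕ := ∑ u ∈ S, ∑ w ∈ Sᶜ, G.adjCount u w

noncomputable def conductance (S : Finset (Fin n)) : ℝ :=
  if S = ∅ then 1 else (G.cut S : ℝ) / ((min (G.vol S) (G.vol Sᶜ) : ℕ) : ℝ)

/-! ### The parameters -/

noncomputable def ell : ℕ := ⌈Real.logb 2 ((G.vol Finset.univ : ℝ) / 2)⌉₊

noncomputable def tOne (φ : ℝ) : ℕ :=
  ⌈2 / φ ^ 2 * Real.log (200 * ((G.ell : ℝ) + 2) * √((G.vol Finset.univ : ℝ) / 2))⌉₊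

noncomputable def tLast (φ : ℝ) : ℕ := (G.ell + 1) * G.tOne φ

noncomputable def fOne (φ : ℝ) : ℝ := 1 / (280 * ((G.ell : ℝ) + 2) * (G.tLast φ : ℝ))

/-- The truncation threshold. -/
noncomputable def eps (φ : ℝ) (b : ℕ) : ℝ :=
  1 / (1800 * ((G.ell : ℝ) + 2) * (G.tLast φ : ℝ) * 2 ^ b)

/-! ### The truncated lazy random walk -/

/-- The matrix `M = (A D⁻¹ + I) / 2` of the lazy walk. -/
noncomputable def walk : Matrix (Fin n) (Fin n) ℝ :=
  (1 / 2 : ℝ) • ((Matrix.of fun u w => (G.adjCount u w : ℝ)) *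
    Matrix.diagonal (fun u => ((G.deg u : ℝ))⁻¹) + 1)

noncomputable def trunc (ε : ℝ) (p : Fin n → ℝ) : Fin n → ℝ :=
  fun u => if (G.deg u : ℝ) * ε ≤ p u then p u else 0

noncomputable def walkVec (ε : ℝ) (v : Fin n) : ℕ → Fin n → ℝ
  | 0 => Pi.single v 1
  | t + 1 => Matrix.mulVec G.walk (G.trunc ε (walkVec ε v t))

/-! ### Sweep sets and the curve `I(p, ·)` -/

/-- `w` comes before `u` when vertices are listed by decreasing `p / d`, ties being broken
in favour of the smaller vertex. -/
def Before (p : Fin n → ℝ) (w u : Fin n) : Prop :=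
  p u / (G.deg u : ℝ) < p w / (G.deg w : ℝ) ∨
    (p u / (G.deg u : ℝ) = p w / (G.deg w : ℝ) ∧ w < u)

open Classical in
/-- The set `S_j(p)` of the first `j` vertices in that list. -/
noncomputable def sweep (p : Fin n → ℝ) (j : ℕ) : Finset (Fin n) :=
  Finset.univ.filter fun u => (Finset.univ.filter fun w => G.Before p w u).card < j

/-- `I(p, x)`: the maximum of `∑ w(u) p(u)` over `w ∈ [0,1]^V` with `∑ w(u) d(u) = x`. -/
noncomputable def curve (p : Fin n → ℝ) (x : ℝ) : ℝ :=
  sSup {y | ∃ w : Fin n → ℝ, (∀ u, 0 ≤ w u ∧ w u ≤ 1) ∧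
    ∑ u, w u * (G.deg u : ℝ) = x ∧ y = ∑ u, w u * p u}

/-- `I_x(p, x)`: the derivative of the curve, taken from the left. -/
noncomputable def curveSlope (p : Fin n → ℝ) (x : ℝ) : ℝ :=
  derivWithin (G.curve p) (Set.Iic x) x

/-! ### The procedure `Nibble` -/

/-- The four conditions under which `Nibble` may return `S_j(q)`. -/
def Stops (φ : ℝ) (b : ℕ) (q : Fin n → ℝ) (j : ℕ) : Prop :=
  G.conductance (G.sweep q j) ≤ φ ∧
  (G.vol (G.sweep q j) : ℝ) ≤ 5 / 6 * (G.vol Finset.univ : ℝ) ∧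
  2 ^ b ≤ G.vol (G.sweep q j) ∧
  1 / (140 * ((G.ell : ℝ) + 2) * 2 ^ b) ≤ G.curveSlope q (2 ^ b)

/-- Some sweep set that satisfies the four conditions lies inside the set of vertices
surviving the truncation of `q`. -/
def MustStop (φ : ℝ) (b : ℕ) (q : Fin n → ℝ) : Prop :=
  ∃ j, (∀ u ∈ G.sweep q j, 0 < G.trunc (G.eps φ b) q u) ∧ G.Stops φ b q j

/-- `C` is a possible output of `Nibble(G, v, φ, b)`. A run has rounds `1, …, t_last`. In each
round it may return any set `S_j(q_t)` satisfying the four conditions, and it has to return one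
if such a set exists inside the set of vertices surviving the truncation of `q_t`; sets reaching
beyond the surviving vertices may be examined or not. If no round returns a set, the output
is empty. In particular this covers the procedure that examines every `j` in each round,
whichever admissible `j` it picks, and the one that examines only the surviving vertices. -/
def IsNibbleOutput (φ : ℝ) (v : Fin n) (b : ℕ) (C : Finset (Fin n)) : Prop :=
  (∃ t ∈ Finset.Icc 1 (G.tLast φ),
    (∀ s ∈ Finset.Icc 1 (G.tLast φ), s < t →
      ¬ G.MustStop φ b (G.walkVec (G.eps φ b) v s)) ∧
    ∃ j, G.Stops φ b (G.walkVec (G.eps φ b) v t) j ∧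
      C = G.sweep (G.walkVec (G.eps φ b) v t) j) ∨
  ((∀ s ∈ Finset.Icc 1 (G.tLast φ), ¬ G.MustStop φ b (G.walkVec (G.eps φ b) v s)) ∧ C = ∅)

/-! ### The random choices of `RandomNibble` -/

/-- The expectation of `F v b` when `v` is chosen with probability `d(v) / vol V` and,
independently, `b` from `1, …, ⌈log₂ m⌉` with probability `2^{-b} / (1 - 2^{-⌈log₂ m⌉})`. -/
noncomputable def randomNibbleMean (F : Fin n → ℕ → ℝ) : ℝ :=
  ∑ v, ∑ b ∈ Finset.Icc 1 ⌈Real.logb 2 G.edges⌉₊,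
    ((G.deg v : ℝ) / (G.vol Finset.univ : ℝ)) *
      ((1 / 2 : ℝ) ^ b / (1 - (1 / 2 : ℝ) ^ ⌈Real.logb 2 G.edges⌉₊)) * F v b

end LoopGraph

/-! ### Step counting

Programs are run on a unit-cost random access machine with real arithmetic: an arithmetic
operation or comparison on numbers, an elementary function (`log`, square root, rounding), a
read or a write of an array cell, a read of a degree, of a loop count or of `vol V`, a move along
a list, the creation of a list cell or of a pair, and the draw of a uniformly random number each
cost one step; memory is blank at the start. The input graph is given by its degrees, its loop counts, its adjacency lists and a list of
all arcs. -/

/-- A result together with the number of steps spent on computing it. -/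
structure Timed (α : Type) where
  val : α
  cost : ℕ

instance : Monad Timed where
  pure a := ⟨a, 0⟩
  bind x f := ⟨(f x.val).val, x.cost + (f x.val).cost⟩

namespace Timed

/-- Spend `k` steps. -/
def tick (k : ℕ) : Timed Unit := ⟨(), k⟩

/-- Merge two sorted lists; `le` is a comparison of at most eight steps. -/
def merge {α : Type} (le : α → α → Bool) : List α → List α → Timed (List α)
  | [], ys => do
      tick 2
      return ys
  | x :: xs, [] => do
      tick 2
      return x :: xs
  | x :: xs, y :: ys => do
      tick 14
      if le x y then
        let zs ← merge le xs (y :: ys)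
        return x :: zs
      else
        let zs ← merge le (x :: xs) ys
        return y :: zs
termination_by xs ys => xs.length + ys.length

/-- One round of merge sort: merge neighbouring runs. -/
def mergePairs {α : Type} (le : α → α → Bool) : List (List α) → Timed (List (List α))
  | xs :: ys :: rest => do
      tick 4
      let zs ← merge le xs ys
      let tl ← mergePairs le rest
      return zs :: tl
  | l => do
      tick 2
      return l

/-- Repeat rounds until a single run is left; the first argument only bounds the recursion. -/
def mergeRounds {α : Type} (le : α → α → Bool) : ℕ → List (List α) → Timed (List α)
  | _, [] => do
      tick 2
      return []
  | _, [xs] => do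
      tick 2
      return xs
  | 0, xs :: _ => do
      tick 2
      return xs
  | k + 1, xs :: ys :: rest => do
      tick 2
      let l ← mergePairs le (xs :: ys :: rest)
      mergeRounds le k l

/-- Merge sort. -/
def sort {α : Type} (le : α → α → Bool) (l : List α) : Timed (List α) := do
  tick (4 * l.length + 2)
  mergeRounds le l.length (l.map fun x => [x])

end Timed

/-- An array with one real cell for each vertex, and the list of the cells in use. -/
structure Cells (n : ℕ) where
  arr : Fin n → ℝ
  used : List (Fin n)

namespace LoopGraph

open Timed

variable {n : ℕ} (G : LoopGraph n)

open Classical in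
/-- The adjacency list of `u`, without the self-loops; part of the input. -/
noncomputable def nbrs (u : Fin n) : List (Fin n) :=
  (List.finRange n).filter fun w => decide (G.graph.Adj u w)

/-- Increase the cell of `w` by `x`. -/
noncomputable def deposit (w : Fin n) (x : ℝ) (s : Cells n) : Timed (Cells n) := do
  tick 6
  if s.arr w = 0 then
    return ⟨Function.update s.arr w x, w :: s.used⟩
  else
    return ⟨Function.update s.arr w (s.arr w + x), s.used⟩

/-- Increase by `y` the cells of all vertices in a list. -/
noncomputable def spread (y : ℝ) : List (Fin n) → Cells n → Timed (Cells n)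
  | [], s => do
      tick 1
      return s
  | w :: ws, s => do
      tick 2
      let s' ← deposit w y s
      spread y ws s'

/-- Multiply by the walk matrix the vector given by a list of vertices and values. -/
noncomputable def multiply : List (Fin n × ℝ) → Cells n → Timed (Cells n)
  | [], s => do
      tick 1
      return s
  | (u, x) :: rest, s => do
      tick 12
      let y := x / (2 * (G.deg u : ℝ))
      let s₁ ← deposit u (x / 2 + (G.loops u : ℝ) * y) s
      let s₂ ← spread y (G.nbrs u) s₁
      multiply rest s₂

/-- List the vertices in use that survive the truncation, with their values. -/
noncomputable def survivors (ε : ℝ) (q : Fin n → ℝ) : List (Fin n) → Timed (List (Fin n × ℝ))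
  | [] => do
      tick 1
      return []
  | u :: us => do
      tick 10
      let r ← survivors ε q us
      if (G.deg u : ℝ) * ε ≤ q u then
        return (u, q u) :: r
      else
        return r

open Classical in
/-- The order of the sweep. -/
noncomputable def sweepLE (a c : Fin n × ℝ) : Bool :=
  decide (c.2 / (G.deg c.1 : ℝ) < a.2 / (G.deg a.1 : ℝ) ∨
    (c.2 / (G.deg c.1 : ℝ) = a.2 / (G.deg a.1 : ℝ) ∧ a.1 ≤ c.1))

/-- Count the marked vertices and all vertices in a list. -/
def countMarked (mark : Fin n → Bool) : List (Fin n) → Timed (ℕ × ℕ)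
  | [] => do
      tick 2
      return (0, 0)
  | w :: ws => do
      tick 6
      let c ← countMarked mark ws
      return (if mark w then c.1 + 1 else c.1, c.2 + 1)

open Classical in
/-- Go through the sorted list, maintaining marks on the vertices seen so far, the list `pre` of
these vertices, their volume, the number of edges leaving them, and whether the slope condition
has been met at `2 ^ b`; return the first prefix satisfying the four conditions. The argument
`pow` is `2 ^ b` and `thr` is the required slope. -/
noncomputable def scan (φ thr : ℝ) (pow : ℕ) : List (Fin n × ℝ) → (Fin n → Bool) →
    List (Fin n) → ℕ → ℤ → Bool → Timed (Option (List (Fin n)))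
  | [], _, _, _, _, _ => do
      tick 1
      return none
  | (u, x) :: rest, mark, pre, volume, cutSize, steep => do
      tick 40
      let c ← countMarked mark (G.nbrs u)
      let volume' : ℕ := volume + G.deg u
      let cutSize' : ℤ := cutSize + (c.2 : ℤ) - 2 * (c.1 : ℤ)
      let steep' : Bool :=
        steep || (decide (pow ≤ volume') && decide (thr ≤ x / (G.deg u : ℝ)))
      if (cutSize' : ℝ) ≤
            φ * min (volume' : ℝ) ((G.vol Finset.univ : ℝ) - (volume' : ℝ)) ∧
          (volume' : ℝ) ≤ 5 / 6 * (G.vol Finset.univ : ℝ) ∧ pow ≤ volume' ∧ steep' = true then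
        return some (u :: pre)
      else
        scan φ thr pow rest (Function.update mark u true) (u :: pre) volume' cutSize' steep'

/-- The rounds of `Nibble`, from the list of the nonzero entries of `r_{t-1}`. At the end of a
round the touched cells of the two arrays are reset, so that each round starts from blank
arrays. -/
noncomputable def rounds (φ ε thr : ℝ) (pow : ℕ) :
    ℕ → List (Fin n × ℝ) → Timed (List (Fin n))
  | 0, _ => do
      tick 1
      return []
  | k + 1, r => do
      tick 4
      let s ← G.multiply r ⟨fun _ => 0, []⟩
      let r' ← G.survivors ε s.arr s.used
      let sorted ← Timed.sort G.sweepLE r'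
      let res ← G.scan φ thr pow sorted (fun _ => false) [] 0 0 false
      tick (2 * s.used.length + 2 * r'.length)
      match res with
      | some C => return C
      | none => rounds φ ε thr pow k r'

/-- `Nibble(G, v, φ, b)`, examining only sweep sets of surviving vertices. The first
charge pays for computing `ℓ`, `t_1`, `t_last`, `2 ^ b`, the two thresholds and `r_0`. -/
noncomputable def nibbleProgram (φ : ℝ) (v : Fin n) (b : ℕ) : Timed (List (Fin n)) := do
  tick (50 + 2 * b)
  let ε := G.eps φ b
  let thr : ℝ := 1 / (140 * ((G.ell : ℝ) + 2) * 2 ^ b)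
  let r₀ : List (Fin n × ℝ) := if (G.deg v : ℝ) * ε ≤ 1 then [(v, 1)] else []
  G.rounds φ ε thr (2 ^ b) (G.tLast φ) r₀

/-- `RandomNibble(G, φ)` when the random choices turn out as `v` and `b`. The first
charge pays for drawing `v`, as the tail of a uniformly random entry of the adjacency matrix
stored as a list of arcs, and for drawing `b`, by going through at most `⌈log₂ m⌉` values. -/
noncomputable def randomNibbleProgram (φ : ℝ) (v : Fin n) (b : ℕ) : Timed (List (Fin n)) := do
  tick (10 + 4 * ⌈Real.logb 2 G.edges⌉₊)
  G.nibbleProgram φ v b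

end LoopGraph

/-! Both quantitative claims use that scale `b` is drawn with weight about `2^{-b}`, which cancels a
factor `2^b`.

Overlap. The walk started in proportion to degree on a set `S` loses at most half of `cut S` per
step, so by Markov's inequality it stays in `S` up to time `t_last` with probability at least `1 -
1/(280(ℓ+2))` from at least half of the volume of `S` (`exists_good_start`). From such a start, the
slope condition forces any returned set to have volume at least `2^b/2` inside `S`: its densest
part, of volume at least `2^b`, has density at least `1/(140(ℓ+2)2^b)`, and little mass lies outside
`S` (`half_le_vol_inter`). Also some scale must return a set (`exists_mustStop`). The mean overlap
per good start is then at least `1/2`, and good starts carry half of the volume of `S`.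

`exists_mustStop` is a Lovász–Simonovits argument by contradiction. While no stop is forced, the
curve of the truncated walk stays below `α + β x + (1 - φ²/10)^t · profile`. At a sweep set with
large boundary one step contracts the concave profile (`unitProfile_contract`); at one with small
boundary only the slope condition can have failed, so beyond `2^b` the curve rises with slope at
most `β`; below `2^b` the bound comes from the previous scale, with the slope term and the
truncation error absorbed into `α` (`curveLE_of_not_mustStop`, `curveLE_of_not_mustStop_scales`). At
`t_last` the profile term is negligible and `S` would hold too little mass.

Running time. Every survivor has mass at least `d(u) ε_b` and the total mass is at most 1, so
survivors have volume at most `1/ε_b` (`sum_deg_le`). A round costs this times the `ℓ + 1` passes of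
merge sort; there are `t_last = O(ℓ²/φ²)` rounds, so scale `b` costs `O(2^b ℓ⁶/φ⁴)`. The average
over `b` leaves one more factor `ℓ`. The program is correct because survivors form an initial
segment of the sweep order (`exists_sweep_eq_survivors`). -/

namespace LoopGraph

variable {n : ℕ} (G : LoopGraph n)

/-! ### Degrees, volumes and cuts -/

theorem adjCount_comm (u w : Fin n) : G.adjCount u w = G.adjCount w u := by
  unfold adjCount
  by_cases h : u = w
  · subst h; rfl
  · rw [if_neg h, if_neg (Ne.symm h)]
    by_cases ha : G.graph.Adj u w
    · rw [if_pos ha, if_pos ha.symm]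
    · rw [if_neg ha, if_neg fun hb => ha hb.symm]

theorem vol_union_disjoint {S T : Finset (Fin n)} (h : Disjoint S T) :
    G.vol (S ∪ T) = G.vol S + G.vol T := Finset.sum_union h

theorem vol_add_vol_compl (S : Finset (Fin n)) : G.vol S + G.vol Sᶜ = G.vol Finset.univ :=
  Finset.sum_add_sum_compl S _

theorem vol_mono {S T : Finset (Fin n)} (h : S ⊆ T) : G.vol S ≤ G.vol T :=
  Finset.sum_le_sum_of_subset h

theorem vol_insert {u : Fin n} {S : Finset (Fin n)} (h : u ∉ S) :
    G.vol (insert u S) = G.vol S + G.deg u := by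
  unfold vol; rw [Finset.sum_insert h, add_comm]

theorem cut_compl (S : Finset (Fin n)) : G.cut Sᶜ = G.cut S := by
  unfold cut
  rw [compl_compl, Finset.sum_comm]
  simp_rw [G.adjCount_comm]

theorem cut_le_vol (S : Finset (Fin n)) : G.cut S ≤ G.vol S := by
  unfold cut vol deg
  exact Finset.sum_le_sum fun u _ => Finset.sum_le_sum_of_subset (Finset.subset_univ _)

/-- The number of edge ends at `w` leading into `S`. -/
noncomputable def degIn (S : Finset (Fin n)) (w : Fin n) : ℕ := ∑ u ∈ S, G.adjCount u w

theorem degIn_le (S : Finset (Fin n)) (w : Fin n) : G.degIn S w ≤ G.deg w := by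
  unfold degIn deg
  simp_rw [G.adjCount_comm w]
  exact Finset.sum_le_sum_of_subset (Finset.subset_univ _)

theorem sum_degIn_compl (S : Finset (Fin n)) : ∑ w ∈ Sᶜ, G.degIn S w = G.cut S := by
  unfold degIn cut
  rw [Finset.sum_comm]

theorem sum_degIn (S : Finset (Fin n)) : ∑ w ∈ S, G.degIn S w + G.cut S = G.vol S := by
  have h : ∑ w, G.degIn S w = G.vol S := by
    unfold degIn vol deg
    rw [Finset.sum_comm]
  rw [← h, ← G.sum_degIn_compl, Finset.sum_add_sum_compl]

/-! ### The order of the sweep -/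

variable {G} in
theorem Before.trans {p : Fin n → ℝ} {a b c : Fin n} (h₁ : G.Before p a b)
    (h₂ : G.Before p b c) : G.Before p a c := by
  unfold Before at *
  rcases h₁ with h₁ | ⟨h₁, h₁'⟩ <;> rcases h₂ with h₂ | ⟨h₂, h₂'⟩
  · exact Or.inl (h₂.trans h₁)
  · exact Or.inl (h₂ ▸ h₁)
  · exact Or.inl (h₁ ▸ h₂)
  · exact Or.inr ⟨h₂.trans h₁, h₁'.trans h₂'⟩

theorem not_before_self (p : Fin n → ℝ) (a : Fin n) : ¬ G.Before p a a := by
  simp [Before]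

theorem before_trichotomy (p : Fin n → ℝ) {a b : Fin n} (h : a ≠ b) :
    G.Before p a b ∨ G.Before p b a := by
  unfold Before
  rcases lt_trichotomy (p a / (G.deg a : ℝ)) (p b / (G.deg b : ℝ)) with h₁ | h₁ | h₁
  · exact Or.inr (Or.inl h₁)
  · rcases lt_or_gt_of_ne h with h₂ | h₂
    · exact Or.inl (Or.inr ⟨h₁.symm, h₂⟩)
    · exact Or.inr (Or.inr ⟨h₁, h₂⟩)
  · exact Or.inl (Or.inl h₁)

variable {G} in
theorem Before.div_le {p : Fin n → ℝ} {a b : Fin n} (h : G.Before p a b) :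
    p b / (G.deg b : ℝ) ≤ p a / (G.deg a : ℝ) := by
  rcases h with h | h
  · exact h.le
  · exact h.1.le

open Classical in
/-- The position of a vertex in the list ordered by decreasing `p / d`. -/
noncomputable def rank (p : Fin n → ℝ) (u : Fin n) : ℕ :=
  (Finset.univ.filter fun w => G.Before p w u).card

theorem mem_sweep {p : Fin n → ℝ} {j : ℕ} {u : Fin n} :
    u ∈ G.sweep p j ↔ G.rank p u < j := by
  simp [sweep, rank]

variable {G} in
theorem Before.rank_lt {p : Fin n → ℝ} {a b : Fin n} (h : G.Before p a b) :
    G.rank p a < G.rank p b := by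
  classical
  unfold rank
  apply Finset.card_lt_card
  refine ⟨fun w hw => ?_, fun hsub => ?_⟩
  · simp only [Finset.mem_filter, Finset.mem_univ, true_and] at hw ⊢
    exact hw.trans h
  · have : a ∈ Finset.univ.filter fun w => G.Before p w a := hsub (by simpa using h)
    simp only [Finset.mem_filter, Finset.mem_univ, true_and] at this
    exact G.not_before_self p a this

theorem rank_lt_rank_iff {p : Fin n → ℝ} {a b : Fin n} :
    G.rank p a < G.rank p b ↔ G.Before p a b := by
  refine ⟨fun h => ?_, Before.rank_lt⟩
  by_contra hn
  have hab : a ≠ b := by rintro rfl; exact lt_irrefl _ h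
  exact absurd (((G.before_trichotomy p hab).resolve_left hn).rank_lt) (by omega)

theorem rank_injective (p : Fin n → ℝ) : Function.Injective (G.rank p) := by
  intro a b h
  by_contra hab
  rcases G.before_trichotomy p hab with h' | h' <;> have := h'.rank_lt <;> omega

theorem rank_lt_card (p : Fin n → ℝ) (u : Fin n) : G.rank p u < n := by
  classical
  have : G.rank p u < (Finset.univ : Finset (Fin n)).card := by
    unfold rank
    apply Finset.card_lt_card
    refine ⟨Finset.subset_univ _, fun h => ?_⟩
    have := h (Finset.mem_univ u)
    simp only [Finset.mem_filter, Finset.mem_univ, true_and] at this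
    exact G.not_before_self p u this
  simpa using this

theorem exists_rank_eq (p : Fin n → ℝ) {k : ℕ} (hk : k < n) : ∃ u, G.rank p u = k := by
  have hinj : Function.Injective fun u => (⟨G.rank p u, G.rank_lt_card p u⟩ : Fin n) := fun a b h =>
    G.rank_injective p (by simpa using h)
  obtain ⟨u, hu⟩ := Finite.surjective_of_injective hinj ⟨k, hk⟩
  exact ⟨u, by simpa using hu⟩

@[simp]
theorem sweep_zero (p : Fin n → ℝ) : G.sweep p 0 = ∅ := by
  ext u; simp [mem_sweep]

theorem sweep_of_le (p : Fin n → ℝ) {j : ℕ} (h : n ≤ j) : G.sweep p j = Finset.univ := by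
  ext u; simp [mem_sweep, (G.rank_lt_card p u).trans_le h]

theorem sweep_mono (p : Fin n → ℝ) : Monotone (G.sweep p) := fun _ _ h _ hu =>
  G.mem_sweep.2 ((G.mem_sweep.1 hu).trans_le h)

theorem notMem_sweep_rank (p : Fin n → ℝ) (u : Fin n) : u ∉ G.sweep p (G.rank p u) := by
  simp [mem_sweep]

theorem sweep_rank_succ (p : Fin n → ℝ) (u : Fin n) :
    G.sweep p (G.rank p u + 1) = insert u (G.sweep p (G.rank p u)) := by
  ext w
  rw [Finset.mem_insert, mem_sweep, mem_sweep, Nat.lt_succ_iff_lt_or_eq, or_comm]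
  refine or_congr ⟨fun h => G.rank_injective p h, fun h => h ▸ rfl⟩ Iff.rfl

theorem div_le_of_mem_sweep {p : Fin n → ℝ} {u w : Fin n} (h : w ∈ G.sweep p (G.rank p u + 1)) :
    p u / (G.deg u : ℝ) ≤ p w / (G.deg w : ℝ) := by
  rw [sweep_rank_succ, Finset.mem_insert] at h
  rcases h with rfl | h
  · exact le_rfl
  · exact (G.rank_lt_rank_iff.1 (G.mem_sweep.1 h)).div_le

theorem div_le_of_notMem_sweep {p : Fin n → ℝ} {u w : Fin n} (h : w ∉ G.sweep p (G.rank p u)) :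
    p w / (G.deg w : ℝ) ≤ p u / (G.deg u : ℝ) := by
  rw [mem_sweep, not_lt] at h
  rcases h.eq_or_lt with h | h
  · rw [G.rank_injective p h]
  · exact (G.rank_lt_rank_iff.1 h).div_le

theorem vol_sweep_rank_succ (p : Fin n → ℝ) (u : Fin n) :
    G.vol (G.sweep p (G.rank p u + 1)) = G.vol (G.sweep p (G.rank p u)) + G.deg u := by
  rw [sweep_rank_succ, vol_insert _ (G.notMem_sweep_rank p u)]

/-- Every volume lies between those of two consecutive sweep sets. -/
theorem exists_vol_sweep (p : Fin n → ℝ) {x : ℝ} (hx : 0 < x)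
    (hx' : x ≤ (G.vol Finset.univ : ℝ)) :
    ∃ u, (G.vol (G.sweep p (G.rank p u)) : ℝ) < x ∧
      x ≤ (G.vol (G.sweep p (G.rank p u + 1)) : ℝ) := by
  classical
  have hex : ∃ j, x ≤ (G.vol (G.sweep p j) : ℝ) := ⟨n, by rwa [G.sweep_of_le p le_rfl]⟩
  have hpos : Nat.find hex ≠ 0 := by
    intro h0
    have := Nat.find_spec hex
    rw [h0, sweep_zero] at this
    simp [vol] at this
    linarith
  obtain ⟨k, hk⟩ := Nat.exists_eq_succ_of_ne_zero hpos
  have hkn : k < n := by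
    have : Nat.find hex ≤ n := Nat.find_min' hex (by rwa [G.sweep_of_le p le_rfl])
    omega
  obtain ⟨u, rfl⟩ := G.exists_rank_eq p hkn
  refine ⟨u, not_le.1 (Nat.find_min hex (by omega)), ?_⟩
  have := Nat.find_spec hex
  rwa [hk] at this

/-- A set that is closed under passing to earlier vertices is a sweep set. -/
theorem sweep_card_eq {p : Fin n → ℝ} {U : Finset (Fin n)}
    (hU : ∀ u ∈ U, ∀ w, G.Before p w u → w ∈ U) : G.sweep p U.card = U := by
  classical
  ext u
  rw [mem_sweep]
  constructor
  · intro h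
    by_contra hu
    refine absurd h (not_lt.2 (Finset.card_le_card fun w hw => ?_))
    have hne : w ≠ u := by rintro rfl; exact hu hw
    rw [Finset.mem_filter]
    exact ⟨Finset.mem_univ _,
      (G.before_trichotomy p hne).resolve_right fun h' => hu (hU w hw u h')⟩
  · intro hu
    refine Finset.card_lt_card ⟨fun w hw => hU u hu w (Finset.mem_filter.1 hw).2, fun h => ?_⟩
    exact G.not_before_self p u (Finset.mem_filter.1 (h hu)).2

theorem card_sweep (p : Fin n → ℝ) {j : ℕ} (hj : j ≤ n) : (G.sweep p j).card = j := by
  induction j with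
  | zero => simp
  | succ k ih =>
    obtain ⟨u, rfl⟩ := G.exists_rank_eq p hj
    rw [sweep_rank_succ, Finset.card_insert_of_notMem (G.notMem_sweep_rank p u), ih (by omega)]

/-! ### The curve -/

variable {G}

/-- Weak duality for the linear program behind the curve: the line with slope equal to the density
of `u`, through the knot just before `u`, lies above all fractional weights. Densities are at least
this slope on the sweep set and at most this slope off it. -/
theorem sum_weight_le (hd : ∀ u, 0 < G.deg u) (p : Fin n → ℝ) (u : Fin n) {w : Fin n → ℝ}
    (hw : ∀ z, 0 ≤ w z ∧ w z ≤ 1) :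
    ∑ z, w z * p z ≤ ∑ z ∈ G.sweep p (G.rank p u), p z +
      p u / (G.deg u : ℝ) * (∑ z, w z * (G.deg z : ℝ) - G.vol (G.sweep p (G.rank p u))) := by
  classical
  set c := p u / (G.deg u : ℝ)
  set S := G.sweep p (G.rank p u)
  have key : ∑ z, (w z - if z ∈ S then 1 else 0) * (p z - c * (G.deg z : ℝ)) ≤ 0 := by
    apply Finset.sum_nonpos
    intro z _
    have hz : (0 : ℝ) < G.deg z := by exact_mod_cast hd z
    split_ifs with h
    · have h1 : c ≤ p z / (G.deg z : ℝ) :=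
        G.div_le_of_mem_sweep (G.sweep_mono p (Nat.le_succ _) h)
      rw [le_div_iff₀ hz] at h1
      exact mul_nonpos_of_nonpos_of_nonneg (by linarith [(hw z).2]) (by linarith)
    · have h1 : p z / (G.deg z : ℝ) ≤ c := G.div_le_of_notMem_sweep h
      rw [div_le_iff₀ hz] at h1
      exact mul_nonpos_of_nonneg_of_nonpos (by linarith [(hw z).1]) (by linarith)
  have e : ∑ z, (w z - if z ∈ S then 1 else 0) * (p z - c * (G.deg z : ℝ)) =
      ∑ z, w z * p z - c * ∑ z, w z * (G.deg z : ℝ) -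
        (∑ z ∈ S, p z - c * ∑ z ∈ S, (G.deg z : ℝ)) := by
    rw [Finset.mul_sum, Finset.mul_sum, ← Finset.sum_sub_distrib, ← Finset.sum_sub_distrib,
      ← Finset.univ_inter S, ← Finset.sum_ite_mem, ← Finset.sum_sub_distrib]
    refine Finset.sum_congr rfl fun z _ => ?_
    simp only [Finset.univ_inter]
    split_ifs <;> ring
  have hv : (G.vol S : ℝ) = ∑ z ∈ S, (G.deg z : ℝ) := by simp [vol]
  rw [e] at key
  rw [hv]
  linarith

/-- The optimum is greedy: take all vertices before `u` and a fraction of `u`. Optimality is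
`sum_weight_le`. -/
theorem curve_eq (hd : ∀ u, 0 < G.deg u) (p : Fin n → ℝ) (u : Fin n) {x : ℝ}
    (h₁ : (G.vol (G.sweep p (G.rank p u)) : ℝ) ≤ x)
    (h₂ : x ≤ (G.vol (G.sweep p (G.rank p u + 1)) : ℝ)) :
    G.curve p x = ∑ z ∈ G.sweep p (G.rank p u), p z +
      p u / (G.deg u : ℝ) * (x - G.vol (G.sweep p (G.rank p u))) := by
  classical
  have hu : (0 : ℝ) < G.deg u := by exact_mod_cast hd u
  rw [vol_sweep_rank_succ, Nat.cast_add] at h₂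
  set S := G.sweep p (G.rank p u) with hS
  have huS : u ∉ S := G.notMem_sweep_rank p u
  apply IsGreatest.csSup_eq
  refine ⟨⟨fun z => (if z ∈ S then 1 else 0) +
    (if z = u then (x - G.vol S) / G.deg u else 0), fun z => ?_, ?_, ?_⟩, ?_⟩
  · by_cases hz : z = u
    · subst hz
      simp only [huS, if_false, if_true, zero_add]
      exact ⟨div_nonneg (by linarith) hu.le, by rw [div_le_one hu]; linarith⟩
    · simp only [hz, if_false, add_zero]
      split_ifs <;> norm_num
  · simp only [add_mul, Finset.sum_add_distrib, ite_mul, one_mul, zero_mul, Finset.sum_ite_mem,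
      Finset.univ_inter, Finset.sum_ite_eq', Finset.mem_univ, if_true]
    rw [div_mul_cancel₀ _ hu.ne']
    simp [vol]
  · simp only [add_mul, Finset.sum_add_distrib, ite_mul, one_mul, zero_mul, Finset.sum_ite_mem,
      Finset.univ_inter, Finset.sum_ite_eq', Finset.mem_univ, if_true]
    ring
  · rintro y ⟨w, hw, hx, rfl⟩
    rw [← hx]
    exact sum_weight_le hd p u hw

/-- The half-open interval matches the left derivative: at a knot the slope is the density of the
vertex just completed, not of the next one. -/
theorem curveSlope_eq (hd : ∀ u, 0 < G.deg u) (p : Fin n → ℝ) (u : Fin n) {x : ℝ}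
    (h₁ : (G.vol (G.sweep p (G.rank p u)) : ℝ) < x)
    (h₂ : x ≤ (G.vol (G.sweep p (G.rank p u + 1)) : ℝ)) :
    G.curveSlope p x = p u / (G.deg u : ℝ) := by
  unfold curveSlope
  have hev : G.curve p =ᶠ[nhdsWithin x (Set.Iic x)] fun x => ∑ z ∈ G.sweep p (G.rank p u), p z +
      p u / (G.deg u : ℝ) * (x - G.vol (G.sweep p (G.rank p u))) := by
    filter_upwards [Ioc_mem_nhdsLE h₁] with z hz
    exact curve_eq hd p u hz.1.le (hz.2.trans h₂)
  rw [hev.derivWithin_eq_of_mem (Set.mem_Iic.2 le_rfl)]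
  have : HasDerivAt (fun x : ℝ => ∑ z ∈ G.sweep p (G.rank p u), p z +
      p u / (G.deg u : ℝ) * (x - G.vol (G.sweep p (G.rank p u)))) (p u / (G.deg u : ℝ)) x := by
    simpa using (((hasDerivAt_id x).sub_const _).const_mul (p u / (G.deg u : ℝ))).const_add
      (∑ z ∈ G.sweep p (G.rank p u), p z)
  exact this.hasDerivWithinAt.derivWithin (uniqueDiffOn_Iic x x (Set.mem_Iic.2 le_rfl))

/-- A concave function dominating a vector at the volumes of its first sweep sets dominates it for
all fractional weights of volume at most that of the last of these sets. -/
theorem sum_weight_le_of_concave (hd : ∀ u, 0 < G.deg u) {p : Fin n → ℝ} {B : ℝ → ℝ} {J : ℕ}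
    (hB : ConcaveOn ℝ (Set.Icc 0 (G.vol Finset.univ : ℝ)) B)
    (h : ∀ j ≤ J, ∑ z ∈ G.sweep p j, p z ≤ B (G.vol (G.sweep p j))) {w : Fin n → ℝ}
    (hw : ∀ z, 0 ≤ w z ∧ w z ≤ 1)
    (hJ : ∑ z, w z * (G.deg z : ℝ) ≤ (G.vol (G.sweep p J) : ℝ)) :
    ∑ z, w z * p z ≤ B (∑ z, w z * (G.deg z : ℝ)) := by
  classical
  set x := ∑ z, w z * (G.deg z : ℝ) with hx
  have hx0 : 0 ≤ x := Finset.sum_nonneg fun z _ => mul_nonneg (hw z).1 (Nat.cast_nonneg _)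
  have hx1 : x ≤ G.vol Finset.univ := by
    rw [hx, vol, Nat.cast_sum]
    exact Finset.sum_le_sum fun z _ => mul_le_of_le_one_left (Nat.cast_nonneg _) (hw z).2
  rcases hx0.eq_or_lt with h0 | h0
  · have hz : ∀ z, w z = 0 := by
      intro z
      have := (Finset.sum_eq_zero_iff_of_nonneg
        (fun z _ => mul_nonneg (hw z).1 (Nat.cast_nonneg _))).1 (hx ▸ h0.symm) z
        (Finset.mem_univ z)
      rcases mul_eq_zero.1 this with h | h
      · exact h
      · exact absurd h (by exact_mod_cast (hd z).ne')
    have := h 0 (Nat.zero_le _)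
    simp only [sweep_zero, Finset.sum_empty, vol, Nat.cast_zero] at this
    rw [← h0]
    simpa [hz] using this
  · obtain ⟨u, h₁, h₂⟩ := G.exists_vol_sweep p h0 hx1
    refine (sum_weight_le hd p u hw).trans ?_
    rw [← hx]
    have hu : (0 : ℝ) < G.deg u := by exact_mod_cast hd u
    have hk : G.rank p u + 1 ≤ J := by
      by_contra hn
      have := G.vol_mono (G.sweep_mono p (show J ≤ G.rank p u by omega))
      exact absurd (h₁.trans_le hJ) (not_lt.2 (by exact_mod_cast this))
    have e₁ := h (G.rank p u) (by omega)
    have e₂ := h (G.rank p u + 1) hk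
    have hvu : (G.vol (G.sweep p (G.rank p u + 1)) : ℝ) ∈
        Set.Icc 0 (G.vol Finset.univ : ℝ) :=
      ⟨Nat.cast_nonneg _, by exact_mod_cast G.vol_mono (Finset.subset_univ _)⟩
    rw [vol_sweep_rank_succ, Nat.cast_add] at h₂ e₂ hvu
    rw [sweep_rank_succ, Finset.sum_insert (G.notMem_sweep_rank p u)] at e₂
    set X : ℝ := (G.vol (G.sweep p (G.rank p u)) : ℝ)
    have hX : 0 ≤ X := Nat.cast_nonneg _
    -- `x` is the convex combination with weights `1 - θ` and `θ` of the two neighbouring knots.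
    set θ := (x - X) / G.deg u with hθ
    have hθ0 : 0 ≤ θ := div_nonneg (by linarith) hu.le
    have hθ1 : θ ≤ 1 := by rw [hθ, div_le_one hu]; linarith
    have hxe : (1 - θ) * X + θ * (X + G.deg u) = x := by
      have : θ * G.deg u = x - X := div_mul_cancel₀ _ hu.ne'
      linear_combination this
    have := hB.2 (⟨hX, by linarith [hvu.2]⟩ : X ∈ Set.Icc 0 (G.vol Finset.univ : ℝ)) hvu
      (sub_nonneg.2 hθ1) hθ0 (by ring)
    simp only [smul_eq_mul] at this
    rw [hxe] at this
    refine le_trans ?_ this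
    have e3 : p u / (G.deg u : ℝ) * (x - X) = θ * p u := by rw [hθ]; ring
    rw [e3]
    have := mul_le_mul_of_nonneg_left e₁ (sub_nonneg.2 hθ1)
    have := mul_le_mul_of_nonneg_left e₂ hθ0
    nlinarith

end LoopGraph

/-! ### A contracting profile -/

/-- The profile `√s - (2/5) (s - 1)₊²` on `[0, 2]`. -/
noncomputable def unitProfile (s : ℝ) : ℝ := √s - 2 / 5 * (max (s - 1) 0) ^ 2

theorem unitProfile_le_sqrt (s : ℝ) : unitProfile s ≤ √s := by
  unfold unitProfile; nlinarith [sq_nonneg (max (s - 1) 0)]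

theorem unitProfile_of_le_one {s : ℝ} (hs : s ≤ 1) : unitProfile s = √s := by
  simp [unitProfile, max_eq_right (sub_nonpos.2 hs)]

theorem unitProfile_of_one_le {s : ℝ} (hs : 1 ≤ s) :
    unitProfile s = √s - 2 / 5 * (s - 1) ^ 2 := by
  simp [unitProfile, max_eq_left (sub_nonneg.2 hs)]

theorem concaveOn_unitProfile : ConcaveOn ℝ (Set.Ici 0) unitProfile := by
  have h₁ : ConcaveOn ℝ (Set.Ici (0 : ℝ)) (fun s => √s) := Real.strictConcaveOn_sqrt.concaveOn
  have h₂ : ConvexOn ℝ (Set.Ici (0 : ℝ)) fun s => max (s - 1) 0 := by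
    refine ConvexOn.sup ?_ (convexOn_const 0 (convex_Ici 0))
    exact (convexOn_id (convex_Ici 0)).sub (concaveOn_const 1 (convex_Ici 0))
  have h₃ : ConvexOn ℝ (Set.Ici (0 : ℝ)) fun s => (max (s - 1) 0) ^ 2 :=
    h₂.pow (fun _ _ => le_max_right _ _) 2
  have h₄ := h₁.sub (h₃.smul (show (0 : ℝ) ≤ 2 / 5 by norm_num))
  exact h₄

/-- With `e = δ/s`, squaring the left side gives `2s + 2ab`, where `ab = s√(1 - e²) ≤ s(1 - e²/2)`;
the result is at most `s(2 - e²/4)²`. -/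
theorem sqrt_sub_add_sqrt_add_le {s δ : ℝ} (hs : 0 < s) (h0 : 0 ≤ δ) (hδ : δ ≤ s) :
    √(s - δ) + √(s + δ) ≤ 2 * √s - δ ^ 2 / (4 * s ^ 2) * √s := by
  set a := √(s - δ)
  set b := √(s + δ)
  set r := √s
  have ha : a ^ 2 = s - δ := Real.sq_sqrt (by linarith)
  have hb : b ^ 2 = s + δ := Real.sq_sqrt (by linarith)
  have hr : r ^ 2 = s := Real.sq_sqrt hs.le
  have ha0 : 0 ≤ a := Real.sqrt_nonneg _
  have hb0 : 0 ≤ b := Real.sqrt_nonneg _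
  have hr0 : 0 < r := Real.sqrt_pos.2 hs
  set e := δ / s with he
  have he1 : e ≤ 1 := by rw [he, div_le_one hs]; exact hδ
  have he0 : 0 ≤ e := div_nonneg h0 hs.le
  have hδe : δ = e * s := by rw [he]; field_simp
  have hrw : 2 * r - δ ^ 2 / (4 * s ^ 2) * r = r * (2 - e ^ 2 / 4) := by
    rw [he]; field_simp
  rw [hrw]
  have hab : a * b ≤ s * (1 - e ^ 2 / 2) := by
    have hpos : 0 ≤ 1 - e ^ 2 / 2 := by nlinarith
    refine abs_le_of_sq_le_sq' ?_ (mul_nonneg hs.le hpos) |>.2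
    rw [mul_pow, ha, hb, hδe]
    nlinarith [sq_nonneg (s * e ^ 2)]
  refine abs_le_of_sq_le_sq' ?_ (mul_nonneg hr0.le (by nlinarith)) |>.2
  rw [mul_pow, hr, add_sq, ha, hb]
  nlinarith [mul_nonneg hs.le (sq_nonneg (e ^ 2))]

/-- Up to 1 the square root alone contracts. Beyond 1 the displacement is only at least `φ(2 - s)`,
and the quadratic term supplies the curvature needed to keep the rate `φ²/10`. -/
theorem unitProfile_contract {s δ φ : ℝ} (hs0 : 0 < s) (hs : s ≤ 3 / 2) (hφ : 0 ≤ φ)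
    (h₁ : φ * min s (2 - s) ≤ δ) (h₂ : δ ≤ min s (2 - s)) :
    unitProfile (s - δ) + unitProfile (s + δ) ≤ 2 * (1 - φ ^ 2 / 10) * unitProfile s := by
  have hmin : 0 < min s (2 - s) := lt_min hs0 (by linarith)
  have hδ0 : 0 ≤ δ := le_trans (mul_nonneg hφ hmin.le) h₁
  have hδs : δ ≤ s := h₂.trans (min_le_left _ _)
  have hsq := sqrt_sub_add_sqrt_add_le hs0 hδ0 hδs
  set r := √s with hr
  have hr0 : 0 < r := Real.sqrt_pos.2 hs0
  have hr2 : r ^ 2 = s := Real.sq_sqrt hs0.le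
  rcases le_total s 1 with h | h
  · rw [min_eq_left (by linarith)] at h₁
    rw [unitProfile_of_le_one h, ← hr]
    have := unitProfile_le_sqrt (s - δ)
    have := unitProfile_le_sqrt (s + δ)
    have h3 : φ ^ 2 / 4 ≤ δ ^ 2 / (4 * s ^ 2) := by
      rw [div_le_div_iff₀ (by norm_num) (by positivity)]
      linarith [mul_self_le_mul_self (mul_nonneg hφ hs0.le) h₁]
    linarith [mul_le_mul_of_nonneg_right h3 hr0.le, mul_nonneg (sq_nonneg φ) hr0.le]
  · rw [min_eq_right (by linarith)] at h₁ h₂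
    obtain ⟨u, rfl⟩ : ∃ u, s = 1 + u := ⟨s - 1, by ring⟩
    have hu0 : 0 ≤ u := by linarith
    have hu : u ≤ 1 / 2 := by linarith
    have hr1 : r ≤ 1 + u / 2 := by
      refine abs_le_of_sq_le_sq' ?_ (by linarith) |>.2
      nlinarith
    -- Equivalent to `s^{3/2} ≤ 2`, which holds for `s ≤ 3/2`.
    have hc : (1 : ℝ) / 8 ≤ 1 / (4 * (1 + u) ^ 2) * r := by
      rw [div_mul_eq_mul_div, one_mul, div_le_div_iff₀ (by norm_num) (by positivity)]
      have h1 : r ≤ 5 / 4 := by linarith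
      have h2 : r * (1 + u) ≤ 2 := by nlinarith
      have h3 : (1 + u) ^ 2 = r * (r * (1 + u)) := by rw [← hr2]; ring
      rw [h3]
      linarith [mul_le_mul_of_nonneg_left h2 hr0.le]
    have hroot : √(1 + u - δ) + √(1 + u + δ) ≤ 2 * r - δ ^ 2 / 8 := by
      have : δ ^ 2 / (4 * (1 + u) ^ 2) * r = δ ^ 2 * (1 / (4 * (1 + u) ^ 2) * r) := by ring
      rw [this] at hsq
      linarith [mul_le_mul_of_nonneg_left hc (sq_nonneg δ)]
    -- This is where the rate `1/10` comes from: at `u = 1/2` the two sides are `0.23` and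
    -- `0.23125`.
    have hpoly : (1 + u / 2 - 2 / 5 * u ^ 2) / 5 ≤ (1 - u) ^ 2 / 8 + 2 / 5 * (1 - u) := by
      nlinarith
    have hF : (r - 2 / 5 * u ^ 2) / 5 ≤ (1 - u) ^ 2 / 8 + 2 / 5 * (1 - u) := by linarith
    have hδφ : φ ^ 2 * (1 - u) ^ 2 ≤ δ ^ 2 := by
      have h1 : φ * (1 - u) ≤ δ := by linarith
      have h0 : 0 ≤ φ * (1 - u) := mul_nonneg hφ (by linarith)
      rw [← mul_pow]
      exact pow_le_pow_left₀ h0 h1 2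
    have hplus : unitProfile (1 + u + δ) = √(1 + u + δ) - 2 / 5 * (u + δ) ^ 2 := by
      rw [unitProfile_of_one_le (by linarith)]; ring
    have hs' : unitProfile (1 + u) = r - 2 / 5 * u ^ 2 := by
      rw [unitProfile_of_one_le h]; ring
    rw [hplus, hs']
    have hw : 0 < 1 - u := by linarith
    -- the gain has at least the size of `φ² F / 5`
    have hgain : φ ^ 2 * ((r - 2 / 5 * u ^ 2) / 5) ≤ δ ^ 2 / 8 + 2 / 5 * (δ ^ 2 / (1 - u)) := by
      have h1 := mul_le_mul_of_nonneg_left hF (sq_nonneg φ)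
      have h2 : φ ^ 2 * (1 - u) ≤ δ ^ 2 / (1 - u) := by
        rw [le_div_iff₀ hw]; linarith
      linarith
    -- If `δ ≤ u`, both displaced points feel the quadratic term, which gains `(4/5) δ²`. Otherwise
    -- the left point lies below 1 and only the right one contributes, with a gain of `(2/5)(δ² +
    -- 2uδ - u²)`.
    rcases le_total δ u with h3 | h3
    · have hminus : unitProfile (1 + u - δ) = √(1 + u - δ) - 2 / 5 * (u - δ) ^ 2 := by
        rw [unitProfile_of_one_le (by linarith)]; ring
      rw [hminus]
      have h4 : δ ^ 2 / (1 - u) ≤ 2 * δ ^ 2 := by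
        rw [div_le_iff₀ hw]
        linarith [mul_nonneg (sq_nonneg δ) (show 0 ≤ 1 - 2 * u by linarith)]
      linarith
    · have hminus := unitProfile_le_sqrt (1 + u - δ)
      have h4 : δ ^ 2 / (1 - u) ≤ δ ^ 2 + 2 * u * δ - u ^ 2 := by
        rw [div_le_iff₀ hw]
        have h5 : (u * δ) * (1 - u) ≤ (2 * u * δ - u ^ 2) * (1 - u) :=
          mul_le_mul_of_nonneg_right (by nlinarith [mul_nonneg hu0 (sub_nonneg.2 h3)]) hw.le
        have h6 : 0 ≤ (u * δ) * (1 - u - δ) :=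
          mul_nonneg (mul_nonneg hu0 hδ0) (by linarith)
        linarith
      linarith

/-- The coefficient `2/5` is almost the largest possible here: at `3/2` the slope is `1/(2√1.5) -
2/5`, about `0.008`. The same balance appears below as `t - s ≤ (5/2)(√t - √s)`. -/
theorem unitProfile_mono {s t : ℝ} (h0 : 0 ≤ s) (hst : s ≤ t) (ht : t ≤ 3 / 2) :
    unitProfile s ≤ unitProfile t := by
  unfold unitProfile
  set a := √s with ha
  set b := √t with hb
  have ha2 : a ^ 2 = s := Real.sq_sqrt h0
  have hb2 : b ^ 2 = t := Real.sq_sqrt (h0.trans hst)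
  have ha0 : 0 ≤ a := Real.sqrt_nonneg _
  have hab : a ≤ b := Real.sqrt_le_sqrt hst
  have hb5 : b ≤ 5 / 4 := by nlinarith
  have hmax : max (t - 1) 0 - max (s - 1) 0 ≤ t - s := by
    rcases max_cases (t - 1) 0 with h | h <;> rcases max_cases (s - 1) 0 with h' | h' <;> linarith
  have hm1 : max (t - 1) 0 ≤ 1 / 2 := max_le (by linarith) (by norm_num)
  have hm2 : max (s - 1) 0 ≤ max (t - 1) 0 := max_le_max (by linarith) le_rfl
  have hm0 : 0 ≤ max (s - 1) 0 := le_max_right _ _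
  set p := max (t - 1) 0
  set q := max (s - 1) 0
  have h1 : p ^ 2 - q ^ 2 ≤ t - s := by nlinarith
  have h2 : t - s ≤ 5 / 2 * (b - a) := by nlinarith
  linarith

theorem one_le_unitProfile {s : ℝ} (h1 : 1 ≤ s) (hs : s ≤ 3 / 2) : 1 ≤ unitProfile s := by
  have := unitProfile_mono zero_le_one h1 hs
  rwa [unitProfile_of_le_one le_rfl, Real.sqrt_one] at this

theorem unitProfile_nonneg {s : ℝ} (h0 : 0 ≤ s) (hs : s ≤ 2) : 0 ≤ unitProfile s := by
  rcases le_total s 1 with h | h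
  · rw [unitProfile_of_le_one h]; exact Real.sqrt_nonneg _
  · rw [unitProfile_of_one_le h]
    have : 1 ≤ √s := Real.one_le_sqrt.2 h
    nlinarith

/-- The profile scaled to `[0, 2 m]`. -/
noncomputable def profile (m x : ℝ) : ℝ := √m * unitProfile (x / m)


theorem concaveOn_profile {m : ℝ} (hm : 0 < m) : ConcaveOn ℝ (Set.Icc 0 (2 * m)) (profile m) := by
  refine ⟨convex_Icc _ _, fun x hx y hy a b ha hb hab => ?_⟩
  have := concaveOn_unitProfile.2 (show x / m ∈ Set.Ici 0 from div_nonneg hx.1 hm.le)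
    (show y / m ∈ Set.Ici 0 from div_nonneg hy.1 hm.le) ha hb hab
  simp only [smul_eq_mul, profile] at this ⊢
  have e : (a * x + b * y) / m = a * (x / m) + b * (y / m) := by ring
  rw [e]
  nlinarith [mul_le_mul_of_nonneg_left this (Real.sqrt_nonneg m)]

theorem profile_nonneg {m x : ℝ} (hm : 0 < m) (h0 : 0 ≤ x) (hx : x ≤ 2 * m) : 0 ≤ profile m x :=
  mul_nonneg (Real.sqrt_nonneg _) (unitProfile_nonneg (div_nonneg h0 hm.le)
    (by rwa [div_le_iff₀ hm]))

theorem profile_mono {m x y : ℝ} (hm : 0 < m) (h0 : 0 ≤ x) (hxy : x ≤ y) (hy : y ≤ 3 / 2 * m) :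
    profile m x ≤ profile m y :=
  mul_le_mul_of_nonneg_left (unitProfile_mono (div_nonneg h0 hm.le)
    (div_le_div_of_nonneg_right hxy hm.le) (by rwa [div_le_iff₀ hm])) (Real.sqrt_nonneg _)

/-- Used for the initial point mass. Up to `m` the profile is `√x`, and `a² ≤ a ≤ x`; from `m` to
`3m/2` it is at least `√m ≥ 1`. -/
theorem le_profile {m x a : ℝ} (hm : 1 ≤ m) (hx : x ≤ 3 / 2 * m) (h0 : 0 ≤ a) (ha : a ≤ x)
    (ha1 : a ≤ 1) : a ≤ profile m x := by
  have hm0 : 0 < m := by linarith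
  rcases le_total x m with h | h
  · rw [profile, unitProfile_of_le_one (by rwa [div_le_one hm0]), ← Real.sqrt_mul hm0.le,
      mul_div_cancel₀ _ hm0.ne']
    refine Real.le_sqrt_of_sq_le ?_
    nlinarith
  · have h1 : 1 ≤ √m := Real.one_le_sqrt.2 hm
    have h2 : 1 ≤ unitProfile (x / m) :=
      one_le_unitProfile (by rwa [one_le_div hm0]) (by rwa [div_le_iff₀ hm0])
    unfold profile
    nlinarith

theorem profile_le {m x : ℝ} (hm : 0 < m) (h0 : 0 ≤ x) (hx : x ≤ 3 / 2 * m) :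
    profile m x ≤ 9 / 8 * √m := by
  have h1 : unitProfile (x / m) ≤ 9 / 8 := by
    refine (unitProfile_mono (div_nonneg h0 hm.le) (t := 3 / 2) (by rwa [div_le_iff₀ hm])
      le_rfl).trans ?_
    rw [unitProfile_of_one_le (by norm_num)]
    have : √(3 / 2 : ℝ) ≤ 49 / 40 := by
      rw [Real.sqrt_le_left (by norm_num)]; norm_num
    linarith
  unfold profile
  nlinarith [Real.sqrt_nonneg m]

theorem profile_contract {m x c φ : ℝ} (hm : 0 < m) (h0 : 0 < x) (hx : x ≤ 3 / 2 * m)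
    (hφ : 0 ≤ φ) (h₁ : φ * min x (2 * m - x) ≤ c) (h₂ : c ≤ min x (2 * m - x)) :
    profile m (x - c) + profile m (x + c) ≤ 2 * (1 - φ ^ 2 / 10) * profile m x := by
  have e : min (x / m) (2 - x / m) = min x (2 * m - x) / m := by
    rw [← min_div_div_right hm.le]; congr 1; field_simp
  have := unitProfile_contract (s := x / m) (δ := c / m) (div_pos h0 hm) (by rwa [div_le_iff₀ hm])
    hφ (by rw [e, ← mul_div_assoc]; exact div_le_div_of_nonneg_right h₁ hm.le)
    (by rw [e]; exact div_le_div_of_nonneg_right h₂ hm.le)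
  rw [← sub_div, ← add_div] at this
  unfold profile
  nlinarith [mul_le_mul_of_nonneg_left this (Real.sqrt_nonneg m)]

namespace LoopGraph

variable {n : ℕ} {G : LoopGraph n}

/-! ### The walk -/

theorem walk_mulVec_apply (G : LoopGraph n) (r : Fin n → ℝ) (u : Fin n) :
    Matrix.mulVec G.walk r u =
      (∑ w, (G.adjCount u w : ℝ) * (r w / (G.deg w : ℝ)) + r u) / 2 := by
  have e : Matrix.mulVec (Matrix.diagonal fun u => ((G.deg u : ℝ))⁻¹) r =
      fun w => r w / (G.deg w : ℝ) := by
    funext w; rw [Matrix.mulVec_diagonal]; ring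
  unfold walk
  rw [Matrix.smul_mulVec, Pi.smul_apply, Matrix.add_mulVec, Matrix.one_mulVec, Pi.add_apply,
    ← Matrix.mulVec_mulVec, e]
  simp only [smul_eq_mul, Matrix.mulVec, dotProduct, Matrix.of_apply]
  ring

theorem sum_walk (G : LoopGraph n) (r : Fin n → ℝ) (S : Finset (Fin n)) :
    ∑ u ∈ S, Matrix.mulVec G.walk r u =
      (∑ w, (G.degIn S w : ℝ) * (r w / (G.deg w : ℝ)) + ∑ u ∈ S, r u) / 2 := by
  simp_rw [walk_mulVec_apply, ← Finset.sum_div, Finset.sum_add_distrib]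
  rw [Finset.sum_comm]
  simp_rw [← Finset.sum_mul, degIn, Nat.cast_sum]

theorem walk_mulVec_mono {r r' : Fin n → ℝ} (h : ∀ u, r u ≤ r' u) (u : Fin n) :
    Matrix.mulVec G.walk r u ≤ Matrix.mulVec G.walk r' u := by
  simp_rw [walk_mulVec_apply]
  have := h u
  have : ∑ w, (G.adjCount u w : ℝ) * (r w / (G.deg w : ℝ)) ≤
      ∑ w, (G.adjCount u w : ℝ) * (r' w / (G.deg w : ℝ)) := by
    gcongr with w
    exact h w
  linarith

theorem walk_mulVec_nonneg {r : Fin n → ℝ} (h : ∀ u, 0 ≤ r u) (u : Fin n) :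
    0 ≤ Matrix.mulVec G.walk r u := by
  rw [walk_mulVec_apply]
  exact div_nonneg (add_nonneg (Finset.sum_nonneg fun w _ => mul_nonneg (Nat.cast_nonneg _)
    (div_nonneg (h w) (Nat.cast_nonneg _))) (h u)) zero_le_two

theorem walk_mulVec_deg (hd : ∀ u, 0 < G.deg u) (u : Fin n) :
    Matrix.mulVec G.walk (fun w => (G.deg w : ℝ)) u = G.deg u := by
  rw [walk_mulVec_apply]
  have : ∑ w, (G.adjCount u w : ℝ) * ((G.deg w : ℝ) / (G.deg w : ℝ)) = G.deg u := by
    rw [deg, Nat.cast_sum]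
    refine Finset.sum_congr rfl fun w _ => ?_
    have : (G.deg w : ℝ) ≠ 0 := by exact_mod_cast (hd w).ne'
    rw [div_self this, mul_one]
  rw [this]; ring

theorem sum_walk_univ (hd : ∀ u, 0 < G.deg u) (r : Fin n → ℝ) :
    ∑ u, Matrix.mulVec G.walk r u = ∑ u, r u := by
  rw [sum_walk]
  have : ∑ w, (G.degIn Finset.univ w : ℝ) * (r w / (G.deg w : ℝ)) = ∑ w, r w := by
    refine Finset.sum_congr rfl fun w _ => ?_
    have h1 : (G.deg w : ℝ) ≠ 0 := by exact_mod_cast (hd w).ne'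
    have h2 : G.degIn Finset.univ w = G.deg w := by
      unfold degIn deg; simp_rw [G.adjCount_comm w]
    rw [h2, mul_div_cancel₀ _ h1]
  rw [this]; ring

theorem trunc_nonneg {ε : ℝ} {p : Fin n → ℝ} (h : ∀ u, 0 ≤ p u) (u : Fin n) :
    0 ≤ G.trunc ε p u := by
  unfold trunc; split_ifs
  · exact h u
  · exact le_rfl

theorem trunc_le {ε : ℝ} {p : Fin n → ℝ} (h : ∀ u, 0 ≤ p u) (u : Fin n) :
    G.trunc ε p u ≤ p u := by
  unfold trunc; split_ifs
  · exact le_rfl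
  · exact h u

theorem le_trunc_add {ε : ℝ} (hε : 0 ≤ ε) (p : Fin n → ℝ) (u : Fin n) :
    p u ≤ G.trunc ε p u + G.deg u * ε := by
  unfold trunc; split_ifs with h
  · have : (0 : ℝ) ≤ G.deg u * ε := by positivity
    linarith
  · linarith [not_le.1 h]

theorem walkVec_nonneg (ε : ℝ) (v : Fin n) (t : ℕ) (u : Fin n) : 0 ≤ G.walkVec ε v t u := by
  induction t generalizing u with
  | zero =>
    unfold walkVec
    by_cases h : u = v
    · subst h; simp
    · simp [Pi.single_eq_of_ne h]
  | succ t ih => exact walk_mulVec_nonneg (trunc_nonneg ih) u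

theorem trunc_zero {p : Fin n → ℝ} (h : ∀ u, 0 ≤ p u) : G.trunc 0 p = p := by
  funext u; simp [trunc, h u]

/-- Threshold `0` removes nothing from a nonnegative vector, so `walkVec 0` is the untruncated walk.
-/
theorem walkVec_zero_succ (v : Fin n) (t : ℕ) :
    G.walkVec 0 v (t + 1) = Matrix.mulVec G.walk (G.walkVec 0 v t) := by
  rw [walkVec, trunc_zero (walkVec_nonneg 0 v t)]

theorem walkVec_le_walkVec_zero (ε : ℝ) (v : Fin n) (t : ℕ) (u : Fin n) :
    G.walkVec ε v t u ≤ G.walkVec 0 v t u := by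
  induction t generalizing u with
  | zero => exact le_rfl
  | succ t ih =>
    rw [walkVec_zero_succ, walkVec]
    exact walk_mulVec_mono (fun w => (trunc_le (walkVec_nonneg ε v t) w).trans (ih w)) u

/-- Each truncation removes at most `ε d` pointwise, and the walk fixes the degree vector `d`, so
these errors add up without spreading. -/
theorem walkVec_zero_le {ε : ℝ} (hd : ∀ u, 0 < G.deg u) (hε : 0 ≤ ε) (v : Fin n) (t : ℕ)
    (u : Fin n) : G.walkVec 0 v t u ≤ G.walkVec ε v t u + t * (G.deg u * ε) := by
  induction t generalizing u with
  | zero => simp [walkVec]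
  | succ t ih =>
    have h : ∀ w, G.walkVec 0 v t w ≤
        (G.trunc ε (G.walkVec ε v t) + ((t + 1) * ε) • fun w => (G.deg w : ℝ)) w := fun w => by
      have := le_trunc_add (G := G) hε (G.walkVec ε v t) w
      have := ih w
      simp only [Pi.add_apply, Pi.smul_apply, smul_eq_mul]
      linarith
    have := walk_mulVec_mono (G := G) h u
    rw [Matrix.mulVec_add, Matrix.mulVec_smul, Pi.add_apply, Pi.smul_apply, walk_mulVec_deg hd,
      ← walkVec_zero_succ, smul_eq_mul] at this
    change _ ≤ Matrix.mulVec G.walk (G.trunc ε (G.walkVec ε v t)) u + _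
    push_cast
    linarith

theorem walkVec_zero_le_trunc {ε : ℝ} (hd : ∀ u, 0 < G.deg u) (hε : 0 ≤ ε) (v : Fin n) (t : ℕ)
    (u : Fin n) : G.walkVec 0 v t u ≤
      G.trunc ε (G.walkVec ε v t) u + (t + 1) * ε * G.deg u := by
  have := walkVec_zero_le hd hε v t u
  have := le_trunc_add (G := G) hε (G.walkVec ε v t) u
  linarith

theorem sum_walkVec_zero (hd : ∀ u, 0 < G.deg u) (v : Fin n) (t : ℕ) :
    ∑ u, G.walkVec 0 v t u = 1 := by
  induction t with
  | zero => simp [walkVec]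
  | succ t ih => rw [walkVec_zero_succ, sum_walk_univ hd, ih]

theorem sum_walkVec_le_one (hd : ∀ u, 0 < G.deg u) (ε : ℝ) (v : Fin n) (t : ℕ)
    (S : Finset (Fin n)) : ∑ u ∈ S, G.walkVec ε v t u ≤ 1 := by
  rw [← sum_walkVec_zero hd v t]
  exact (Finset.sum_le_sum fun u _ => walkVec_le_walkVec_zero ε v t u).trans
    (Finset.sum_le_sum_of_subset_of_nonneg (Finset.subset_univ _)
      fun u _ _ => walkVec_nonneg 0 v t u)

/-- A vertex whose only edge is a single self-loop is never reached from elsewhere. -/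
theorem walkVec_eq_zero_of_single_loop (ε : ℝ) {v u : Fin n} (hu : G.deg u = 1 ∧ G.loops u = 1)
    (huv : u ≠ v) (t : ℕ) : G.walkVec ε v t u = 0 := by
  induction t with
  | zero => simp [walkVec, Pi.single_eq_of_ne huv]
  | succ t ih =>
    have hr : G.trunc ε (G.walkVec ε v t) u = 0 := by simp [trunc, ih]
    rw [walkVec, walk_mulVec_apply, hr, add_zero, div_eq_zero_iff]
    left
    have hself : G.adjCount u u = 1 := by simp [adjCount, hu.2]
    refine Finset.sum_eq_zero fun w _ => ?_
    by_cases hw : w = u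
    · subst hw; rw [hr]; simp
    · have h1 : G.adjCount u u + G.adjCount u w ≤ G.deg u := by
        rw [← Finset.sum_pair (f := G.adjCount u) (Ne.symm hw)]
        exact Finset.sum_le_sum_of_subset (Finset.subset_univ _)
      have : G.adjCount u w = 0 := by omega
      simp [this]

/-! ### The curve of the walk -/

/-- The curve of `r` lies below `B`. -/
def CurveLE (G : LoopGraph n) (r : Fin n → ℝ) (B : ℝ → ℝ) : Prop :=
  ∀ w : Fin n → ℝ, (∀ z, 0 ≤ w z ∧ w z ≤ 1) → ∑ z, w z * r z ≤ B (∑ z, w z * (G.deg z : ℝ))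

theorem CurveLE.sum_le {r : Fin n → ℝ} {B : ℝ → ℝ} (h : G.CurveLE r B) (S : Finset (Fin n)) :
    ∑ u ∈ S, r u ≤ B (G.vol S) := by
  classical
  have := h (fun z => if z ∈ S then 1 else 0) fun z => by split_ifs <;> norm_num
  simpa [vol] using this

/-- The Lovász–Simonovits step. The mass on `S` after one step is the mean of two fractional weights
of the old vector: the share of edges into `S` on `S` alone, of volume `vol S - cut S`, and all of
`S` plus that share outside, of volume `vol S + cut S`. -/
theorem CurveLE.sum_walk_le (hd : ∀ u, 0 < G.deg u) {r : Fin n → ℝ} {B : ℝ → ℝ}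
    (h : G.CurveLE r B) (S : Finset (Fin n)) :
    ∑ u ∈ S, Matrix.mulVec G.walk r u ≤
      (B ((G.vol S : ℝ) - G.cut S) + B ((G.vol S : ℝ) + G.cut S)) / 2 := by
  classical
  have hd' : ∀ z, (G.deg z : ℝ) ≠ 0 := fun z => by exact_mod_cast (hd z).ne'
  have hf : ∀ z, 0 ≤ (G.degIn S z : ℝ) / G.deg z ∧ (G.degIn S z : ℝ) / G.deg z ≤ 1 := fun z =>
    ⟨by positivity, div_le_one_of_le₀ (by exact_mod_cast G.degIn_le S z) (Nat.cast_nonneg _)⟩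
  have h₁ := h (fun z => if z ∈ S then (G.degIn S z : ℝ) / G.deg z else 0) fun z => by
    split_ifs
    · exact hf z
    · norm_num
  have h₂ := h (fun z => if z ∈ S then 1 else (G.degIn S z : ℝ) / G.deg z) fun z => by
    split_ifs
    · norm_num
    · exact hf z
  have e₁ : ∑ z, (if z ∈ S then (G.degIn S z : ℝ) / G.deg z else 0) * (G.deg z : ℝ) =
      (G.vol S : ℝ) - G.cut S := by
    rw [← G.sum_degIn S]
    simp only [ite_mul, zero_mul, Finset.sum_ite_mem, Finset.univ_inter, div_mul_cancel₀ _ (hd' _)]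
    push_cast; ring
  have e₂ : ∑ z, (if z ∈ S then 1 else (G.degIn S z : ℝ) / G.deg z) * (G.deg z : ℝ) =
      (G.vol S : ℝ) + G.cut S := by
    rw [← G.sum_degIn_compl S, vol, ← Finset.sum_add_sum_compl S]
    push_cast
    congr 1
    · exact Finset.sum_congr rfl fun z hz => by rw [if_pos hz, one_mul]
    · exact Finset.sum_congr rfl fun z hz => by
        rw [if_neg (Finset.mem_compl.1 hz), div_mul_cancel₀ _ (hd' _)]
  rw [e₁] at h₁
  rw [e₂] at h₂
  rw [sum_walk]
  have e₃ : ∑ w, (G.degIn S w : ℝ) * (r w / (G.deg w : ℝ)) + ∑ u ∈ S, r u =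
      ∑ z, (if z ∈ S then (G.degIn S z : ℝ) / G.deg z else 0) * r z +
        ∑ z, (if z ∈ S then 1 else (G.degIn S z : ℝ) / G.deg z) * r z := by
    rw [← Finset.univ_inter S, ← Finset.sum_ite_mem, ← Finset.sum_add_distrib,
      ← Finset.sum_add_distrib]
    refine Finset.sum_congr rfl fun z _ => ?_
    simp only [Finset.univ_inter]
    split_ifs <;> ring
  rw [e₃]
  linarith

/-- The bound on the curve after `t` steps. -/
noncomputable def envelope (G : LoopGraph n) (φ α β : ℝ) (t : ℕ) (x : ℝ) : ℝ :=
  α + β * x + (1 - φ ^ 2 / 10) ^ t * profile G.edges x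

theorem vol_univ_eq (G : LoopGraph n) : (G.vol Finset.univ : ℝ) = 2 * G.edges := by
  unfold edges; ring

theorem vol_le (G : LoopGraph n) (S : Finset (Fin n)) : (G.vol S : ℝ) ≤ 2 * G.edges := by
  rw [← vol_univ_eq]; exact_mod_cast G.vol_mono (Finset.subset_univ S)

theorem concaveOn_envelope (hm : 1 < G.edges) {φ : ℝ} (hφ : 0 < φ) (hφ1 : φ < 1) (α β : ℝ)
    (t : ℕ) : ConcaveOn ℝ (Set.Icc 0 (G.vol Finset.univ : ℝ)) (G.envelope φ α β t) := by
  rw [vol_univ_eq]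
  have hlam : (0 : ℝ) ≤ (1 - φ ^ 2 / 10) ^ t := pow_nonneg (by nlinarith) _
  have h₁ := (concaveOn_profile (m := G.edges) (by linarith)).smul hlam
  have h₂ : ConcaveOn ℝ (Set.Icc 0 (2 * G.edges)) fun x => α + β * x :=
    ⟨convex_Icc _ _, fun x _ y _ a b _ _ hab => by
      simp only [smul_eq_mul]; exact le_of_eq (by linear_combination α * hab)⟩
  exact h₂.add h₁

/-- One step of the walk contracts the envelope at a set with many edges leaving it. -/
theorem sum_walk_le_envelope (hd : ∀ u, 0 < G.deg u) (hm : 1 < G.edges) {φ : ℝ} (hφ : 0 < φ)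
    (hφ1 : φ < 1) {α β : ℝ} {t : ℕ} {r : Fin n → ℝ} (h : G.CurveLE r (G.envelope φ α β t))
    {S : Finset (Fin n)} (hS : 0 < G.vol S) (hS' : (G.vol S : ℝ) ≤ 3 / 2 * G.edges)
    (hcut : φ * min (G.vol S : ℝ) (2 * G.edges - G.vol S) ≤ G.cut S) :
    ∑ u ∈ S, Matrix.mulVec G.walk r u ≤ G.envelope φ α β (t + 1) (G.vol S) := by
  refine (h.sum_walk_le hd S).trans ?_
  have hle : (G.cut S : ℝ) ≤ min (G.vol S : ℝ) (2 * G.edges - G.vol S) := by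
    refine le_min (by exact_mod_cast G.cut_le_vol S) ?_
    have h1 := G.cut_le_vol Sᶜ
    rw [cut_compl] at h1
    have h2 := G.vol_add_vol_compl S
    rw [← vol_univ_eq, ← h2]
    push_cast
    have : (G.cut S : ℝ) ≤ G.vol Sᶜ := by exact_mod_cast h1
    linarith
  have := profile_contract (m := G.edges) (by linarith) (x := G.vol S) (by exact_mod_cast hS) hS'
    hφ.le hcut hle
  have hlam : (0 : ℝ) ≤ (1 - φ ^ 2 / 10) ^ t := pow_nonneg (by nlinarith) _
  have := mul_le_mul_of_nonneg_left this hlam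
  unfold envelope
  rw [pow_succ (1 - φ ^ 2 / 10) t]
  linarith

theorem envelope_mono (hm : 1 < G.edges) {φ : ℝ} (hφ : 0 < φ) (hφ1 : φ < 1) {α β : ℝ}
    (hβ : 0 ≤ β) (t : ℕ) {x y : ℝ} (h0 : 0 ≤ x) (hxy : x ≤ y) (hy : y ≤ 3 / 2 * G.edges) :
    G.envelope φ α β t x ≤ G.envelope φ α β t y := by
  have hlam : (0 : ℝ) ≤ (1 - φ ^ 2 / 10) ^ t := pow_nonneg (by nlinarith) _
  have h1 := mul_le_mul_of_nonneg_left (profile_mono (by linarith) h0 hxy hy) hlam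
  have h2 := mul_le_mul_of_nonneg_left hxy hβ
  unfold envelope
  linarith

/-- Beyond volume `3m/2` the linear term alone exceeds the total mass, so contraction is needed only
below it. -/
theorem one_le_envelope (hm : 1 < G.edges) {φ : ℝ} (hφ : 0 < φ) (hφ1 : φ < 1) {α β : ℝ}
    (hα : 0 ≤ α) (hβ : 1 ≤ β * (3 / 2 * G.edges)) (t : ℕ) {x : ℝ} (hx : 3 / 2 * G.edges ≤ x)
    (hx' : x ≤ 2 * G.edges) : 1 ≤ G.envelope φ α β t x := by
  have hlam : (0 : ℝ) ≤ (1 - φ ^ 2 / 10) ^ t := pow_nonneg (by nlinarith) _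
  have h1 := mul_nonneg hlam (profile_nonneg (m := G.edges) (by linarith) (by linarith) hx')
  have hβ0 : 0 ≤ β := by
    by_contra hn
    nlinarith
  have h2 := mul_le_mul_of_nonneg_left hx hβ0
  unfold envelope
  linarith

theorem curveLE_envelope_zero (hd : ∀ u, 0 < G.deg u) (hm : 1 < G.edges) {φ : ℝ} (hφ : 0 < φ)
    (hφ1 : φ < 1) {α β : ℝ} (hα : 0 ≤ α) (hβ : 1 ≤ β * (3 / 2 * G.edges)) (ε : ℝ) (v : Fin n) :
    G.CurveLE (G.trunc ε (G.walkVec ε v 0)) (G.envelope φ α β 0) := by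
  intro w hw
  set x := ∑ z, w z * (G.deg z : ℝ) with hx
  have hwx : w v ≤ x := by
    have h1 : w v * (G.deg v : ℝ) ≤ x :=
      Finset.single_le_sum (f := fun z => w z * (G.deg z : ℝ))
        (fun z _ => mul_nonneg (hw z).1 (Nat.cast_nonneg _)) (Finset.mem_univ v)
    have h2 : (1 : ℝ) ≤ G.deg v := by exact_mod_cast hd v
    nlinarith [(hw v).1]
  have hsum : ∑ z, w z * G.trunc ε (G.walkVec ε v 0) z ≤ w v := by
    calc ∑ z, w z * G.trunc ε (G.walkVec ε v 0) z ≤ ∑ z, w z * G.walkVec ε v 0 z :=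
          Finset.sum_le_sum fun z _ => mul_le_mul_of_nonneg_left
            (trunc_le (walkVec_nonneg ε v 0) z) (hw z).1
      _ = w v := by simp [walkVec, Pi.single_apply]
  refine hsum.trans ?_
  have hx2 : x ≤ 2 * G.edges := by
    rw [← vol_univ_eq, vol, Nat.cast_sum]
    exact Finset.sum_le_sum fun z _ => mul_le_of_le_one_left (Nat.cast_nonneg _) (hw z).2
  rcases le_total x (3 / 2 * G.edges) with h | h
  · have h1 := le_profile hm.le h (hw v).1 hwx (hw v).2
    have hβ0 : 0 ≤ β := by
      by_contra hn
      nlinarith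
    have h2 := mul_nonneg hβ0 ((hw v).1.trans hwx)
    unfold envelope
    rw [pow_zero]
    linarith
  · exact (hw v).2.trans (one_le_envelope hm hφ hφ1 hα hβ 0 h hx2)

/-- The vertices surviving the truncation form a sweep set. -/
theorem exists_sweep_eq_survivors (hd : ∀ u, 0 < G.deg u) (ε : ℝ) (p : Fin n → ℝ) :
    ∃ J ≤ n, ∀ u, u ∈ G.sweep p J ↔ (G.deg u : ℝ) * ε ≤ p u := by
  classical
  have hd' : ∀ z, (0 : ℝ) < G.deg z := fun z => by exact_mod_cast hd z
  let U := Finset.univ.filter fun u => (G.deg u : ℝ) * ε ≤ p u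
  refine ⟨U.card, by simpa using Finset.card_le_univ U, fun u => ?_⟩
  rw [G.sweep_card_eq, Finset.mem_filter]
  · simp
  · intro u hu w hw
    simp only [U, Finset.mem_filter, Finset.mem_univ, true_and] at hu ⊢
    have := hw.div_le
    rw [mul_comm, ← le_div_iff₀ (hd' _)] at hu ⊢
    exact hu.trans this

/-- If `Nibble` at scale `b` does not have to stop up to time `T`, then the curve of the truncated
walk stays below the envelope, provided it does so at the sweep sets of small volume. -/
theorem curveLE_of_not_mustStop (hd : ∀ u, 0 < G.deg u) (hm : 1 < G.edges) {φ : ℝ} (hφ : 0 < φ)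
    (hφ1 : φ < 1) {b : ℕ} (hε : 0 < G.eps φ b) (hb : (2 : ℝ) ^ b ≤ 2 * G.edges) {v : Fin n}
    {T : ℕ} (hno : ∀ s ∈ Finset.Icc 1 T, ¬ G.MustStop φ b (G.walkVec (G.eps φ b) v s))
    {α β : ℝ} (hα : 0 ≤ α) (hβ : 1 ≤ β * (3 / 2 * G.edges))
    (hβ' : 1 / (140 * ((G.ell : ℝ) + 2) * 2 ^ b) ≤ β)
    (hsmall : ∀ t < T, ∀ j,
      G.CurveLE (G.trunc (G.eps φ b) (G.walkVec (G.eps φ b) v t)) (G.envelope φ α β t) →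
      (∀ u ∈ G.sweep (G.walkVec (G.eps φ b) v (t + 1)) j,
        0 < G.walkVec (G.eps φ b) v (t + 1) u) →
      (G.vol (G.sweep (G.walkVec (G.eps φ b) v (t + 1)) j) : ℝ) < 2 ^ b →
      ∑ u ∈ G.sweep (G.walkVec (G.eps φ b) v (t + 1)) j, G.walkVec (G.eps φ b) v (t + 1) u ≤
        G.envelope φ α β (t + 1) (G.vol (G.sweep (G.walkVec (G.eps φ b) v (t + 1)) j))) :
    ∀ t ≤ T, G.CurveLE (G.trunc (G.eps φ b) (G.walkVec (G.eps φ b) v t))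
      (G.envelope φ α β t) := by
  classical
  have hβ0 : 0 ≤ β := by
    by_contra hn
    nlinarith
  have hlam : ∀ t, (0 : ℝ) ≤ (1 - φ ^ 2 / 10) ^ t := fun t => pow_nonneg (by nlinarith) _
  intro t
  induction t with
  | zero => intro _; exact curveLE_envelope_zero hd hm hφ hφ1 hα hβ _ v
  | succ t ih =>
    intro ht
    have ih := ih (by omega)
    set ε := G.eps φ b
    set q := G.walkVec ε v (t + 1) with hq
    have hno := hno (t + 1) (Finset.mem_Icc.2 ⟨by omega, ht⟩)
    have hsmall := hsmall t (by omega)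
    obtain ⟨J, -, hJ⟩ := exists_sweep_eq_survivors hd ε q
    have hq0 : ∀ u, 0 ≤ q u := walkVec_nonneg ε v (t + 1)
    have hpos : ∀ u, (G.deg u : ℝ) * ε ≤ q u → 0 < q u := fun u h =>
      lt_of_lt_of_le (mul_pos (by exact_mod_cast hd u) hε) h
    have hq1 : ∀ S : Finset (Fin n), ∑ u ∈ S, q u ≤ 1 := sum_walkVec_le_one hd ε v (t + 1)
    have hknot : ∀ j ≤ J, ∑ z ∈ G.sweep q j, q z ≤
        G.envelope φ α β (t + 1) (G.vol (G.sweep q j)) := by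
      intro j hj
      have hsurv : ∀ u ∈ G.sweep q j, (G.deg u : ℝ) * ε ≤ q u := fun u hu =>
        (hJ u).1 (G.sweep_mono q hj hu)
      rcases le_total (3 / 2 * G.edges) (G.vol (G.sweep q j) : ℝ) with h3 | h3
      · exact (hq1 _).trans (one_le_envelope hm hφ hφ1 hα hβ _ h3 (G.vol_le _))
      rcases lt_or_ge (G.vol (G.sweep q j) : ℝ) (2 ^ b) with h4 | h4
      · exact hsmall j ih (fun u hu => hpos u (hsurv u hu)) h4
      have h4' : 2 ^ b ≤ G.vol (G.sweep q j) := by exact_mod_cast h4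
      have hvpos : 0 < G.vol (G.sweep q j) := lt_of_lt_of_le (by positivity) h4'
      by_cases hcut : φ * min (G.vol (G.sweep q j) : ℝ) (2 * G.edges - G.vol (G.sweep q j)) ≤
          G.cut (G.sweep q j)
      · exact sum_walk_le_envelope hd hm hφ hφ1 ih hvpos h3 hcut
      -- The set has volume between `2^b` and `3m/2 = (3/4) vol V`, conductance at most `φ`, and
      -- only survivors. As no stop is forced, it is the slope condition that fails.
      have hslope : G.curveSlope q (2 ^ b) < 1 / (140 * ((G.ell : ℝ) + 2) * 2 ^ b) := by
        by_contra hs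
        refine hno ⟨j, fun u hu => ?_, ?_, ?_, h4', not_lt.1 hs⟩
        · rw [trunc, if_pos (hsurv u hu)]
          exact hpos u (hsurv u hu)
        · have hne : G.sweep q j ≠ ∅ := by
            intro h0
            rw [h0] at hvpos
            simp [vol] at hvpos
          have hc : ((min (G.vol (G.sweep q j)) (G.vol (G.sweep q j)ᶜ) : ℕ) : ℝ) =
              min (G.vol (G.sweep q j) : ℝ) (2 * G.edges - G.vol (G.sweep q j)) := by
            rw [← vol_univ_eq, ← G.vol_add_vol_compl (G.sweep q j)]
            push_cast
            congr 1
            ring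
          rw [conductance, if_neg hne, hc]
          have : 0 < min (G.vol (G.sweep q j) : ℝ) (2 * G.edges - G.vol (G.sweep q j)) :=
            lt_min (by exact_mod_cast hvpos) (by linarith)
          rw [div_le_iff₀ this]
          exact (not_le.1 hcut).le
        · rw [vol_univ_eq]; linarith
      obtain ⟨u, hu₁, hu₂⟩ := G.exists_vol_sweep q (x := 2 ^ b) (by positivity)
        (by rw [vol_univ_eq]; exact hb)
      rw [curveSlope_eq hd q u hu₁ hu₂] at hslope
      have hkj : G.rank q u < j := by
        by_contra hn
        have := G.vol_mono (G.sweep_mono q (not_lt.1 hn))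
        exact absurd (hu₁.trans_le h4) (not_lt.2 (by exact_mod_cast this))
      -- The knot just below `2^b` is covered by the small-volume hypothesis; from there on the
      -- curve lies below a line of slope at most `β`.
      have e₁ := hsmall (G.rank q u) ih
        (fun z hz => hpos z (hsurv z (G.sweep_mono q hkj.le hz))) hu₁
      have e₂ := sum_weight_le hd q u (w := fun z => if z ∈ G.sweep q j then 1 else 0)
        fun z => by split_ifs <;> norm_num
      simp only [ite_mul, one_mul, zero_mul, Finset.sum_ite_mem, Finset.univ_inter] at e₂
      rw [← Nat.cast_sum] at e₂
      change _ ≤ _ + _ * ((G.vol (G.sweep q j) : ℝ) - _) at e₂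
      have hvv : (G.vol (G.sweep q (G.rank q u)) : ℝ) ≤ G.vol (G.sweep q j) := by
        exact_mod_cast G.vol_mono (G.sweep_mono q hkj.le)
      have e₃ := mul_le_mul_of_nonneg_right (hslope.le.trans hβ') (sub_nonneg.2 hvv)
      have e₄ := mul_le_mul_of_nonneg_left (profile_mono (m := G.edges) (by linarith)
        (Nat.cast_nonneg _) hvv h3) (hlam (t + 1))
      unfold envelope at e₁ ⊢
      linarith
    intro w hw
    -- Truncation ignores weight outside the survivors, so the weight may be cut down to the sweep
    -- set `J`. This lowers its volume, which is harmless because the envelope increases up to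
    -- `3m/2`.
    set w' : Fin n → ℝ := fun z => if z ∈ G.sweep q J then w z else 0 with hw'
    have hw'01 : ∀ z, 0 ≤ w' z ∧ w' z ≤ 1 := fun z => by
      simp only [hw']; split_ifs
      · exact hw z
      · norm_num
    have e₁ : ∑ z, w z * G.trunc ε q z = ∑ z, w' z * q z := by
      refine Finset.sum_congr rfl fun z _ => ?_
      simp only [hw', trunc, ← hJ]
      split_ifs <;> simp
    have hx' : ∑ z, w' z * (G.deg z : ℝ) ≤ ∑ z, w z * (G.deg z : ℝ) :=
      Finset.sum_le_sum fun z _ => mul_le_mul_of_nonneg_right (by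
        simp only [hw']; split_ifs
        · exact le_rfl
        · exact (hw z).1) (Nat.cast_nonneg _)
    have hx'' : ∑ z, w' z * (G.deg z : ℝ) ≤ (G.vol (G.sweep q J) : ℝ) := by
      simp only [hw', ite_mul, zero_mul, Finset.sum_ite_mem, Finset.univ_inter]
      rw [vol, Nat.cast_sum]
      exact Finset.sum_le_sum fun z _ => mul_le_of_le_one_left (Nat.cast_nonneg _) (hw z).2
    have hx2 : ∑ z, w z * (G.deg z : ℝ) ≤ 2 * G.edges := by
      rw [← vol_univ_eq, vol, Nat.cast_sum]
      exact Finset.sum_le_sum fun z _ => mul_le_of_le_one_left (Nat.cast_nonneg _) (hw z).2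
    rw [e₁]
    rcases le_total (∑ z, w z * (G.deg z : ℝ)) (3 / 2 * G.edges) with h | h
    · exact (sum_weight_le_of_concave hd (concaveOn_envelope hm hφ hφ1 α β (t + 1)) hknot hw'01
        hx'').trans (envelope_mono hm hφ hφ1 hβ0 _ (Finset.sum_nonneg fun z _ =>
          mul_nonneg (hw'01 z).1 (Nat.cast_nonneg _)) hx' h)
    · refine le_trans ?_ ((hq1 Finset.univ).trans (one_le_envelope hm hφ hφ1 hα hβ _ h hx2))
      exact Finset.sum_le_sum fun z _ => mul_le_of_le_one_left (hq0 z) (hw'01 z).2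

end LoopGraph

namespace LoopGraph

variable {n : ℕ} {G : LoopGraph n}

/-! ### The parameters -/

theorem ell_pos (hm : 1 < G.edges) : 1 ≤ G.ell :=
  Nat.ceil_pos.2 (Real.logb_pos one_lt_two hm)

theorem edges_le_two_pow (hm : 1 < G.edges) : G.edges ≤ 2 ^ G.ell := by
  have h : Real.logb 2 G.edges ≤ G.ell := Nat.le_ceil _
  rw [Real.logb_le_iff_le_rpow one_lt_two (by linarith)] at h
  exact_mod_cast h

theorem ell_lt (hm : 1 < G.edges) : (G.ell : ℝ) < Real.logb 2 G.edges + 1 :=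
  Nat.ceil_lt_add_one (Real.logb_pos one_lt_two hm).le

theorem two_pow_ell_lt (hm : 1 < G.edges) : (2 : ℝ) ^ G.ell < 2 * G.edges := by
  have h0 : (0 : ℝ) < 2 * G.edges := by linarith
  have h := ell_lt hm
  have h2 : (G.ell : ℝ) < Real.logb 2 (2 * G.edges) := by
    rw [Real.logb_mul two_ne_zero (by linarith), Real.logb_self_eq_one one_lt_two]
    linarith
  rw [Real.lt_logb_iff_rpow_lt one_lt_two h0] at h2
  exact_mod_cast h2

/-- The argument `200 (ℓ + 2) √m` of the logarithm in `t_1`. -/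
noncomputable def logArg (G : LoopGraph n) : ℝ := 200 * ((G.ell : ℝ) + 2) * √G.edges

theorem le_logArg (hm : 1 < G.edges) : 200 * ((G.ell : ℝ) + 2) ≤ G.logArg := by
  have : 1 ≤ √G.edges := Real.one_le_sqrt.2 hm.le
  unfold logArg
  exact le_mul_of_one_le_right (by positivity) this

theorem one_lt_logArg (hm : 1 < G.edges) : 1 < G.logArg := by
  have := le_logArg hm
  have : (0 : ℝ) ≤ G.ell := Nat.cast_nonneg _
  linarith

theorem tOne_pos (hm : 1 < G.edges) {φ : ℝ} (hφ : 0 < φ) : 0 < G.tOne φ :=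
  Nat.ceil_pos.2 (mul_pos (by positivity) (Real.log_pos (one_lt_logArg hm)))

theorem tLast_pos (hm : 1 < G.edges) {φ : ℝ} (hφ : 0 < φ) : 0 < G.tLast φ :=
  Nat.mul_pos (Nat.succ_pos _) (tOne_pos hm hφ)

theorem le_tLast {φ : ℝ} (hφ : 0 < φ) :
    2 * ((G.ell : ℝ) + 1) * Real.log G.logArg ≤ φ ^ 2 * G.tLast φ := by
  have h : 2 / φ ^ 2 * Real.log G.logArg ≤ G.tOne φ := Nat.le_ceil _
  rw [div_mul_eq_mul_div, div_le_iff₀ (by positivity)] at h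
  unfold tLast
  push_cast
  have : (0 : ℝ) ≤ G.ell + 1 := by positivity
  nlinarith [mul_le_mul_of_nonneg_left h this]

theorem eps_pos (hm : 1 < G.edges) {φ : ℝ} (hφ : 0 < φ) (b : ℕ) : 0 < G.eps φ b := by
  have : (0 : ℝ) < G.tLast φ := by exact_mod_cast tLast_pos hm hφ
  unfold eps
  positivity

theorem tLast_mul_eps (hm : 1 < G.edges) {φ : ℝ} (hφ : 0 < φ) (b : ℕ) :
    G.tLast φ * G.eps φ b = 1 / (1800 * ((G.ell : ℝ) + 2) * 2 ^ b) := by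
  have : (0 : ℝ) < G.tLast φ := by exact_mod_cast tLast_pos hm hφ
  unfold eps
  field_simp

/-- Writing `X` for `logArg`, the right side is `X^{-(ℓ+1)/5}`: the rate `φ²/10` meets the factor
`2/φ²` in `t_1`. -/
theorem decay_le {φ : ℝ} (hφ : 0 < φ) (hφ1 : φ < 1) :
    (1 - φ ^ 2 / 10) ^ G.tLast φ ≤ Real.exp (-(Real.log G.logArg / 5)) ^ (G.ell + 1) := by
  have h1 : (1 - φ ^ 2 / 10) ^ G.tLast φ ≤ Real.exp (-(φ ^ 2 / 10)) ^ G.tLast φ :=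
    pow_le_pow_left₀ (by nlinarith) (by linarith [Real.add_one_le_exp (-(φ ^ 2 / 10))]) _
  refine h1.trans ?_
  rw [← Real.exp_nat_mul, ← Real.exp_nat_mul, Real.exp_le_exp]
  have := le_tLast (G := G) hφ
  push_cast
  linarith

/-- Bounds the profile term at the final time. For `ℓ ≥ 4` the decay is at most `1/X`, which cancels
`√m`. For smaller `ℓ` the exponent `(ℓ+1)/5` is below 1 and a weaker constant has to do. -/
theorem profile_decay_le (hm : 1 < G.edges) {φ : ℝ} (hφ : 0 < φ) (hφ1 : φ < 1) :
    9 / 8 * √G.edges * (1 - φ ^ 2 / 10) ^ G.tLast φ ≤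
      if 4 ≤ G.ell then 1 / 1000 else 27 / 250 := by
  set E := Real.exp (-(Real.log G.logArg / 5)) with hE
  set s := √G.edges with hs
  have hs1 : 1 ≤ s := Real.one_le_sqrt.2 hm.le
  have hs2 : s ^ 2 = G.edges := Real.sq_sqrt (by linarith)
  have hE0 : 0 < E := Real.exp_pos _
  have hX : G.logArg = 200 * ((G.ell : ℝ) + 2) * s := rfl
  have hX1 := one_lt_logArg hm
  have hE5 : E ^ 5 * G.logArg = 1 := by
    rw [hE, ← Real.exp_nat_mul]
    push_cast
    rw [show 5 * -(Real.log G.logArg / 5) = -Real.log G.logArg by ring, Real.exp_neg,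
      Real.exp_log (by linarith), inv_mul_cancel₀ (by linarith)]
  have hE1 : E ≤ 1 := by
    rw [hE, Real.exp_le_one_iff]
    linarith [Real.log_pos hX1]
  have hdec := mul_le_mul_of_nonneg_left (decay_le (G := G) hφ hφ1)
    (show 0 ≤ 9 / 8 * s by positivity)
  refine hdec.trans ?_
  have hell := ell_pos hm
  have hpow := edges_le_two_pow hm
  split_ifs with h4
  · have h1 : E ^ (G.ell + 1) ≤ E ^ 5 := pow_le_pow_of_le_one hE0.le hE1 (by omega)
    have hL : (4 : ℝ) ≤ G.ell := by exact_mod_cast h4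
    have h2 : E ^ 5 * s ≤ 1 / 1200 := by
      rw [hX] at hE5
      have : 0 ≤ E ^ 5 * s := by positivity
      nlinarith
    have h3 := mul_le_mul_of_nonneg_right h1 (show 0 ≤ s by positivity)
    nlinarith
  -- Fifth powers turn the fractional exponent into `E⁵ = 1/X` raised to `ℓ + 1`.
  · have key : (9 / 8 * s * E ^ (G.ell + 1)) ^ 5 ≤ (27 / 250) ^ 5 := by
      have e : (9 / 8 * s * E ^ (G.ell + 1)) ^ 5 = (9 / 8) ^ 5 * s ^ 5 * (E ^ 5) ^ (G.ell + 1) := by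
        rw [mul_pow, mul_pow, ← pow_mul, ← pow_mul, mul_comm 5]
      have hinv : E ^ 5 = 1 / G.logArg := by
        rw [eq_div_iff (by linarith)]; exact hE5
      rcases (show G.ell = 1 ∨ 2 ≤ G.ell by omega) with h1 | h1
      · rw [e, hinv, hX, h1]
        rw [h1] at hpow
        have e2 : (9 / 8 : ℝ) ^ 5 * s ^ 5 * (1 / (200 * (((1 : ℕ) : ℝ) + 2) * s)) ^ (1 + 1) =
            (9 / 8) ^ 5 / 360000 * s ^ 3 := by
          have hs0 : s ≠ 0 := by positivity
          rw [Nat.cast_one, show 200 * ((1 : ℝ) + 2) * s = 600 * s by ring,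
            one_div_pow, mul_pow]
          field_simp
          norm_num
          ring
        rw [e2]
        have h5 : s ≤ 1.4143 := by nlinarith
        have h6 : s ^ 3 ≤ 1.4143 * 2 := by
          have : s ^ 2 ≤ 2 := by rw [hs2]; simpa using hpow
          nlinarith
        calc (9 / 8 : ℝ) ^ 5 / 360000 * s ^ 3 ≤ (9 / 8) ^ 5 / 360000 * (1.4143 * 2) := by gcongr
          _ ≤ _ := by norm_num
      · have h5 : (E ^ 5) ^ (G.ell + 1) ≤ (E ^ 5) ^ 3 :=
          pow_le_pow_of_le_one (by positivity) (pow_le_one₀ hE0.le hE1) (by omega)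
        have h6 : E ^ 5 ≤ 1 / (800 * s) := by
          rw [hinv]
          have : (2 : ℝ) ≤ G.ell := by exact_mod_cast h1
          apply one_div_le_one_div_of_le (by positivity)
          rw [hX]
          nlinarith
        have h7 : (E ^ 5) ^ 3 ≤ (1 / (800 * s)) ^ 3 := pow_le_pow_left₀ (by positivity) h6 3
        have h8 : s ^ 2 ≤ 8 := by
          rw [hs2]
          refine hpow.trans ?_
          have : (2 : ℝ) ^ G.ell ≤ 2 ^ 3 := pow_le_pow_right₀ one_le_two (by omega)
          linarith
        rw [e]
        calc (9 / 8 : ℝ) ^ 5 * s ^ 5 * (E ^ 5) ^ (G.ell + 1)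
            ≤ (9 / 8) ^ 5 * s ^ 5 * (1 / (800 * s)) ^ 3 := by
              gcongr
              exact h5.trans h7
          _ = (9 / 8) ^ 5 / 800 ^ 3 * s ^ 2 := by field_simp
          _ ≤ (9 / 8) ^ 5 / 800 ^ 3 * 8 := by gcongr
          _ ≤ _ := by norm_num
    exact le_of_pow_le_pow_left₀ (by norm_num) (by norm_num) key

/-! ### Passing from one scale to the next -/

/-- Base of the induction over scales, with intercept 0. A nonempty set of volume below 2 is one
vertex of degree 1. A single loop there is excluded at the start `v` and unreachable elsewhere, so
the only edge leaves the set and the contraction step applies. -/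
theorem sum_le_envelope_of_vol_lt_two (hd : ∀ u, 0 < G.deg u) (hm : 1 < G.edges) {φ : ℝ}
    (hφ : 0 < φ) (hφ1 : φ < 1) {ε : ℝ} {v : Fin n} (hv : ¬ (G.deg v = 1 ∧ G.loops v = 1))
    {β : ℝ} {t : ℕ} (h : G.CurveLE (G.trunc ε (G.walkVec ε v t)) (G.envelope φ 0 β t))
    {S : Finset (Fin n)} (hS : ∀ u ∈ S, 0 < G.walkVec ε v (t + 1) u) (hS2 : G.vol S < 2) :
    ∑ u ∈ S, G.walkVec ε v (t + 1) u ≤ G.envelope φ 0 β (t + 1) (G.vol S) := by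
  classical
  have hthree : (3 : ℝ) ≤ 2 * G.edges := by
    have h1 : (2 : ℝ) < G.vol Finset.univ := by rw [vol_univ_eq]; linarith
    have h2 : 3 ≤ G.vol Finset.univ := by exact_mod_cast h1
    rw [← vol_univ_eq]; exact_mod_cast h2
  rcases S.eq_empty_or_nonempty with rfl | ⟨u, hu⟩
  · simp [vol, envelope, profile, unitProfile]
  have hSu : S = {u} := by
    refine Finset.eq_singleton_iff_unique_mem.2 ⟨hu, fun z hz => ?_⟩
    by_contra hne
    have h1 : G.deg z + G.deg u ≤ G.vol S := by
      rw [← Finset.sum_pair (f := G.deg) hne]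
      exact Finset.sum_le_sum_of_subset (by
        intro y hy
        rcases Finset.mem_insert.1 hy with rfl | hy
        · exact hz
        · rw [Finset.mem_singleton.1 hy]; exact hu)
    have := hd z
    have := hd u
    omega
  have hvol : G.vol S = G.deg u := by rw [hSu]; simp [vol]
  have hdu : G.deg u = 1 := by have := hd u; omega
  have hloop : G.loops u ≠ 1 := by
    intro hl
    by_cases huv : u = v
    · exact hv (huv ▸ ⟨hdu, hl⟩)
    · exact (hS u hu).ne' (walkVec_eq_zero_of_single_loop ε ⟨hdu, hl⟩ huv _)
  have hcut : G.cut S = 1 := by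
    have h1 := G.sum_degIn S
    have h2 : G.degIn S u = G.loops u := by rw [hSu]; simp [degIn, adjCount]
    have h3 := G.degIn_le S u
    rw [hvol, hSu, Finset.sum_singleton, ← hSu, h2, hdu] at h1
    rw [h2, hdu] at h3
    omega
  refine sum_walk_le_envelope hd hm hφ hφ1 h (by omega) ?_ ?_
  · rw [hvol, hdu]; push_cast; linarith
  · rw [hvol, hdu, hcut, min_eq_left (by push_cast; linarith)]
    push_cast; linarith

/-- If `Nibble` does not have to stop at any of the scales `1, …, b`, the truncated walk at scale
`b` has spread. -/
theorem curveLE_of_not_mustStop_scales (hd : ∀ u, 0 < G.deg u) (hm : 1 < G.edges) {φ : ℝ}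
    (hφ : 0 < φ) (hφ1 : φ < 1) {v : Fin n} (hv : ¬ (G.deg v = 1 ∧ G.loops v = 1)) {b : ℕ}
    (hb1 : 1 ≤ b) (hbl : b ≤ G.ell)
    (hsm : ∀ b', 1 ≤ b' → b' < b → 70 * ((G.ell : ℝ) + 2) * 2 ^ b' ≤ 3 / 2 * G.edges)
    (hno : ∀ b', 1 ≤ b' → b' ≤ b → ∀ s ∈ Finset.Icc 1 (G.tLast φ),
      ¬ G.MustStop φ b' (G.walkVec (G.eps φ b') v s))
    {β : ℝ} (hβ : 1 ≤ β * (3 / 2 * G.edges))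
    (hβ' : 1 / (140 * ((G.ell : ℝ) + 2) * 2 ^ b) ≤ β) :
    ∀ t ≤ G.tLast φ, G.CurveLE (G.trunc (G.eps φ b) (G.walkVec (G.eps φ b) v t))
      (G.envelope φ (((b : ℝ) - 1) * (31 / 1000 / ((G.ell : ℝ) + 2))) β t) := by
  have hpow2 : ∀ c ≤ G.ell, (2 : ℝ) ^ c ≤ 2 * G.edges := fun c hc =>
    (pow_le_pow_right₀ one_le_two hc).trans (two_pow_ell_lt hm).le
  have hL : (0 : ℝ) < (G.ell : ℝ) + 2 := by positivity
  have hT1 : (1 : ℝ) ≤ G.tLast φ := by exact_mod_cast tLast_pos hm hφ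
  have hT : (0 : ℝ) < G.tLast φ := by linarith
  induction b, hb1 using Nat.le_induction generalizing β with
  | base =>
    refine curveLE_of_not_mustStop hd hm hφ hφ1 (eps_pos hm hφ 1) (hpow2 1 hbl)
      (hno 1 le_rfl le_rfl) (by norm_num) hβ hβ' ?_
    intro t _ j h1 h2 h3
    simp only [Nat.cast_one, sub_self, zero_mul] at h1 ⊢
    exact sum_le_envelope_of_vol_lt_two hd hm hφ hφ1 hv h1 h2
      (by rw [pow_one] at h3; exact_mod_cast h3)
  | succ b hb1 ih =>
    have hb1' : (1 : ℝ) ≤ b := by exact_mod_cast hb1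
    have hpb : (0 : ℝ) < 2 ^ b := by positivity
    -- The slope used at scale `b` is twice the stopping threshold. Up to volume `2^{b+1}` it still
    -- contributes only `(2/70)/(ℓ+2)`.
    set β' : ℝ := 1 / (70 * ((G.ell : ℝ) + 2) * 2 ^ b) with hβdef
    have ih := ih (by omega) (fun b' h1 h2 => hsm b' h1 (by omega))
      (fun b' h1 h2 => hno b' h1 (by omega)) (β := β')
      (by
        rw [hβdef, one_div_mul_eq_div, one_le_div (by positivity)]
        exact hsm b hb1 (by omega))
      (by
        rw [hβdef]
        apply one_div_le_one_div_of_le (by positivity)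
        nlinarith [mul_pos hL hpb])
    refine curveLE_of_not_mustStop hd hm hφ hφ1 (eps_pos hm hφ (b + 1)) (hpow2 _ hbl)
      (hno (b + 1) (by omega) le_rfl) (by
        push_cast; rw [add_sub_cancel_right]; positivity) hβ hβ' ?_
    intro t ht j _ _ h3
    set S := G.sweep (G.walkVec (G.eps φ (b + 1)) v (t + 1)) j
    have e1 : ∑ u ∈ S, G.walkVec (G.eps φ (b + 1)) v (t + 1) u ≤
        ∑ u ∈ S, G.walkVec 0 v (t + 1) u :=
      Finset.sum_le_sum fun u _ => walkVec_le_walkVec_zero _ v _ u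
    -- The walks truncated at scales `b + 1` and `b` are compared through the untruncated walk: the
    -- former lies below it, the latter within the accumulated truncation error.
    have e2 : ∑ u ∈ S, G.walkVec 0 v (t + 1) u ≤
        ∑ u ∈ S, G.trunc (G.eps φ b) (G.walkVec (G.eps φ b) v (t + 1)) u +
          ((t + 1 : ℕ) + 1) * G.eps φ b * G.vol S := by
      rw [vol, Nat.cast_sum, Finset.mul_sum, ← Finset.sum_add_distrib]
      exact Finset.sum_le_sum fun u _ =>
        walkVec_zero_le_trunc hd (eps_pos hm hφ b).le v (t + 1) u
    have e3 := (ih (t + 1) (by omega)).sum_le S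
    have hvS : (0 : ℝ) ≤ G.vol S := Nat.cast_nonneg _
    rw [pow_succ] at h3
    have e4 : ((t + 1 : ℕ) + 1) * G.eps φ b * G.vol S ≤ 4 / 1800 / ((G.ell : ℝ) + 2) := by
      have h5 : (((t + 1 : ℕ) : ℝ) + 1) ≤ 2 * G.tLast φ := by
        have : ((t + 1 : ℕ) : ℝ) ≤ G.tLast φ := by exact_mod_cast ht
        linarith
      calc ((t + 1 : ℕ) + 1) * G.eps φ b * G.vol S
          ≤ (2 * G.tLast φ) * G.eps φ b * (2 ^ b * 2) := by
            have := (eps_pos hm hφ b).le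
            gcongr
        _ = 4 * (G.tLast φ * G.eps φ b) * 2 ^ b := by ring
        _ = 4 / 1800 / ((G.ell : ℝ) + 2) := by
            rw [tLast_mul_eps hm hφ]; field_simp
    have e5 : β' * G.vol S ≤ 2 / 70 / ((G.ell : ℝ) + 2) := by
      calc β' * G.vol S ≤ β' * (2 ^ b * 2) := by
            have : 0 ≤ β' := by rw [hβdef]; positivity
            gcongr
        _ = 2 / 70 / ((G.ell : ℝ) + 2) := by rw [hβdef]; field_simp
    -- Truncation error plus slope term: `0.00223 + 0.02858 < 0.031`, the increment of the intercept
    -- from one scale to the next.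
    have e6 : 4 / 1800 / ((G.ell : ℝ) + 2) + 2 / 70 / ((G.ell : ℝ) + 2) ≤
        31 / 1000 / ((G.ell : ℝ) + 2) := by
      rw [← add_div]; gcongr; norm_num
    have hβ0 : 0 ≤ β := le_trans (by positivity) hβ'
    have e7 := mul_nonneg hβ0 hvS
    unfold envelope at e3 ⊢
    push_cast
    linarith

/-- A walk that mostly stays in a set of volume at most `2/3 vol(V)` makes `Nibble` stop at some
scale. -/
theorem exists_mustStop (hd : ∀ u, 0 < G.deg u) (hm : 1 < G.edges) {φ : ℝ}
    (hφ : 0 < φ) (hφ1 : φ < 1) {v : Fin n} (hv : ¬ (G.deg v = 1 ∧ G.loops v = 1))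
    {S : Finset (Fin n)} (hS : (G.vol S : ℝ) ≤ 2 / 3 * (G.vol Finset.univ : ℝ))
    (hstay : 1 - 1 / (280 * ((G.ell : ℝ) + 2)) ≤ ∑ u ∈ S, G.walkVec 0 v (G.tLast φ) u) :
    ∃ b ∈ Finset.Icc 1 G.ell, ∃ s ∈ Finset.Icc 1 (G.tLast φ),
      G.MustStop φ b (G.walkVec (G.eps φ b) v s) := by
  classical
  by_contra hno
  push Not at hno
  have hell := ell_pos hm
  have hell' : (1 : ℝ) ≤ G.ell := by exact_mod_cast hell
  have hpow := edges_le_two_pow hm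
  have hex : ∃ b, 1 ≤ b ∧ 3 / 2 * G.edges ≤ 70 * ((G.ell : ℝ) + 2) * 2 ^ b :=
    ⟨G.ell, hell, by
      have : (0 : ℝ) < 2 ^ G.ell := by positivity
      nlinarith⟩
  -- The least scale at which the slope `1/(3m/2)` reaches the required threshold with a factor 2 to
  -- spare. At all smaller scales the slope `1/(70(ℓ+2)2^{b'})` is at least `1/(3m/2)`, as the
  -- envelope requires.
  obtain ⟨b, hb1, hb2, hbmin⟩ : ∃ b, 1 ≤ b ∧ 3 / 2 * G.edges ≤ 70 * ((G.ell : ℝ) + 2) * 2 ^ b ∧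
      ∀ b', 1 ≤ b' → b' < b → 70 * ((G.ell : ℝ) + 2) * 2 ^ b' ≤ 3 / 2 * G.edges :=
    ⟨Nat.find hex, (Nat.find_spec hex).1, (Nat.find_spec hex).2, fun b' h1 h2 => by
      have := Nat.find_min hex h2
      push Not at this
      exact (this h1).le⟩
  have hbl : b ≤ G.ell := by
    by_contra hn
    have h1 := hbmin G.ell hell (by omega)
    have : (0 : ℝ) < 2 ^ G.ell := by positivity
    nlinarith
  have hL : (0 : ℝ) < (G.ell : ℝ) + 2 := by positivity
  have hy : 0 < 3 / 2 * G.edges := by linarith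
  have hcurve := curveLE_of_not_mustStop_scales hd hm hφ hφ1 hv hb1 hbl hbmin
    (fun b' h1 h2 s hs => hno b' (Finset.mem_Icc.2 ⟨h1, h2.trans hbl⟩) s hs)
    (β := 1 / (3 / 2 * G.edges)) (by rw [one_div_mul_cancel hy.ne'])
    (one_div_le_one_div_of_le hy (hb2.trans (by
      have : (0 : ℝ) < ((G.ell : ℝ) + 2) * 2 ^ b := by positivity
      nlinarith))) _ le_rfl
  have e3 := hcurve.sum_le S
  rw [vol_univ_eq] at hS
  have hvS : (0 : ℝ) ≤ G.vol S := Nat.cast_nonneg _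
  have e2 : ∑ u ∈ S, G.walkVec 0 v (G.tLast φ) u ≤
      ∑ u ∈ S, G.trunc (G.eps φ b) (G.walkVec (G.eps φ b) v (G.tLast φ)) u +
        ((G.tLast φ : ℝ) + 1) * G.eps φ b * G.vol S := by
    rw [vol, Nat.cast_sum, Finset.mul_sum, ← Finset.sum_add_distrib]
    exact Finset.sum_le_sum fun u _ =>
      walkVec_zero_le_trunc hd (eps_pos hm hφ b).le v (G.tLast φ) u
  have hT1 : (1 : ℝ) ≤ G.tLast φ := by exact_mod_cast tLast_pos hm hφ
  have e4 : ((G.tLast φ : ℝ) + 1) * G.eps φ b * G.vol S ≤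
      1 / 675 * (G.edges / (((G.ell : ℝ) + 2) * 2 ^ b)) := by
    calc ((G.tLast φ : ℝ) + 1) * G.eps φ b * G.vol S
        ≤ (2 * G.tLast φ) * G.eps φ b * (4 / 3 * G.edges) := by
          have := (eps_pos hm hφ b).le
          gcongr <;> linarith
      _ = 8 / 3 * (G.tLast φ * G.eps φ b) * G.edges := by ring
      _ = 1 / 675 * (G.edges / (((G.ell : ℝ) + 2) * 2 ^ b)) := by
          rw [tLast_mul_eps hm hφ]; field_simp; norm_num
  have e5 : 1 / (3 / 2 * G.edges) * G.vol S ≤ 8 / 9 := by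
    rw [one_div_mul_eq_div, div_le_iff₀ hy]; linarith
  have e6 := profile_le (m := G.edges) (by linarith) hvS (by linarith)
  have e7 := mul_le_mul_of_nonneg_left e6
    (show (0 : ℝ) ≤ (1 - φ ^ 2 / 10) ^ G.tLast φ from pow_nonneg (by nlinarith) _)
  have e8 := profile_decay_le hm hφ hφ1
  unfold envelope at e3
  -- For `ℓ ≥ 4` the mass on `S` is at most `0.031 + 8/9 + 0.001 + 140/2025`, about `0.990`, below
  -- `1 - 1/1680`.
  split_ifs at e8 with h4
  · have h4' : (4 : ℝ) ≤ G.ell := by exact_mod_cast h4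
    have f1 : 1 / (280 * ((G.ell : ℝ) + 2)) ≤ 1 / 1680 :=
      one_div_le_one_div_of_le (by norm_num) (by linarith)
    have f2 : G.edges / (((G.ell : ℝ) + 2) * 2 ^ b) ≤ 140 / 3 := by
      rw [div_le_iff₀ (by positivity)]; linarith
    have f3 : ((b : ℝ) - 1) * (31 / 1000 / ((G.ell : ℝ) + 2)) ≤ 31 / 1000 := by
      rw [mul_div_assoc', div_le_iff₀ hL]
      have : (b : ℝ) ≤ G.ell := by exact_mod_cast hbl
      linarith
    linarith
  -- For `ℓ ≤ 3` the chosen scale is 1, so the intercept vanishes: `8/9 + 0.108 + 4/3375`, about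
  -- `0.9981`, is below `1 - 1/840`.
  · have hm8 : G.edges / ((G.ell : ℝ) + 2) ≤ 8 / 5 := by
      rw [div_le_iff₀ hL]
      have : G.ell = 1 ∨ G.ell = 2 ∨ G.ell = 3 := by omega
      rcases this with h | h | h <;> rw [h] at hpow ⊢ <;> norm_num at hpow ⊢ <;> linarith
    have hb : b = 1 := by
      by_contra hne
      have h1 := hbmin 1 le_rfl (by omega)
      rw [div_le_iff₀ hL] at hm8
      linarith
    subst hb
    have f1 : 1 / (280 * ((G.ell : ℝ) + 2)) ≤ 1 / 840 :=
      one_div_le_one_div_of_le (by norm_num) (by linarith)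
    have f2 : G.edges / (((G.ell : ℝ) + 2) * 2 ^ 1) ≤ 4 / 5 := by
      rw [← div_div]; linarith
    simp only [Nat.cast_one, sub_self, zero_mul] at e3
    linarith

end LoopGraph

namespace LoopGraph

variable {n : ℕ} {G : LoopGraph n}

/-! ### Escaping from a set -/

/-- The walk started from `r` and killed on leaving `S`. -/
noncomputable def killed (G : LoopGraph n) (S : Finset (Fin n)) (r : Fin n → ℝ) :
    ℕ → Fin n → ℝ
  | 0 => r
  | t + 1 => fun u => if u ∈ S then Matrix.mulVec G.walk (killed G S r t) u else 0

theorem killed_nonneg {S : Finset (Fin n)} {r : Fin n → ℝ} (hr : ∀ u, 0 ≤ r u) (t : ℕ)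
    (u : Fin n) : 0 ≤ G.killed S r t u := by
  induction t generalizing u with
  | zero => exact hr u
  | succ t ih =>
    simp only [killed]; split_ifs
    · exact walk_mulVec_nonneg ih u
    · exact le_rfl

theorem killed_le_walkVec (S : Finset (Fin n)) (v : Fin n) (t : ℕ) (u : Fin n) :
    G.killed S (Pi.single v 1) t u ≤ G.walkVec 0 v t u := by
  induction t generalizing u with
  | zero => exact le_rfl
  | succ t ih =>
    simp only [killed]; split_ifs
    · rw [walkVec_zero_succ]; exact walk_mulVec_mono ih u
    · exact walkVec_nonneg 0 v (t + 1) u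

theorem killed_eq_zero {S : Finset (Fin n)} {r : Fin n → ℝ} (hr : ∀ u, u ∉ S → r u = 0) (t : ℕ)
    {u : Fin n} (hu : u ∉ S) : G.killed S r t u = 0 := by
  cases t with
  | zero => exact hr u hu
  | succ t => simp [killed, hu]

theorem sum_killed_antitone (hd : ∀ u, 0 < G.deg u) (S : Finset (Fin n)) {r : Fin n → ℝ}
    (hr : ∀ u, 0 ≤ r u) : Antitone fun t => ∑ u, G.killed S r t u := by
  refine antitone_nat_of_succ_le fun t => ?_
  rw [← sum_walk_univ hd (G.killed S r t)]
  refine Finset.sum_le_sum fun u _ => ?_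
  simp only [killed]; split_ifs
  · exact le_rfl
  · exact walk_mulVec_nonneg (killed_nonneg hr t) u

/-- Linearity in the starting vector: averaging over point starts is the same as running the killed
walk from the averaged vector. -/
theorem sum_mul_killed (S : Finset (Fin n)) (c : Fin n → ℝ) (t : ℕ) (u : Fin n) :
    ∑ v, c v * G.killed S (Pi.single v 1) t u = G.killed S c t u := by
  induction t generalizing u with
  | zero => simp [killed, Pi.single_apply]
  | succ t ih =>
    simp only [killed]
    split_ifs with hu
    · have e : G.killed S c t = ∑ v, c v • G.killed S (Pi.single v 1) t := by
        funext w
        rw [← ih w, Finset.sum_apply]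
        simp
      rw [e, Matrix.mulVec_sum, Finset.sum_apply]
      refine Finset.sum_congr rfl fun v _ => ?_
      rw [Matrix.mulVec_smul, Pi.smul_apply, smul_eq_mul]
    · simp

/-- The killed walk from the degree vector on `S` stays pointwise below the degree vector, which the
walk fixes. Hence each boundary edge carries out at most `1/2` per step. -/
theorem le_sum_killed_deg (hd : ∀ u, 0 < G.deg u) (S : Finset (Fin n)) (t : ℕ) :
    (G.vol S : ℝ) - t * G.cut S / 2 ≤
      ∑ u, G.killed S (fun u => if u ∈ S then (G.deg u : ℝ) else 0) t u := by
  set r : Fin n → ℝ := fun u => if u ∈ S then (G.deg u : ℝ) else 0 with hr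
  have hr0 : ∀ u, 0 ≤ r u := fun u => by
    simp only [hr]; split_ifs
    · exact Nat.cast_nonneg _
    · exact le_rfl
  have hrd : ∀ u, r u ≤ G.deg u := fun u => by
    simp only [hr]; split_ifs
    · exact le_rfl
    · exact Nat.cast_nonneg _
  have hle : ∀ t u, G.killed S r t u ≤ G.deg u := by
    intro t
    induction t with
    | zero => exact hrd
    | succ t ih =>
      intro u
      simp only [killed]; split_ifs
      · exact (walk_mulVec_mono ih u).trans_eq (walk_mulVec_deg hd u)
      · exact Nat.cast_nonneg _
  have hz : ∀ t u, u ∉ S → G.killed S r t u = 0 := fun t u hu =>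
    killed_eq_zero (fun w hw => by simp [hr, hw]) t hu
  induction t with
  | zero => simp [killed, hr, vol]
  | succ t ih =>
    set y := G.killed S r t with hy
    have e1 : ∑ u, G.killed S r (t + 1) u = ∑ u ∈ S, Matrix.mulVec G.walk y u := by
      simp [killed, ← hy]
    have hsplit := sum_walk_univ hd y
    rw [← Finset.sum_add_sum_compl S] at hsplit
    have hout : ∑ u ∈ Sᶜ, Matrix.mulVec G.walk y u ≤ G.cut S / 2 := by
      rw [sum_walk]
      have h1 : ∑ u ∈ Sᶜ, y u = 0 :=
        Finset.sum_eq_zero fun u hu => hz t u (Finset.mem_compl.1 hu)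
      have h2 : ∑ w, (G.degIn Sᶜ w : ℝ) * (y w / (G.deg w : ℝ)) ≤ G.cut S := by
        have h3 := G.sum_degIn_compl Sᶜ
        rw [compl_compl, cut_compl] at h3
        rw [← h3, Nat.cast_sum, ← Finset.sum_subset (Finset.subset_univ S)]
        · refine Finset.sum_le_sum fun w _ => mul_le_of_le_one_right (Nat.cast_nonneg _) ?_
          exact div_le_one_of_le₀ (hle t w) (Nat.cast_nonneg _)
        · intro w _ hw
          rw [hy, hz t w hw]; simp
      rw [h1]
      linarith
    rw [e1]
    push_cast
    linarith

/-- From at least half of `S`, by volume, the walk stays in `S` with high probability. -/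
theorem exists_good_start (hd : ∀ u, 0 < G.deg u) (S : Finset (Fin n)) (T : ℕ) {η : ℝ}
    (hη : 0 < η) (hcut : T * (G.cut S : ℝ) ≤ η * G.vol S) :
    ∃ U ⊆ S, (G.vol S : ℝ) / 2 ≤ G.vol U ∧
      ∀ v ∈ U, ∀ t ≤ T, 1 - η ≤ ∑ u ∈ S, G.walkVec 0 v t u := by
  classical
  set f : Fin n → ℝ := fun v => ∑ u, G.killed S (Pi.single v 1) T u with hf
  have hs0 : ∀ v u, (0 : ℝ) ≤ (Pi.single v 1 : Fin n → ℝ) u := fun v u => by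
    by_cases h : u = v
    · subst h; simp
    · simp [Pi.single_eq_of_ne h]
  have hf1 : ∀ v, f v ≤ 1 := fun v => by
    have := sum_killed_antitone hd S (hs0 v) (Nat.zero_le T)
    simpa [killed] using this
  have hsum : (G.vol S : ℝ) - T * G.cut S / 2 ≤ ∑ v ∈ S, (G.deg v : ℝ) * f v := by
    refine (le_sum_killed_deg hd S T).trans_eq ?_
    rw [Finset.sum_congr rfl fun u _ => (sum_mul_killed S _ T u).symm]
    rw [Finset.sum_comm]
    simp_rw [← Finset.mul_sum, ite_mul, zero_mul, Finset.sum_ite_mem, Finset.univ_inter]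
    rfl
  refine ⟨S.filter fun v => 1 - η ≤ f v, Finset.filter_subset _ _, ?_, ?_⟩
  · have hsplit : (G.vol S : ℝ) = G.vol (S.filter fun v => 1 - η ≤ f v) +
        G.vol (S.filter fun v => ¬ (1 - η ≤ f v)) := by
      unfold vol
      rw [← Nat.cast_add, Finset.sum_filter_add_sum_filter_not]
    -- Markov's inequality: a bad start loses more than `η`, while the total loss is at most `η
    -- vol(S)/2`.
    have hbad : η * G.vol (S.filter fun v => ¬ (1 - η ≤ f v)) ≤
        ∑ v ∈ S, (G.deg v : ℝ) * (1 - f v) := by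
      refine le_trans ?_ (Finset.sum_le_sum_of_subset_of_nonneg
        (Finset.filter_subset (fun v => ¬ (1 - η ≤ f v)) S)
        fun v _ _ => mul_nonneg (Nat.cast_nonneg _) (sub_nonneg.2 (hf1 v)))
      rw [vol, Nat.cast_sum, Finset.mul_sum]
      refine Finset.sum_le_sum fun v hv => ?_
      have := not_le.1 (Finset.mem_filter.1 hv).2
      rw [mul_comm]
      exact mul_le_mul_of_nonneg_left (by linarith) (Nat.cast_nonneg _)
    have he : ∑ v ∈ S, (G.deg v : ℝ) * (1 - f v) =
        G.vol S - ∑ v ∈ S, (G.deg v : ℝ) * f v := by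
      simp_rw [mul_sub, mul_one, Finset.sum_sub_distrib]
      simp [vol]
    rw [he] at hbad
    have h2 : η * (G.vol (S.filter fun v => ¬ (1 - η ≤ f v)) : ℝ) ≤ η * (G.vol S / 2) := by
      linarith
    have := le_of_mul_le_mul_left h2 hη
    linarith
  · intro v hv t ht
    obtain ⟨hvS, hv⟩ := Finset.mem_filter.1 hv
    refine hv.trans ?_
    refine (sum_killed_antitone hd S (hs0 v) ht).trans ?_
    dsimp only
    rw [← Finset.sum_subset (Finset.subset_univ S)]
    · exact Finset.sum_le_sum fun u _ => killed_le_walkVec S v t u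
    · intro u _ hu
      refine killed_eq_zero (fun w hw => ?_) t hu
      exact Pi.single_eq_of_ne (by rintro rfl; exact hw hvS) _

/-! ### Overlap and averaging over the random choices -/

/-- A set returned by `Nibble` overlaps the set in which the walk stays. -/
theorem half_le_vol_inter (hd : ∀ u, 0 < G.deg u) {φ ε : ℝ} {b t j : ℕ} {v : Fin n}
    {S : Finset (Fin n)}
    (hstay : 1 - 1 / (280 * ((G.ell : ℝ) + 2)) ≤ ∑ u ∈ S, G.walkVec 0 v t u)
    (hhalt : G.Stops φ b (G.walkVec ε v t) j) :
    (2 : ℝ) ^ b / 2 ≤ G.vol (G.sweep (G.walkVec ε v t) j ∩ S) := by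
  classical
  obtain ⟨-, -, h3, h4⟩ := hhalt
  set q := G.walkVec ε v t
  have h3' : (2 : ℝ) ^ b ≤ G.vol (G.sweep q j) := by exact_mod_cast h3
  obtain ⟨u, hu₁, hu₂⟩ := G.exists_vol_sweep q (x := 2 ^ b) (by positivity)
    (h3'.trans (by exact_mod_cast G.vol_mono (Finset.subset_univ _)))
  rw [curveSlope_eq hd q u hu₁ hu₂] at h4
  have hkj : G.rank q u + 1 ≤ j := by
    by_contra hn
    have := G.vol_mono (G.sweep_mono q (show j ≤ G.rank q u by omega))
    exact absurd (hu₁.trans_le h3') (not_lt.2 (by exact_mod_cast this))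
  set A := G.sweep q (G.rank q u + 1)
  set θ := 1 / (140 * ((G.ell : ℝ) + 2) * 2 ^ b) with hθ
  have hθ0 : 0 < θ := by positivity
  have hdens : ∀ z ∈ A, (G.deg z : ℝ) * θ ≤ q z := fun z hz => by
    have h5 := h4.trans (G.div_le_of_mem_sweep hz)
    rwa [le_div_iff₀ (by exact_mod_cast hd z), mul_comm] at h5
  -- `A` is the part of the returned set up to the vertex at which the volume reaches `2^b`. Its
  -- density is at least `θ`, so the little mass outside `S` limits the volume of `A` there.
  have hout : θ * G.vol (A \ S) ≤ 1 / (280 * ((G.ell : ℝ) + 2)) := by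
    calc θ * G.vol (A \ S) ≤ ∑ z ∈ A \ S, q z := by
          rw [vol, Nat.cast_sum, Finset.mul_sum]
          refine Finset.sum_le_sum fun z hz => ?_
          rw [mul_comm]
          exact hdens z (Finset.mem_sdiff.1 hz).1
      _ ≤ ∑ z ∈ A \ S, G.walkVec 0 v t z :=
          Finset.sum_le_sum fun z _ => walkVec_le_walkVec_zero ε v t z
      _ ≤ ∑ z ∈ Sᶜ, G.walkVec 0 v t z :=
          Finset.sum_le_sum_of_subset_of_nonneg (fun z hz =>
            Finset.mem_compl.2 (Finset.mem_sdiff.1 hz).2) fun z _ _ => walkVec_nonneg 0 v t z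
      _ ≤ _ := by
          have := sum_walkVec_zero hd v t
          rw [← Finset.sum_add_sum_compl S] at this
          linarith
  have hhalf : (G.vol (A \ S) : ℝ) ≤ 2 ^ b / 2 := by
    have e : 1 / (280 * ((G.ell : ℝ) + 2)) = θ * (2 ^ b / 2) := by
      rw [hθ]; field_simp; norm_num
    rw [e] at hout
    exact le_of_mul_le_mul_left hout hθ0
  have hsplit : (G.vol A : ℝ) = G.vol (A ∩ S) + G.vol (A \ S) := by
    rw [← Nat.cast_add, ← vol_union_disjoint _ (Finset.disjoint_sdiff_inter A S).symm,
      Finset.union_comm, Finset.sdiff_union_inter]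
  have hmono : (G.vol (A ∩ S) : ℝ) ≤ G.vol (G.sweep q j ∩ S) := by
    exact_mod_cast G.vol_mono (Finset.inter_subset_inter_right (G.sweep_mono q hkj))
  linarith

/-- One scale per start suffices: its probability is at least `2^{-b}`, which cancels the gain `c
2^b`. -/
theorem randomNibbleMean_ge (hm : 1 < G.edges) {F : Fin n → ℕ → ℝ}
    (hF : ∀ v b, 0 ≤ F v b) (U : Finset (Fin n)) (c : ℝ)
    (hU : ∀ v ∈ U, ∃ b ∈ Finset.Icc 1 G.ell, c * 2 ^ b ≤ F v b) :
    c * G.vol U / G.vol Finset.univ ≤ G.randomNibbleMean F := by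
  have hV : (0 : ℝ) < G.vol Finset.univ := by rw [vol_univ_eq]; linarith
  have hell := ell_pos hm
  have hN0 : (0 : ℝ) < 1 - (1 / 2) ^ G.ell :=
    sub_pos.2 (pow_lt_one₀ (by norm_num) (by norm_num) (by omega))
  have hN1 : (1 : ℝ) - (1 / 2) ^ G.ell ≤ 1 := by
    have : (0 : ℝ) ≤ (1 / 2) ^ G.ell := by positivity
    linarith
  change _ ≤ ∑ v, ∑ b ∈ Finset.Icc 1 G.ell, ((G.deg v : ℝ) / (G.vol Finset.univ : ℝ)) *
      ((1 / 2 : ℝ) ^ b / (1 - (1 / 2 : ℝ) ^ G.ell)) * F v b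
  have hterm : ∀ v b, 0 ≤ ((G.deg v : ℝ) / (G.vol Finset.univ : ℝ)) *
      ((1 / 2 : ℝ) ^ b / (1 - (1 / 2 : ℝ) ^ G.ell)) * F v b := fun v b =>
    mul_nonneg (by positivity) (hF v b)
  refine le_trans ?_ (Finset.sum_le_sum_of_subset_of_nonneg (Finset.subset_univ U)
    fun v _ _ => Finset.sum_nonneg fun b _ => hterm v b)
  rw [vol, Nat.cast_sum, Finset.mul_sum, Finset.sum_div]
  refine Finset.sum_le_sum fun v hv => ?_
  obtain ⟨b, hb, hcb⟩ := hU v hv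
  refine le_trans ?_ (Finset.single_le_sum (fun b _ => hterm v b) hb)
  have h1 : c ≤ (1 / 2 : ℝ) ^ b * F v b := by
    have := mul_le_mul_of_nonneg_left hcb (show (0 : ℝ) ≤ (1 / 2) ^ b by positivity)
    have e : (1 / 2 : ℝ) ^ b * (c * 2 ^ b) = c := by
      rw [mul_left_comm, ← mul_pow]; norm_num
    linarith
  have h2 : (1 / 2 : ℝ) ^ b * F v b ≤ (1 / 2 : ℝ) ^ b / (1 - (1 / 2 : ℝ) ^ G.ell) * F v b := by
    refine mul_le_mul_of_nonneg_right ?_ (hF v b)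
    exact le_div_self (by positivity) hN0 hN1
  rw [mul_comm c, mul_div_right_comm, mul_assoc]
  exact mul_le_mul_of_nonneg_left (h1.trans h2) (by positivity)

theorem cut_mul_tLast_le (hd : ∀ u, 0 < G.deg u) (hm : 1 < G.edges) {φ : ℝ} (hφ : 0 < φ)
    {S : Finset (Fin n)} (hS : (G.vol S : ℝ) ≤ 2 / 3 * (G.vol Finset.univ : ℝ))
    (hcond : G.conductance S ≤ G.fOne φ) :
    G.tLast φ * (G.cut S : ℝ) ≤ 1 / (280 * ((G.ell : ℝ) + 2)) * G.vol S := by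
  have hT : (0 : ℝ) < G.tLast φ := by exact_mod_cast tLast_pos hm hφ
  rcases S.eq_empty_or_nonempty with rfl | ⟨u, hu⟩
  · simp [cut, vol]
  have hne : S ≠ ∅ := fun h => by simp [h] at hu
  have hvS : 0 < G.vol S :=
    lt_of_lt_of_le (hd u) (Finset.single_le_sum (f := G.deg) (fun _ _ => Nat.zero_le _) hu)
  have hvC : 0 < G.vol Sᶜ := by
    have h1 := G.vol_add_vol_compl S
    have h2 : (G.vol S : ℝ) + G.vol Sᶜ = G.vol Finset.univ := by exact_mod_cast h1
    have hV : (0 : ℝ) < G.vol Finset.univ := by rw [vol_univ_eq]; linarith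
    have : (0 : ℝ) < G.vol Sᶜ := by linarith
    exact_mod_cast this
  have hmin : (0 : ℝ) < ((min (G.vol S) (G.vol Sᶜ) : ℕ) : ℝ) := by
    exact_mod_cast lt_min hvS hvC
  rw [conductance, if_neg hne, div_le_iff₀ hmin] at hcond
  have hle : ((min (G.vol S) (G.vol Sᶜ) : ℕ) : ℝ) ≤ G.vol S := by
    exact_mod_cast min_le_left _ _
  have hf : 0 ≤ G.fOne φ := by unfold fOne; positivity
  have h1 := mul_le_mul_of_nonneg_left (hcond.trans (mul_le_mul_of_nonneg_left hle hf)) hT.le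
  refine h1.trans_eq ?_
  unfold fOne
  field_simp

/-- The overlap guarantee of `RandomNibble`. -/
theorem randomNibble_overlap (hd : ∀ u, 0 < G.deg u) (hm : 1 < G.edges) {φ : ℝ}
    (hφ : 0 < φ) (hφ1 : φ < 1) {C : Fin n → ℕ → Finset (Fin n)}
    (hC : ∀ v, ∀ b ∈ Finset.Icc 1 G.ell, G.IsNibbleOutput φ v b (C v b))
    {S : Finset (Fin n)} (hS : (G.vol S : ℝ) ≤ 2 / 3 * (G.vol Finset.univ : ℝ))
    (hcond : G.conductance S ≤ G.fOne φ) (hloop : ∀ u ∈ S, ¬ (G.deg u = 1 ∧ G.loops u = 1)) :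
    (G.vol S : ℝ) / (4 * (G.vol Finset.univ : ℝ)) ≤
      G.randomNibbleMean (fun v b => (G.vol (C v b ∩ S) : ℝ)) := by
  obtain ⟨U, hUS, hU, hstay⟩ := exists_good_start hd S (G.tLast φ)
    (η := 1 / (280 * ((G.ell : ℝ) + 2))) (by positivity) (cut_mul_tLast_le hd hm hφ hS hcond)
  have hV : (0 : ℝ) < G.vol Finset.univ := by rw [vol_univ_eq]; linarith
  -- The constant `1/2` is the overlap `2^b/2`; together with `vol U ≥ vol S / 2` it yields `1/4`.
  refine le_trans ?_ (randomNibbleMean_ge hm (fun v b => Nat.cast_nonneg _) U (1 / 2)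
    fun v hv => ?_)
  · rw [div_le_div_iff₀ (by positivity) hV]
    nlinarith
  · obtain ⟨b, hb, s, hs, hmust⟩ := exists_mustStop hd hm hφ hφ1 (hloop v (hUS hv)) hS
      (hstay v hv _ le_rfl)
    refine ⟨b, hb, ?_⟩
    -- The returned set may come from a round other than the forced one. The overlap bound still
    -- applies because the walk stays in `S` at every time up to `t_last`.
    rcases hC v b hb with ⟨t, ht, -, j, hhalt, hCj⟩ | ⟨hno, -⟩
    · rw [hCj]
      have := half_le_vol_inter hd (hstay v hv t (Finset.mem_Icc.1 ht).2) hhalt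
      linarith
    · exact absurd hmust (hno s hs)

theorem conductance_le_of_isNibbleOutput {φ : ℝ} {v : Fin n} {b : ℕ} {C : Finset (Fin n)}
    (h : G.IsNibbleOutput φ v b C) (hne : C.Nonempty) :
    G.conductance C ≤ φ ∧ (G.vol C : ℝ) ≤ 5 / 6 * (G.vol Finset.univ : ℝ) := by
  rcases h with ⟨t, -, -, j, hhalt, rfl⟩ | ⟨-, rfl⟩
  · exact ⟨hhalt.1, hhalt.2.1⟩
  · exact absurd hne (by simp)

end LoopGraph

/-! ### Merge sort -/

namespace Timed

variable {α β : Type}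

@[simp] theorem pure_val (a : α) : (pure a : Timed α).val = a := rfl

@[simp] theorem pure_cost (a : α) : (pure a : Timed α).cost = 0 := rfl

@[simp] theorem bind_val (x : Timed α) (f : α → Timed β) : (x >>= f).val = (f x.val).val := rfl

@[simp] theorem bind_cost (x : Timed α) (f : α → Timed β) :
    (x >>= f).cost = x.cost + (f x.val).cost := rfl

@[simp] theorem tick_cost (k : ℕ) : (tick k).cost = k := rfl

variable {le : α → α → Bool}

theorem merge_perm (xs ys : List α) : (merge le xs ys).val.Perm (xs ++ ys) := by
  induction xs, ys using merge.induct with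
  | case1 ys => rw [merge]; simp
  | case2 x xs => rw [merge]; simp
  | case3 x xs y ys ih₁ ih₂ =>
    rw [merge]
    simp only [bind_val]
    split_ifs
    · exact ih₁.cons x
    · exact (ih₂.cons y).trans (List.perm_middle (l₁ := x :: xs)).symm

theorem merge_cost_le (xs ys : List α) :
    (merge le xs ys).cost ≤ 14 * (xs.length + ys.length) + 2 := by
  induction xs, ys using merge.induct with
  | case1 ys => rw [merge]; simp
  | case2 x xs => rw [merge]; simp
  | case3 x xs y ys ih₁ ih₂ =>
    rw [merge]
    simp only [List.length_cons] at ih₁ ih₂ ⊢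
    split_ifs <;> simp only [bind_cost, pure_cost, tick_cost] <;> omega

theorem merge_pairwise (htot : ∀ a c, le a c ∨ le c a)
    (htrans : ∀ a c d, le a c → le c d → le a d) {xs ys : List α}
    (hx : xs.Pairwise fun a c => le a c) (hy : ys.Pairwise fun a c => le a c) :
    (merge le xs ys).val.Pairwise fun a c => le a c := by
  induction xs, ys using merge.induct with
  | case1 ys => rw [merge]; simpa using hy
  | case2 x xs => rw [merge]; simpa using hx
  | case3 x xs y ys ih₁ ih₂ =>
    rw [merge]
    simp only [bind_val]
    split_ifs with h
    · refine List.pairwise_cons.2 ⟨fun z hz => ?_, ih₁ (List.pairwise_cons.1 hx).2 hy⟩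
      rcases List.mem_append.1 ((merge_perm xs (y :: ys)).mem_iff.1 hz) with hz | hz
      · exact (List.pairwise_cons.1 hx).1 z hz
      · rcases List.mem_cons.1 hz with rfl | hz
        · exact h
        · exact htrans _ _ _ h ((List.pairwise_cons.1 hy).1 z hz)
    · have hyx : le y x := (htot x y).resolve_left h
      refine List.pairwise_cons.2 ⟨fun z hz => ?_, ih₂ hx (List.pairwise_cons.1 hy).2⟩
      rcases List.mem_append.1 ((merge_perm (x :: xs) ys).mem_iff.1 hz) with hz | hz
      · rcases List.mem_cons.1 hz with rfl | hz
        · exact hyx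
        · exact htrans _ _ _ hyx ((List.pairwise_cons.1 hx).1 z hz)
      · exact (List.pairwise_cons.1 hy).1 z hz

theorem mergePairs_spec (htot : ∀ a c, le a c ∨ le c a)
    (htrans : ∀ a c d, le a c → le c d → le a d) (l : List (List α))
    (hl : ∀ xs ∈ l, xs.Pairwise fun a c => le a c) :
    (mergePairs le l).val.flatten.Perm l.flatten ∧
      (∀ xs ∈ (mergePairs le l).val, xs.Pairwise fun a c => le a c) ∧
      2 * (mergePairs le l).val.length ≤ l.length + 1 ∧
      (mergePairs le l).cost ≤ 14 * l.flatten.length + 6 * l.length + 2 := by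
  induction l using mergePairs.induct with
  | case1 xs ys rest ih =>
    obtain ⟨h1, h2, h3, h4⟩ := ih fun z hz => hl z (by simp [hz])
    rw [mergePairs]
    simp only [bind_val, pure_val, bind_cost, pure_cost, tick_cost, List.flatten_cons,
      List.length_cons, List.length_append]
    refine ⟨?_, ?_, by omega, ?_⟩
    · rw [← List.append_assoc]
      exact (merge_perm xs ys).append h1
    · intro z hz
      rcases List.mem_cons.1 hz with rfl | hz
      · exact merge_pairwise htot htrans (hl xs (by simp)) (hl ys (by simp))
      · exact h2 z hz
    · have := merge_cost_le (le := le) xs ys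
      omega
  | case2 l h =>
    have e : mergePairs le l = (do tick 2; return l) := by
      rcases l with _ | ⟨a, _ | ⟨c, r⟩⟩
      · rfl
      · rfl
      · exact (h a c r rfl).elim
    have hlen : l.length ≤ 1 := by
      rcases l with _ | ⟨a, _ | ⟨c, r⟩⟩
      · simp
      · simp
      · exact (h a c r rfl).elim
    rw [e]
    simp only [bind_val, pure_val, bind_cost, pure_cost, tick_cost]
    exact ⟨List.Perm.refl _, hl, by omega, by omega⟩

/-- Each round halves the number of runs, rounding up, so fuel `k` suffices for `2^k` runs. -/
theorem mergeRounds_spec (htot : ∀ a c, le a c ∨ le c a)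
    (htrans : ∀ a c d, le a c → le c d → le a d) (k : ℕ) (l : List (List α))
    (hl : ∀ xs ∈ l, xs.Pairwise fun a c => le a c) (hk : l.length ≤ 2 ^ k) :
    (mergeRounds le k l).val.Perm l.flatten ∧
      (mergeRounds le k l).val.Pairwise fun a c => le a c := by
  induction k generalizing l with
  | zero =>
    rcases l with _ | ⟨a, _ | ⟨c, r⟩⟩
    · simp [mergeRounds]
    · simpa [mergeRounds] using hl
    · simp at hk
  | succ k ih =>
    rcases l with _ | ⟨a, _ | ⟨c, r⟩⟩
    · simp [mergeRounds]
    · simpa [mergeRounds] using hl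
    · obtain ⟨h1, h2, h3, -⟩ := mergePairs_spec htot htrans (a :: c :: r) hl
      rw [mergeRounds]
      simp only [bind_val]
      have := ih _ h2 (by rw [pow_succ] at hk; omega)
      exact ⟨this.1.trans h1, this.2⟩

/-- The exponent `j` counting the rounds is separate from the fuel `k`: `sort` supplies fuel equal
to the list length, but the cost grows only with the logarithm. -/
theorem mergeRounds_cost_le (htot : ∀ a c, le a c ∨ le c a)
    (htrans : ∀ a c d, le a c → le c d → le a d) (k j N : ℕ) (l : List (List α))
    (hl : ∀ xs ∈ l, xs.Pairwise fun a c => le a c) (hj : l.length ≤ 2 ^ j) (hN : l.length ≤ N)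
    (hF : l.flatten.length ≤ N) :
    (mergeRounds le k l).cost ≤ j * (20 * N + 4) + 2 := by
  induction k generalizing l j with
  | zero => rcases l with _ | ⟨a, _ | ⟨c, r⟩⟩ <;> simp [mergeRounds]
  | succ k ih =>
    rcases l with _ | ⟨a, _ | ⟨c, r⟩⟩
    · simp [mergeRounds]
    · simp [mergeRounds]
    · obtain ⟨h1, h2, h3, h4⟩ := mergePairs_spec htot htrans (a :: c :: r) hl
      rcases j with _ | j
      · simp at hj
      rw [mergeRounds]
      simp only [bind_cost, tick_cost]
      have hlen : 2 ≤ (a :: c :: r).length := by simp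
      rw [pow_succ] at hj
      have := ih j _ h2 (by omega) (by omega) (by rw [h1.length_eq]; exact hF)
      have e : (j + 1) * (20 * N + 4) = j * (20 * N + 4) + (20 * N + 4) := by ring
      rw [e]
      omega

theorem sort_spec (htot : ∀ a c, le a c ∨ le c a)
    (htrans : ∀ a c d, le a c → le c d → le a d) (l : List α) :
    (sort le l).val.Perm l ∧ (sort le l).val.Pairwise fun a c => le a c := by
  have hflat : (l.map fun x => [x]).flatten = l := by
    induction l with
    | nil => rfl
    | cons a l ih => simp [ih]
  have := mergeRounds_spec htot htrans l.length (l.map fun x => [x])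
    (by intro xs hxs; obtain ⟨x, -, rfl⟩ := List.mem_map.1 hxs; simp)
    (by rw [List.length_map]; exact Nat.lt_two_pow_self.le)
  rw [hflat] at this
  exact this

theorem sort_cost_le (htot : ∀ a c, le a c ∨ le c a)
    (htrans : ∀ a c d, le a c → le c d → le a d) (l : List α) {j : ℕ} (hj : l.length ≤ 2 ^ j) :
    (sort le l).cost ≤ 4 * l.length + 2 + (j * (20 * l.length + 4) + 2) := by
  have hflat : (l.map fun x => [x]).flatten.length = l.length := by simp [Function.comp_def]
  exact Nat.add_le_add_left (mergeRounds_cost_le htot htrans l.length j l.length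
    (l.map fun x => [x])
    (by intro xs hxs; obtain ⟨x, -, rfl⟩ := List.mem_map.1 hxs; simp)
    (by rwa [List.length_map]) (by rw [List.length_map]) hflat.le) _

end Timed

/-! ### Sparse multiplication by the walk matrix -/

/-- The cells in use are listed once each and are exactly the nonzero ones. -/
def Cells.Valid {n : ℕ} (s : Cells n) : Prop :=
  s.used.Nodup ∧ (∀ w, w ∈ s.used ↔ s.arr w ≠ 0) ∧ ∀ w, 0 ≤ s.arr w

namespace LoopGraph

open Timed

variable {n : ℕ} {G : LoopGraph n}

theorem nodup_nbrs (G : LoopGraph n) (u : Fin n) : (G.nbrs u).Nodup :=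
  (List.nodup_finRange n).filter _

theorem mem_nbrs {u w : Fin n} : w ∈ G.nbrs u ↔ G.graph.Adj u w := by
  simp [nbrs]

theorem adjCount_of_ne {u w : Fin n} (h : u ≠ w) :
    G.adjCount u w = if w ∈ G.nbrs u then 1 else 0 := by
  classical
  rw [adjCount, if_neg h]
  simp [mem_nbrs]

theorem sum_adjCount_eq_length (u : Fin n) {S : Finset (Fin n)} (hu : u ∉ S) :
    ∑ w ∈ S, G.adjCount u w = ((G.nbrs u).filter (· ∈ S)).length := by
  classical
  rw [← List.toFinset_card_of_nodup ((G.nodup_nbrs u).filter _), List.toFinset_filter,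
    Finset.card_filter, ← Finset.sum_filter, Finset.sum_filter, ← Finset.sum_filter]
  rw [Finset.sum_congr rfl fun w hw =>
    adjCount_of_ne (G := G) (show u ≠ w by rintro rfl; exact hu hw), Finset.sum_boole,
    Finset.sum_const, smul_eq_mul, mul_one, Nat.cast_id]
  congr 1
  ext w
  simp [and_comm]

theorem length_nbrs_le (G : LoopGraph n) (u : Fin n) : (G.nbrs u).length ≤ G.deg u := by
  classical
  have h := sum_adjCount_eq_length (G := G) u (S := Finset.univ.erase u) (by simp)
  have e : (G.nbrs u).filter (· ∈ Finset.univ.erase u) = G.nbrs u := by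
    rw [List.filter_eq_self]
    intro w hw
    have := (mem_nbrs.1 hw).ne'
    simpa using this
  rw [e] at h
  rw [← h]
  exact Finset.sum_le_sum_of_subset (Finset.subset_univ _)

theorem deposit_cost (w : Fin n) (x : ℝ) (s : Cells n) : (deposit w x s).cost = 6 := by
  unfold deposit
  simp only [bind_cost, tick_cost]
  split_ifs <;> rfl

/-- Positivity of deposits makes a zero cell a reliable sign that the vertex is not yet listed, so
no vertex is listed twice. -/
theorem deposit_spec {w : Fin n} {x : ℝ} (hx : 0 < x) {s : Cells n} (hs : s.Valid) :
    (deposit w x s).val.Valid ∧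
      (∀ z, (deposit w x s).val.arr z = s.arr z + if z = w then x else 0) ∧
      (deposit w x s).val.used.length ≤ s.used.length + 1 := by
  obtain ⟨h1, h2, h3⟩ := hs
  unfold deposit
  simp only [bind_val]
  split_ifs with h0
  · simp only [pure_val]
    have harr : ∀ z, Function.update s.arr w x z = s.arr z + if z = w then x else 0 := by
      intro z
      by_cases hz : z = w
      · subst hz; simp [h0]
      · simp [hz]
    refine ⟨⟨List.nodup_cons.2 ⟨fun h => (h2 w).1 h h0, h1⟩, fun z => ?_, fun z => ?_⟩, harr,
      by simp⟩
    · by_cases hz : z = w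
      · subst hz; simp [hx.ne']
      · simp [hz, h2 z]
    · simp only [harr]
      have := h3 z
      split_ifs <;> linarith
  · simp only [pure_val]
    have harr : ∀ z, Function.update s.arr w (s.arr w + x) z =
        s.arr z + if z = w then x else 0 := by
      intro z
      by_cases hz : z = w
      · subst hz; simp
      · simp [hz]
    refine ⟨⟨h1, fun z => ?_, fun z => ?_⟩, harr, by simp⟩
    · by_cases hz : z = w
      · subst hz
        have := h3 z
        simp [h2 z, h0, (show s.arr z + x ≠ 0 by linarith)]
      · simp [hz, h2 z]
    · simp only [harr]
      have := h3 z
      split_ifs <;> linarith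

theorem spread_cost (y : ℝ) (l : List (Fin n)) (s : Cells n) :
    (spread y l s).cost = 8 * l.length + 1 := by
  induction l generalizing s with
  | nil => rfl
  | cons w l ih =>
    rw [spread]
    simp only [bind_cost, tick_cost, deposit_cost, ih, List.length_cons]
    ring

theorem spread_spec {y : ℝ} (hy : 0 < y) {l : List (Fin n)} (hl : l.Nodup) {s : Cells n}
    (hs : s.Valid) :
    (spread y l s).val.Valid ∧
      (∀ z, (spread y l s).val.arr z = s.arr z + if z ∈ l then y else 0) ∧
      (spread y l s).val.used.length ≤ s.used.length + l.length := by
  induction l generalizing s with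
  | nil => exact ⟨hs, fun z => by simp [spread], by simp [spread]⟩
  | cons w l ih =>
    obtain ⟨h1, h2, h3⟩ := deposit_spec (w := w) hy hs
    obtain ⟨h4, h5, h6⟩ := ih (List.nodup_cons.1 hl).2 h1
    rw [spread]
    simp only [bind_val]
    refine ⟨h4, fun z => ?_, by rw [List.length_cons]; omega⟩
    rw [h5, h2]
    have hw := (List.nodup_cons.1 hl).1
    by_cases hz : z = w
    · subst hz; simp [hw]
    · simp [hz]

theorem multiply_cost_le (hd : ∀ u, 0 < G.deg u) (us : List (Fin n)) (p : Fin n → ℝ)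
    (s : Cells n) :
    (G.multiply (us.map fun u => (u, p u)) s).cost ≤ 27 * (us.map G.deg).sum + 1 := by
  induction us generalizing s with
  | nil => simp [multiply]
  | cons u us ih =>
    rw [List.map_cons, multiply]
    simp only [bind_cost, tick_cost, deposit_cost, spread_cost, List.map_cons, List.sum_cons]
    have h1 := ih (spread (p u / (2 * (G.deg u : ℝ))) (G.nbrs u)
      (deposit u (p u / 2 + (G.loops u : ℝ) * (p u / (2 * (G.deg u : ℝ)))) s).val).val
    have h2 := G.length_nbrs_le u
    have h3 := hd u
    -- `12 + 6 + (8 · length + 1)` is at most `27 d(u)`, since the neighbour list has length at most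
    -- `d(u)` and `d(u) ≥ 1`.
    omega

theorem multiply_spec (hd : ∀ u, 0 < G.deg u) {us : List (Fin n)} {p : Fin n → ℝ}
    (hp : ∀ u ∈ us, 0 < p u) {s : Cells n} (hs : s.Valid) :
    (G.multiply (us.map fun u => (u, p u)) s).val.Valid ∧
      (∀ z, (G.multiply (us.map fun u => (u, p u)) s).val.arr z = s.arr z +
        (us.map fun u => ((G.adjCount z u : ℝ) * (p u / (G.deg u : ℝ)) +
          if u = z then p u else 0) / 2).sum) ∧
      (G.multiply (us.map fun u => (u, p u)) s).val.used.length ≤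
        s.used.length + 2 * (us.map G.deg).sum := by
  induction us generalizing s with
  | nil => exact ⟨hs, fun z => by simp [multiply], by simp [multiply]⟩
  | cons u us ih =>
    have hpu := hp u (by simp)
    have hdu : (0 : ℝ) < G.deg u := by exact_mod_cast hd u
    have hy : 0 < p u / (2 * (G.deg u : ℝ)) := by positivity
    obtain ⟨h1, h2, h3⟩ := deposit_spec (w := u)
      (x := p u / 2 + (G.loops u : ℝ) * (p u / (2 * (G.deg u : ℝ)))) (by positivity) hs
    obtain ⟨h4, h5, h6⟩ := spread_spec hy (G.nodup_nbrs u) h1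
    obtain ⟨h7, h8, h9⟩ := ih (fun w hw => hp w (by simp [hw])) h4
    rw [List.map_cons, multiply]
    simp only [bind_val]
    refine ⟨h7, fun z => ?_, ?_⟩
    · rw [h8, h5, h2, List.map_cons, List.sum_cons, G.adjCount_comm]
      by_cases hz : z = u
      · subst hz
        have hself : z ∉ G.nbrs z := fun h => (mem_nbrs.1 h).ne rfl
        simp only [hself, if_true, if_false, adjCount]
        field_simp
        ring
      · rw [adjCount_of_ne (Ne.symm hz), if_neg hz, if_neg (Ne.symm hz)]
        split_ifs
        · push_cast; field_simp; ring
        · simp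
    · have := G.length_nbrs_le u
      have := hd u
      rw [List.map_cons, List.sum_cons]
      omega

theorem multiply_eq_walk (hd : ∀ u, 0 < G.deg u) {us : List (Fin n)} (hnd : us.Nodup)
    {p : Fin n → ℝ} (hp : ∀ u, 0 ≤ p u) (hus : ∀ u, u ∈ us ↔ p u ≠ 0) :
    (G.multiply (us.map fun u => (u, p u)) ⟨fun _ => 0, []⟩).val.Valid ∧
      (G.multiply (us.map fun u => (u, p u)) ⟨fun _ => 0, []⟩).val.arr = Matrix.mulVec G.walk p ∧
      (G.multiply (us.map fun u => (u, p u)) ⟨fun _ => 0, []⟩).val.used.length ≤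
        2 * (us.map G.deg).sum := by
  classical
  obtain ⟨h1, h2, h3⟩ := multiply_spec (us := us) (p := p) hd
    (fun u hu => lt_of_le_of_ne (hp u) ((hus u).1 hu).symm)
    (s := ⟨fun _ => 0, []⟩) ⟨List.nodup_nil, by simp, by simp⟩
  refine ⟨h1, ?_, by simpa using h3⟩
  funext z
  rw [h2, walk_mulVec_apply, ← List.sum_toFinset _ hnd]
  have e : ∑ u ∈ us.toFinset, ((G.adjCount z u : ℝ) * (p u / (G.deg u : ℝ)) +
      if u = z then p u else 0) / 2 = ∑ u, ((G.adjCount z u : ℝ) * (p u / (G.deg u : ℝ)) +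
      if u = z then p u else 0) / 2 := by
    refine Finset.sum_subset (Finset.subset_univ _) fun u _ hu => ?_
    have : p u = 0 := by
      by_contra h
      exact hu (List.mem_toFinset.2 ((hus u).2 h))
    simp [this]
  rw [e, ← Finset.sum_div, Finset.sum_add_distrib]
  simp

theorem survivors_spec (ε : ℝ) (q : Fin n → ℝ) (us : List (Fin n)) :
    (G.survivors ε q us).val =
        (us.filter fun u => decide ((G.deg u : ℝ) * ε ≤ q u)).map (fun u => (u, q u)) ∧
      (G.survivors ε q us).cost = 10 * us.length + 1 := by
  induction us with
  | nil => exact ⟨rfl, rfl⟩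
  | cons u us ih =>
    rw [survivors]
    simp only [bind_val, bind_cost, tick_cost, List.length_cons]
    split_ifs with h
    · exact ⟨by simp [h, ih.1], by simp only [pure_cost, ih.2]; ring⟩
    · exact ⟨by simp [h, ih.1], by simp only [pure_cost, ih.2]; ring⟩

end LoopGraph

namespace LoopGraph

open Timed

variable {n : ℕ} {G : LoopGraph n}

/-! ### The scan of the sorted list -/

theorem countMarked_spec (mark : Fin n → Bool) (l : List (Fin n)) :
    (countMarked mark l).val = ((l.filter mark).length, l.length) ∧
      (countMarked mark l).cost = 6 * l.length + 2 := by
  induction l with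
  | nil => exact ⟨rfl, rfl⟩
  | cons w l ih =>
    rw [countMarked]
    simp only [bind_val, bind_cost, tick_cost, pure_val, pure_cost, ih.1, ih.2, List.length_cons]
    refine ⟨?_, by ring⟩
    by_cases h : mark w <;> simp [h]

/-- Edges from `u` to the outside are gained and those from `u` into `S` are lost; loops affect
neither, so the loop-free list suffices. The statement is over the integers because of the
subtraction. -/
theorem cut_insert {u : Fin n} {S : Finset (Fin n)} (hu : u ∉ S) :
    (G.cut (insert u S) : ℤ) =
      G.cut S + ((G.nbrs u).length : ℤ) - 2 * (((G.nbrs u).filter (· ∈ S)).length : ℤ) := by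
  classical
  have hC : insert u (insert u S)ᶜ = Sᶜ := by
    ext w
    by_cases hw : w = u
    · subst hw; simp [hu]
    · simp [hw]
  have huC : u ∉ (insert u S)ᶜ := by simp
  have h1 : G.cut (insert u S) + ∑ a ∈ S, G.adjCount u a =
      G.cut S + ∑ w ∈ (insert u S)ᶜ, G.adjCount u w := by
    have e : G.cut S = ∑ a ∈ S, (G.adjCount a u + ∑ w ∈ (insert u S)ᶜ, G.adjCount a w) := by
      unfold cut
      refine Finset.sum_congr rfl fun a _ => ?_
      rw [← hC, Finset.sum_insert huC]
    rw [e, Finset.sum_add_distrib, cut, Finset.sum_insert hu]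
    simp_rw [G.adjCount_comm u]
    ring
  have h2 : ∑ w ∈ (insert u S)ᶜ, G.adjCount u w + ∑ a ∈ S, G.adjCount u a =
      (G.nbrs u).length := by
    have hdisj : Disjoint (insert u S)ᶜ S :=
      Finset.disjoint_left.2 fun w hw hw' => by simp [hw'] at hw
    rw [← Finset.sum_union hdisj, sum_adjCount_eq_length u (by simp [hu])]
    congr 1
    rw [List.filter_eq_self]
    intro w hw
    have := (mem_nbrs.1 hw).ne'
    by_cases hwS : w ∈ S <;> simp [this, hwS]
  rw [← sum_adjCount_eq_length u hu]
  zify at h1 h2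
  push_cast
  linarith

/-- The vertices in the list come at the positions `k, k + 1, …` in the order of the sweep. -/
def EnumFrom (G : LoopGraph n) (q : Fin n → ℝ) : ℕ → List (Fin n) → Prop
  | _, [] => True
  | k, u :: us => G.rank q u = k ∧ EnumFrom G q (k + 1) us

/-- A strictly sorted list of all vertices with positions in `[k, J)` cannot skip one: the vertex at
position `k` would have to appear after a vertex of higher rank. -/
theorem enumFrom_of_pairwise {q : Fin n → ℝ} {J : ℕ} (hJ : J ≤ n) {k : ℕ} {us : List (Fin n)}
    (hus : us.Pairwise fun a c => G.Before q a c)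
    (hmem : ∀ u, u ∈ us ↔ k ≤ G.rank q u ∧ G.rank q u < J) : G.EnumFrom q k us := by
  induction us generalizing k with
  | nil => trivial
  | cons u us ih =>
    obtain ⟨h1, h2⟩ := List.pairwise_cons.1 hus
    have hu := (hmem u).1 (by simp)
    have hrank : G.rank q u = k := by
      by_contra hne
      obtain ⟨w, hw⟩ := G.exists_rank_eq q (show k < n by omega)
      rcases List.mem_cons.1 ((hmem w).2 ⟨hw.ge, by omega⟩) with rfl | hw'
      · exact hne hw
      · have := (h1 w hw').rank_lt
        omega
    refine ⟨hrank, ih h2 fun w => ⟨fun hw => ?_, fun hw => ?_⟩⟩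
    · have := (h1 w hw).rank_lt
      have := (hmem w).1 (by simp [hw])
      omega
    · rcases List.mem_cons.1 ((hmem w).2 ⟨by omega, hw.2⟩) with rfl | hw'
      · omega
      · exact hw'

theorem scan_cost_le (hd : ∀ u, 0 < G.deg u) (φ thr : ℝ) (pow : ℕ) (q : Fin n → ℝ)
    (us : List (Fin n)) (mark : Fin n → Bool) (pre : List (Fin n)) (volume : ℕ) (cutSize : ℤ)
    (steep : Bool) :
    (G.scan φ thr pow (us.map fun u => (u, q u)) mark pre volume cutSize steep).cost ≤
      48 * (us.map G.deg).sum + 1 := by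
  induction us generalizing mark pre volume cutSize steep with
  | nil => simp [scan]
  | cons u us ih =>
    rw [List.map_cons, scan]
    have h2 := G.length_nbrs_le u
    have h3 := hd u
    simp only [bind_cost, tick_cost, (countMarked_spec _ _).2, List.map_cons, List.sum_cons]
    split_ifs
    · rw [pure_cost]
      omega
    · refine (Nat.add_le_add_left (Nat.add_le_add_left (ih _ _ _ _ _) _) _).trans ?_
      omega

/-- The slope condition is met as soon as some vertex reaching the volume is dense enough. -/
theorem le_curveSlope_iff (hd : ∀ u, 0 < G.deg u) (q : Fin n → ℝ) {pow k : ℕ} (hpow : 0 < pow)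
    (hk : pow ≤ G.vol (G.sweep q k)) (thr : ℝ) :
    thr ≤ G.curveSlope q pow ↔ ∃ u, G.rank q u < k ∧
      pow ≤ G.vol (G.sweep q (G.rank q u + 1)) ∧ thr ≤ q u / (G.deg u : ℝ) := by
  have hpow' : (0 : ℝ) < pow := by exact_mod_cast hpow
  obtain ⟨u, hu₁, hu₂⟩ := G.exists_vol_sweep q hpow'
    (by exact_mod_cast hk.trans (G.vol_mono (Finset.subset_univ _)))
  rw [curveSlope_eq hd q u hu₁ hu₂]
  have hu₁' : G.vol (G.sweep q (G.rank q u)) < pow := by exact_mod_cast hu₁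
  have hlt : ∀ j, pow ≤ G.vol (G.sweep q j) → G.rank q u < j := fun j hj => by
    by_contra hn
    have := G.vol_mono (G.sweep_mono q (not_lt.1 hn))
    omega
  constructor
  · intro h
    exact ⟨u, hlt k hk, by exact_mod_cast hu₂, h⟩
  · rintro ⟨w, -, hw2, hw3⟩
    exact hw3.trans (G.div_le_of_mem_sweep (G.mem_sweep.2 (hlt _ hw2)))

/-- The form of the stopping test that the scan evaluates. The volume bounds make the minimum
positive, so the conductance test can be cleared of its division. -/
theorem stops_iff (hd : ∀ u, 0 < G.deg u) {φ : ℝ} {b : ℕ} (q : Fin n → ℝ) (k : ℕ) :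
    G.Stops φ b q k ↔
      (((G.cut (G.sweep q k) : ℤ) : ℝ) ≤ φ * min (G.vol (G.sweep q k) : ℝ)
          ((G.vol Finset.univ : ℝ) - (G.vol (G.sweep q k) : ℝ)) ∧
        (G.vol (G.sweep q k) : ℝ) ≤ 5 / 6 * (G.vol Finset.univ : ℝ) ∧
        2 ^ b ≤ G.vol (G.sweep q k) ∧
        ∃ u, G.rank q u < k ∧ 2 ^ b ≤ G.vol (G.sweep q (G.rank q u + 1)) ∧
          1 / (140 * ((G.ell : ℝ) + 2) * 2 ^ b) ≤ q u / (G.deg u : ℝ)) := by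
  unfold Stops
  set S := G.sweep q k
  by_cases h3 : 2 ^ b ≤ G.vol S
  swap
  · simp [h3]
  by_cases h2 : (G.vol S : ℝ) ≤ 5 / 6 * (G.vol Finset.univ : ℝ)
  swap
  · simp [h2]
  have hv : 0 < G.vol S := lt_of_lt_of_le (by positivity) h3
  have hv' : (0 : ℝ) < G.vol S := by exact_mod_cast hv
  have hne : S ≠ ∅ := fun h => by rw [h] at hv; simp [vol] at hv
  have hc : ((min (G.vol S) (G.vol Sᶜ) : ℕ) : ℝ) =
      min (G.vol S : ℝ) ((G.vol Finset.univ : ℝ) - (G.vol S : ℝ)) := by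
    rw [← G.vol_add_vol_compl S]
    push_cast
    congr 1
    ring
  have hmin : 0 < min (G.vol S : ℝ) ((G.vol Finset.univ : ℝ) - (G.vol S : ℝ)) :=
    lt_min hv' (by linarith)
  have h4 := le_curveSlope_iff hd q (show 0 < 2 ^ b by positivity) h3
    (1 / (140 * ((G.ell : ℝ) + 2) * 2 ^ b))
  push_cast at h4
  rw [conductance, if_neg hne, hc, div_le_iff₀ hmin, h4]
  norm_cast

/-- The scan returns a sweep set satisfying the four conditions if there is one among the sets
that it looks through. -/
theorem scan_spec (hd : ∀ u, 0 < G.deg u) {φ : ℝ} {b : ℕ} {q : Fin n → ℝ} {us : List (Fin n)}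
    {k : ℕ} (hus : G.EnumFrom q k us) {mark : Fin n → Bool} {pre : List (Fin n)} {volume : ℕ}
    {cutSize : ℤ} {steep : Bool} (hmark : ∀ u, mark u = decide (u ∈ G.sweep q k))
    (hpre : pre.toFinset = G.sweep q k) (hvol : volume = G.vol (G.sweep q k))
    (hcut : cutSize = G.cut (G.sweep q k))
    (hsteep : steep = true ↔ ∃ u, G.rank q u < k ∧
      2 ^ b ≤ G.vol (G.sweep q (G.rank q u + 1)) ∧
        1 / (140 * ((G.ell : ℝ) + 2) * 2 ^ b) ≤ q u / (G.deg u : ℝ)) :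
    (∃ C, (G.scan φ (1 / (140 * ((G.ell : ℝ) + 2) * 2 ^ b)) (2 ^ b) (us.map fun u => (u, q u))
        mark pre volume cutSize steep).val = some C ∧
        ∃ j, G.Stops φ b q j ∧ C.toFinset = G.sweep q j) ∨
      ((G.scan φ (1 / (140 * ((G.ell : ℝ) + 2) * 2 ^ b)) (2 ^ b) (us.map fun u => (u, q u))
        mark pre volume cutSize steep).val = none ∧
        ∀ j, k < j → j ≤ k + us.length → ¬ G.Stops φ b q j) := by
  classical
  induction us generalizing k mark pre volume cutSize steep with
  | nil =>
    right
    refine ⟨rfl, fun j h1 h2 => ?_⟩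
    simp at h2
    omega
  | cons u us ih =>
    obtain ⟨hu, hus⟩ := hus
    have hsucc : G.sweep q (k + 1) = insert u (G.sweep q k) := by
      rw [← hu]; exact G.sweep_rank_succ q u
    have huk : u ∉ G.sweep q k := by rw [← hu]; exact G.notMem_sweep_rank q u
    have hvol' : volume + G.deg u = G.vol (G.sweep q (k + 1)) := by
      rw [hsucc, vol_insert _ huk, hvol]
    have hcut' : cutSize + ((countMarked mark (G.nbrs u)).val.2 : ℤ) -
        2 * ((countMarked mark (G.nbrs u)).val.1 : ℤ) = G.cut (G.sweep q (k + 1)) := by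
      rw [(countMarked_spec _ _).1, hsucc, cut_insert huk, hcut]
      have e : mark = fun w => decide (w ∈ G.sweep q k) := funext hmark
      simp only [e]
    have hsteep' : (steep || (decide (2 ^ b ≤ volume + G.deg u) &&
        decide (1 / (140 * ((G.ell : ℝ) + 2) * 2 ^ b) ≤ q u / (G.deg u : ℝ)))) = true ↔
        ∃ w, G.rank q w < k + 1 ∧ 2 ^ b ≤ G.vol (G.sweep q (G.rank q w + 1)) ∧
          1 / (140 * ((G.ell : ℝ) + 2) * 2 ^ b) ≤ q w / (G.deg w : ℝ) := by
      rw [Bool.or_eq_true, hsteep, Bool.and_eq_true, decide_eq_true_eq, decide_eq_true_eq, hvol']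
      constructor
      · rintro (⟨w, h1, h2⟩ | ⟨h1, h2⟩)
        · exact ⟨w, by omega, h2⟩
        · exact ⟨u, by omega, by rw [hu]; exact h1, h2⟩
      · rintro ⟨w, h1, h2, h3⟩
        rcases Nat.lt_succ_iff_lt_or_eq.1 h1 with h | h
        · exact Or.inl ⟨w, h, h2, h3⟩
        · obtain rfl : w = u := G.rank_injective q (h.trans hu.symm)
          exact Or.inr ⟨by rw [← hu]; exact h2, h3⟩
    have hpre' : (u :: pre).toFinset = G.sweep q (k + 1) := by
      rw [List.toFinset_cons, hpre, hsucc]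
    have hmark' : ∀ w, Function.update mark u true w = decide (w ∈ G.sweep q (k + 1)) := by
      intro w
      rw [hsucc]
      by_cases hw : w = u
      · subst hw; simp
      · simp [hw, hmark w]
    rw [List.map_cons, scan]
    simp only [bind_val]
    rw [hcut', hvol']
    have hst := stops_iff hd (φ := φ) (b := b) q (k + 1)
    rw [← hsteep', hvol'] at hst
    rw [hvol'] at hsteep'
    split_ifs with h
    · exact Or.inl ⟨u :: pre, rfl, k + 1, hst.2 h, hpre'⟩
    · rcases ih hus hmark' hpre' rfl rfl hsteep' with h' | ⟨h1, h2⟩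
      · exact Or.inl h'
      · refine Or.inr ⟨h1, fun j hj1 hj2 => ?_⟩
        rw [List.length_cons] at hj2
        rcases Nat.lt_or_ge (k + 1) j with h3 | h3
        · exact h2 j h3 (by omega)
        · obtain rfl : j = k + 1 := by omega
          exact fun hs => h (hst.1 hs)

end LoopGraph

namespace LoopGraph

open Timed

variable {n : ℕ} {G : LoopGraph n}

/-! ### The rounds of the program -/

theorem sweepLE_iff {a c : Fin n × ℝ} : G.sweepLE a c = true ↔
    (c.2 / (G.deg c.1 : ℝ) < a.2 / (G.deg a.1 : ℝ) ∨
      (c.2 / (G.deg c.1 : ℝ) = a.2 / (G.deg a.1 : ℝ) ∧ a.1 ≤ c.1)) := by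
  classical
  unfold sweepLE
  exact decide_eq_true_iff

theorem sweepLE_total (a c : Fin n × ℝ) : G.sweepLE a c ∨ G.sweepLE c a := by
  rw [sweepLE_iff, sweepLE_iff]
  rcases lt_trichotomy (a.2 / (G.deg a.1 : ℝ)) (c.2 / (G.deg c.1 : ℝ)) with h | h | h
  · exact Or.inr (Or.inl h)
  · rcases le_total a.1 c.1 with h' | h'
    · exact Or.inl (Or.inr ⟨h.symm, h'⟩)
    · exact Or.inr (Or.inr ⟨h, h'⟩)
  · exact Or.inl (Or.inl h)

theorem sweepLE_trans (a c d : Fin n × ℝ) (h₁ : G.sweepLE a c) (h₂ : G.sweepLE c d) :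
    G.sweepLE a d := by
  rw [sweepLE_iff] at *
  rcases h₁ with h₁ | ⟨h₁, h₁'⟩ <;> rcases h₂ with h₂ | ⟨h₂, h₂'⟩
  · exact Or.inl (h₂.trans h₁)
  · exact Or.inl (h₂ ▸ h₁)
  · exact Or.inl (h₁ ▸ h₂)
  · exact Or.inr ⟨h₂.trans h₁, h₁'.trans h₂'⟩

/-- `us` lists the support of `r`. -/
def Lists (us : List (Fin n)) (r : Fin n → ℝ) : Prop :=
  us.Nodup ∧ ∀ u, u ∈ us ↔ r u ≠ 0

/-- The surviving list is given in two forms, with values of `q` and of its truncation, which agree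
there: sorting and scanning use the first, the next round the second. -/
theorem survivors_multiply (hd : ∀ u, 0 < G.deg u) {ε : ℝ} (hε : 0 < ε) {us : List (Fin n)}
    {r q : Fin n → ℝ} (hr : ∀ u, 0 ≤ r u) (hus : Lists us r) (hq : Matrix.mulVec G.walk r = q)
    {s : Cells n} (hs : (G.multiply (us.map fun u => (u, r u)) ⟨fun _ => 0, []⟩).val = s) :
    s.arr = q ∧ s.used.length ≤ 2 * (us.map G.deg).sum ∧
      ∃ us', Lists us' (G.trunc ε q) ∧
        (G.survivors ε s.arr s.used).val = us'.map (fun u => (u, q u)) ∧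
        (G.survivors ε s.arr s.used).val = us'.map (fun u => (u, G.trunc ε q u)) := by
  obtain ⟨hv, harr, hlen⟩ := multiply_eq_walk hd hus.1 hr hus.2
  rw [hs] at hv harr hlen
  rw [hq] at harr
  refine ⟨harr, hlen, s.used.filter fun u => decide ((G.deg u : ℝ) * ε ≤ q u),
    ⟨hv.1.filter _, fun u => ?_⟩, ?_, ?_⟩
  · have hpos : (0 : ℝ) < (G.deg u : ℝ) * ε := mul_pos (by exact_mod_cast hd u) hε
    rw [List.mem_filter, hv.2.1, harr, decide_eq_true_eq, trunc]
    split_ifs with h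
    · simp [h]
    · simp [h]
  · rw [(survivors_spec _ _ _).1, harr]
  · rw [(survivors_spec _ _ _).1, harr]
    refine List.map_congr_left fun u hu => ?_
    have := (List.mem_filter.1 hu).2
    rw [decide_eq_true_eq] at this
    rw [trunc, if_pos this]

theorem sort_survivors (hd : ∀ u, 0 < G.deg u) {ε : ℝ} (hε : 0 < ε) {us : List (Fin n)}
    {q : Fin n → ℝ} (hus : Lists us (G.trunc ε q)) :
    ∃ us', us'.Perm us ∧ (Timed.sort G.sweepLE (us.map fun u => (u, q u))).val =
      us'.map (fun u => (u, q u)) ∧ G.EnumFrom q 0 us' := by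
  obtain ⟨hperm, hsorted⟩ := Timed.sort_spec (le := G.sweepLE) sweepLE_total sweepLE_trans
    (us.map fun u => (u, q u))
  set l := (Timed.sort G.sweepLE (us.map fun u => (u, q u))).val
  have hmap : l = (l.map Prod.fst).map fun u => (u, q u) := by
    rw [List.map_map]
    symm
    refine (List.map_congr_left fun a ha => ?_).trans l.map_id
    obtain ⟨u, -, rfl⟩ := List.mem_map.1 (hperm.mem_iff.1 ha)
    rfl
  have hperm' : (l.map Prod.fst).Perm us := by
    have := hperm.map Prod.fst
    rw [List.map_map] at this
    simpa [Function.comp_def] using this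
  refine ⟨l.map Prod.fst, hperm', hmap, ?_⟩
  obtain ⟨J, hJn, hJ⟩ := exists_sweep_eq_survivors hd ε q
  refine enumFrom_of_pairwise hJn ?_ fun u => ?_
  · have hnd : (l.map Prod.fst).Nodup := hperm'.nodup_iff.2 hus.1
    rw [hmap] at hsorted
    refine ((List.pairwise_map.1 hsorted).and hnd).imp fun {a c} h => ?_
    obtain ⟨h1, h2⟩ := h
    rw [sweepLE_iff] at h1
    rcases h1 with h1 | ⟨h1, h3⟩
    · exact Or.inl h1
    · exact Or.inr ⟨h1, lt_of_le_of_ne h3 h2⟩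
  · have hpos : (0 : ℝ) < (G.deg u : ℝ) * ε := mul_pos (by exact_mod_cast hd u) hε
    simp only [Nat.zero_le, true_and]
    rw [hperm'.mem_iff, hus.2, ← G.mem_sweep, hJ, trunc]
    split_ifs with h
    · simpa [h] using (hpos.trans_le h).ne'
    · simp [h]

/-- If no set that the scan looks through qualifies, then the round need not stop. -/
theorem not_mustStop {φ : ℝ} {b : ℕ} {q : Fin n → ℝ} {us : List (Fin n)}
    (hus : Lists us (G.trunc (G.eps φ b) q))
    (h : ∀ j, 0 < j → j ≤ 0 + us.length → ¬ G.Stops φ b q j) : ¬ G.MustStop φ b q := by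
  classical
  rintro ⟨j, hj, hhalt⟩
  -- The index `j` in `MustStop` is unbounded, but sweep sets do not change beyond `n`.
  have hsweep : G.sweep q (min j n) = G.sweep q j := by
    rcases le_total j n with h' | h'
    · rw [min_eq_left h']
    · rw [min_eq_right h', G.sweep_of_le q h', G.sweep_of_le q le_rfl]
  have hcard : min j n ≤ us.length := by
    rw [← G.card_sweep q (min_le_right j n), ← List.toFinset_card_of_nodup hus.1, hsweep]
    exact Finset.card_le_card fun u hu => List.mem_toFinset.2 ((hus.2 u).2 (hj u hu).ne')
  have hhalt' : G.Stops φ b q (min j n) := by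
    unfold Stops at hhalt ⊢
    rwa [hsweep]
  refine h (min j n) (Nat.pos_of_ne_zero fun h0 => ?_) (by omega) hhalt'
  have := hhalt'.2.2.1
  rw [h0, sweep_zero] at this
  simp [vol] at this

theorem rounds_spec (hd : ∀ u, 0 < G.deg u) {φ : ℝ} {b : ℕ} (hε : 0 < G.eps φ b) (v : Fin n)
    (k t : ℕ) {us : List (Fin n)}
    (hus : Lists us (G.trunc (G.eps φ b) (G.walkVec (G.eps φ b) v t))) :
    (∃ t' ∈ Finset.Icc (t + 1) (t + k),
      (∀ s ∈ Finset.Icc (t + 1) (t + k), s < t' →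
        ¬ G.MustStop φ b (G.walkVec (G.eps φ b) v s)) ∧
      ∃ j, G.Stops φ b (G.walkVec (G.eps φ b) v t') j ∧
        (G.rounds φ (G.eps φ b) (1 / (140 * ((G.ell : ℝ) + 2) * 2 ^ b)) (2 ^ b) k
          (us.map fun u => (u, G.trunc (G.eps φ b) (G.walkVec (G.eps φ b) v t) u))).val.toFinset =
          G.sweep (G.walkVec (G.eps φ b) v t') j) ∨
    ((∀ s ∈ Finset.Icc (t + 1) (t + k), ¬ G.MustStop φ b (G.walkVec (G.eps φ b) v s)) ∧
      (G.rounds φ (G.eps φ b) (1 / (140 * ((G.ell : ℝ) + 2) * 2 ^ b)) (2 ^ b) k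
        (us.map fun u => (u, G.trunc (G.eps φ b) (G.walkVec (G.eps φ b) v t) u))).val = []) := by
  induction k generalizing t us with
  | zero =>
    refine Or.inr ⟨fun s hs => ?_, rfl⟩
    rw [Finset.mem_Icc] at hs
    omega
  | succ k ih =>
    set ε := G.eps φ b
    set q := G.walkVec ε v (t + 1) with hq
    obtain ⟨harr, -, us', hus', hsurv, hsurv'⟩ := survivors_multiply hd hε
      (trunc_nonneg (walkVec_nonneg ε v t)) hus (q := q) rfl rfl
    obtain ⟨us'', hperm, hsort, henum⟩ := sort_survivors hd hε hus'
    rw [rounds]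
    simp only [bind_val]
    rw [hsurv', ← hsurv', hsurv, hsort]
    have hscan := scan_spec hd (φ := φ) (b := b) henum (mark := fun _ => false) (pre := [])
      (volume := 0) (cutSize := 0) (steep := false) (fun u => by simp) (by simp)
      (by simp [vol]) (by simp [cut]) (by simp)
    rcases hscan with ⟨C, hC, j, hhalt, hCj⟩ | ⟨hnone, hno⟩
    · rw [hC]
      refine Or.inl ⟨t + 1, Finset.mem_Icc.2 ⟨le_rfl, by omega⟩, fun s hs hlt => ?_, j, hhalt, hCj⟩
      rw [Finset.mem_Icc] at hs
      omega
    · rw [hnone]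
      rw [hperm.length_eq] at hno
      have hmust := not_mustStop hus' hno
      have hmap : (us'.map fun u => (u, q u)) = us'.map fun u => (u, G.trunc ε q u) :=
        hsurv.symm.trans hsurv'
      simp only [hmap]
      rcases ih (t + 1) hus' with ⟨t', ht', hbefore, j, hhalt, hval⟩ | ⟨hall, hval⟩
      · rw [Finset.mem_Icc] at ht'
        refine Or.inl ⟨t', Finset.mem_Icc.2 (by omega), fun s hs hlt => ?_, j, hhalt, hval⟩
        rw [Finset.mem_Icc] at hs
        rcases hs.1.eq_or_lt with h | h
        · rw [← h]; exact hmust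
        · exact hbefore s (Finset.mem_Icc.2 (by omega)) hlt
      · refine Or.inr ⟨fun s hs => ?_, hval⟩
        rw [Finset.mem_Icc] at hs
        rcases hs.1.eq_or_lt with h | h
        · rw [← h]; exact hmust
        · exact hall s (Finset.mem_Icc.2 (by omega))

/-! ### Cost of the rounds -/

/-- Each listed vertex carries mass at least `d(u) ε`, and the total mass is at most 1. -/
theorem sum_deg_le (hd : ∀ u, 0 < G.deg u) {ε : ℝ} (hε : 0 < ε) (v : Fin n) (t : ℕ)
    {us : List (Fin n)} (hus : Lists us (G.trunc ε (G.walkVec ε v t))) :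
    (us.map G.deg).sum ≤ ⌊1 / ε⌋₊ := by
  classical
  refine Nat.le_floor ?_
  rw [le_div_iff₀ hε, ← List.sum_toFinset _ hus.1, Nat.cast_sum, Finset.sum_mul]
  refine le_trans (Finset.sum_le_sum fun u hu => ?_) (sum_walkVec_le_one hd ε v t us.toFinset)
  by_contra hn
  exact (hus.2 u).1 (List.mem_toFinset.1 hu) (by rw [trunc, if_neg hn])

theorem length_le_sum_deg (hd : ∀ u, 0 < G.deg u) (us : List (Fin n)) :
    us.length ≤ (us.map G.deg).sum := by
  induction us with
  | nil => simp
  | cons u us ih =>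
    have := hd u
    simp only [List.length_cons, List.map_cons, List.sum_cons]
    omega

/-- With `W = ⌊1/ε⌋`, a round costs `27W` for multiplying, `20W` for truncating up to `2W` touched
cells, `4W` plus `j` passes for sorting, `48W` for scanning and `6W` for resetting. The `W` terms
sum to `105W` and the constants to 11. -/
theorem rounds_cost_le (hd : ∀ u, 0 < G.deg u) {φ ε thr : ℝ} {pow : ℕ} (hε : 0 < ε) (v : Fin n)
    {j : ℕ} (hj : n ≤ 2 ^ j) (k t : ℕ) {us : List (Fin n)}
    (hus : Lists us (G.trunc ε (G.walkVec ε v t))) :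
    (G.rounds φ ε thr pow k (us.map fun u => (u, G.trunc ε (G.walkVec ε v t) u))).cost ≤
      k * (105 * ⌊1 / ε⌋₊ + j * (20 * ⌊1 / ε⌋₊ + 4) + 11) + 1 := by
  induction k generalizing t us with
  | zero => simp [rounds]
  | succ k ih =>
    set q := G.walkVec ε v (t + 1) with hq
    set W := ⌊1 / ε⌋₊
    have hW := sum_deg_le hd hε v t hus
    have hmul := multiply_cost_le hd us (G.trunc ε (G.walkVec ε v t)) ⟨fun _ => 0, []⟩
    obtain ⟨harr, hlen, us', hus', hsurv, hsurv'⟩ := survivors_multiply hd hε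
      (trunc_nonneg (walkVec_nonneg ε v t)) hus (q := q) rfl rfl
    obtain ⟨us'', hperm, hsort, henum⟩ := sort_survivors hd hε hus'
    have hW' := sum_deg_le hd hε v (t + 1) hus'
    have hN := length_le_sum_deg hd us'
    have hNn : us'.length ≤ 2 ^ j := by
      have := hus'.1.length_le_card
      rw [Fintype.card_fin] at this
      exact this.trans hj
    have hsortc := Timed.sort_cost_le (le := G.sweepLE) sweepLE_total sweepLE_trans
      (us'.map fun u => (u, q u)) (j := j) (by rwa [List.length_map])
    rw [List.length_map] at hsortc
    have hscanc := scan_cost_le hd φ thr pow q us'' (fun _ => false) [] 0 0 false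
    rw [(hperm.map G.deg).sum_eq] at hscanc
    have hmap : (us'.map fun u => (u, q u)) = us'.map fun u => (u, G.trunc ε q u) :=
      hsurv.symm.trans hsurv'
    have hjN : j * (20 * us'.length + 4) ≤ j * (20 * W + 4) :=
      Nat.mul_le_mul_left _ (by omega)
    have hsucc : (k + 1) * (105 * W + j * (20 * W + 4) + 11) =
        k * (105 * W + j * (20 * W + 4) + 11) + (105 * W + j * (20 * W + 4) + 11) := by ring
    rw [hsucc, rounds]
    simp only [bind_cost, tick_cost, (survivors_spec _ _ _).2]
    rw [hsurv, hsort, List.length_map]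
    have ih := ih (t + 1) hus'
    rw [← hq] at ih
    rcases hres : (G.scan φ thr pow (us''.map fun u => (u, q u)) (fun _ => false) [] 0 0
      false).val with _ | C
    · simp only [hmap] at ih hsortc ⊢
      omega
    · simp only [pure_cost]
      omega

theorem lists_start (G : LoopGraph n) {ε : ℝ} (v : Fin n) :
    Lists (if (G.deg v : ℝ) * ε ≤ 1 then [v] else []) (G.trunc ε (G.walkVec ε v 0)) ∧
      (if (G.deg v : ℝ) * ε ≤ 1 then [(v, (1 : ℝ))] else []) =
        (if (G.deg v : ℝ) * ε ≤ 1 then [v] else []).map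
          fun u => (u, G.trunc ε (G.walkVec ε v 0) u) := by
  have hone : ∀ u, u ≠ v → G.trunc ε (G.walkVec ε v 0) u = 0 := fun u hu => by
    simp [trunc, walkVec, Pi.single_eq_of_ne hu]
  split_ifs with h
  · have hv : G.trunc ε (G.walkVec ε v 0) v = 1 := by simp [trunc, walkVec, h]
    refine ⟨⟨by simp, fun u => ?_⟩, by simp [hv]⟩
    by_cases hu : u = v
    · subst hu; simp [hv]
    · simp [hu, hone u hu]
  · have hv : G.trunc ε (G.walkVec ε v 0) v = 0 := by
      simp only [trunc, walkVec, Pi.single_eq_same, if_neg h]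
    refine ⟨⟨by simp, fun u => ?_⟩, by simp⟩
    by_cases hu : u = v
    · subst hu; simp [hv]
    · simp [hone u hu]

theorem isNibbleOutput_program (hd : ∀ u, 0 < G.deg u) (hm : 1 < G.edges) {φ : ℝ} (hφ : 0 < φ)
    (v : Fin n) (b : ℕ) :
    G.IsNibbleOutput φ v b (G.randomNibbleProgram φ v b).val.toFinset := by
  have hε := eps_pos hm hφ b
  obtain ⟨h1, h2⟩ := lists_start G (ε := G.eps φ b) v
  have h := rounds_spec hd hε v (G.tLast φ) 0 h1
  rw [← h2] at h
  simp only [zero_add] at h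
  rcases h with h | ⟨h3, h4⟩
  · exact Or.inl (by
      obtain ⟨t, ht, hb, j, hs, hC⟩ := h
      exact ⟨t, ht, hb, j, hs, hC⟩)
  · exact Or.inr ⟨h3, by
      unfold randomNibbleProgram nibbleProgram
      simp only [bind_val]
      rw [h4, List.toFinset_nil]⟩

end LoopGraph

namespace LoopGraph

open Timed

variable {n : ℕ} {G : LoopGraph n}

/-! ### The running time -/

theorem card_le_two_pow (hd : ∀ u, 0 < G.deg u) (hm : 1 < G.edges) : n ≤ 2 ^ (G.ell + 1) := by
  have h1 : n ≤ G.vol Finset.univ := by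
    have : ∑ _u : Fin n, 1 ≤ ∑ u, G.deg u := Finset.sum_le_sum fun u _ => hd u
    simpa [vol] using this
  have h2 : (G.vol Finset.univ : ℝ) ≤ 2 ^ (G.ell + 1) := by
    rw [vol_univ_eq, pow_succ]
    linarith [edges_le_two_pow hm]
  exact h1.trans (by exact_mod_cast h2)

/-- The factors are at most `e⁶`, `e^{ℓ+1}` and `e^ℓ`, and `7 + 2ℓ ≤ 9ℓ`. -/
theorem log_logArg_le (hm : 1 < G.edges) : Real.log G.logArg ≤ 9 * G.ell := by
  have hell : (1 : ℝ) ≤ G.ell := by exact_mod_cast ell_pos hm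
  have hX := one_lt_logArg hm
  rw [Real.log_le_iff_le_exp (by linarith)]
  have h1 : (200 : ℝ) ≤ Real.exp 6 := by
    have h := Real.exp_one_gt_d9
    have e : Real.exp 6 = Real.exp 1 ^ 6 := by rw [← Real.exp_nat_mul]; norm_num
    rw [e]
    calc (200 : ℝ) ≤ 2.7 ^ 6 := by norm_num
      _ ≤ Real.exp 1 ^ 6 := pow_le_pow_left₀ (by norm_num) (by linarith) 6
  have h2 : (G.ell : ℝ) + 2 ≤ Real.exp (G.ell + 1) := by
    linarith [Real.add_one_le_exp ((G.ell : ℝ) + 1)]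
  have h3 : √G.edges ≤ Real.exp G.ell := by
    have h4 : √G.edges ≤ G.edges := by
      rw [Real.sqrt_le_left (by linarith)]; nlinarith
    have h5 : (2 : ℝ) ^ G.ell ≤ Real.exp 1 ^ G.ell :=
      pow_le_pow_left₀ (by norm_num) (by linarith [Real.exp_one_gt_d9]) _
    rw [← Real.exp_nat_mul, mul_one] at h5
    exact h4.trans ((edges_le_two_pow hm).trans h5)
  calc G.logArg ≤ Real.exp 6 * Real.exp (G.ell + 1) * Real.exp G.ell := by
        unfold logArg; gcongr
    _ = Real.exp (6 + (G.ell + 1) + G.ell) := by rw [← Real.exp_add, ← Real.exp_add]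
    _ ≤ Real.exp (9 * G.ell) := Real.exp_le_exp.2 (by linarith)

theorem tLast_le (hm : 1 < G.edges) {φ : ℝ} (hφ : 0 < φ) (hφ1 : φ < 1) :
    (G.tLast φ : ℝ) ≤ 38 * G.ell ^ 2 / φ ^ 2 := by
  have hell : (1 : ℝ) ≤ G.ell := by exact_mod_cast ell_pos hm
  have hlog := log_logArg_le hm
  have hlog0 : 0 < Real.log G.logArg := Real.log_pos (one_lt_logArg hm)
  have hφ2 : 0 < φ ^ 2 := by positivity
  have hφ3 : φ ^ 2 ≤ 1 := pow_le_one₀ hφ.le hφ1.le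
  have h1 : (G.tOne φ : ℝ) < 2 / φ ^ 2 * Real.log G.logArg + 1 :=
    Nat.ceil_lt_add_one (by positivity)
  have h2 : (G.tOne φ : ℝ) ≤ 19 * G.ell / φ ^ 2 := by
    rw [le_div_iff₀ hφ2]
    have e : 2 / φ ^ 2 * Real.log G.logArg * φ ^ 2 = 2 * Real.log G.logArg := by field_simp
    nlinarith
  unfold tLast
  push_cast
  calc ((G.ell : ℝ) + 1) * G.tOne φ ≤ (2 * G.ell) * (19 * G.ell / φ ^ 2) := by
        gcongr; linarith
    _ = 38 * G.ell ^ 2 / φ ^ 2 := by ring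

/-- The number of steps at the vertex `v` and the scale `b`. -/
theorem randomNibbleProgram_cost_le (hd : ∀ u, 0 < G.deg u) (hm : 1 < G.edges) {φ : ℝ}
    (hφ : 0 < φ) (hφ1 : φ < 1) (v : Fin n) {b : ℕ} (hb : b ≤ G.ell) :
    ((G.randomNibbleProgram φ v b).cost : ℝ) ≤
      231 * 5400 * 1444 * (G.ell ^ 6 / φ ^ 4) * 2 ^ b := by
  have hε := eps_pos hm hφ b
  obtain ⟨h1, h2⟩ := lists_start G (ε := G.eps φ b) v
  have h := rounds_cost_le hd (φ := φ) (thr := 1 / (140 * ((G.ell : ℝ) + 2) * 2 ^ b))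
    (pow := 2 ^ b) hε v (card_le_two_pow hd hm) (G.tLast φ) 0 h1
  rw [← h2] at h
  have hcost : (G.randomNibbleProgram φ v b).cost = (10 + 4 * G.ell) + ((50 + 2 * b) +
      (G.rounds φ (G.eps φ b) (1 / (140 * ((G.ell : ℝ) + 2) * 2 ^ b)) (2 ^ b) (G.tLast φ)
        (if (G.deg v : ℝ) * G.eps φ b ≤ 1 then [(v, (1 : ℝ))] else [])).cost) := rfl
  rw [hcost]
  set R := (G.rounds φ (G.eps φ b) (1 / (140 * ((G.ell : ℝ) + 2) * 2 ^ b)) (2 ^ b) (G.tLast φ)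
    (if (G.deg v : ℝ) * G.eps φ b ≤ 1 then [(v, (1 : ℝ))] else [])).cost
  have hT1 : (1 : ℝ) ≤ G.tLast φ := by exact_mod_cast tLast_pos hm hφ
  have hTl := tLast_le hm hφ hφ1
  set T : ℝ := (G.tLast φ : ℝ) with hT
  have hell : (1 : ℝ) ≤ G.ell := by exact_mod_cast ell_pos hm
  have hb' : (b : ℝ) ≤ G.ell := by exact_mod_cast hb
  set Q := 1 / G.eps φ b with hQ
  have hQe : Q = 1800 * ((G.ell : ℝ) + 2) * T * 2 ^ b := by
    rw [hQ, eps, one_div_one_div]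
  have hpow : (1 : ℝ) ≤ 2 ^ b := one_le_pow₀ one_le_two
  have hQ1 : 1 ≤ Q := by
    rw [hQe]
    have h3 : (1 : ℝ) ≤ 1800 * ((G.ell : ℝ) + 2) := by linarith
    exact one_le_mul_of_one_le_of_one_le (one_le_mul_of_one_le_of_one_le h3 hT1) hpow
  have hW : (⌊Q⌋₊ : ℝ) ≤ Q := Nat.floor_le (by linarith)
  have hR : (R : ℝ) ≤ T * (105 * ⌊Q⌋₊ + (G.ell + 1) * (20 * ⌊Q⌋₊ + 4) + 11) + 1 := by
    rw [hT]
    exact_mod_cast h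
  set l : ℝ := (G.ell : ℝ)
  have hR' : (R : ℝ) ≤ T * (Q * (140 + 24 * l)) + 1 := by
    refine hR.trans ?_
    have h3 : 105 * (⌊Q⌋₊ : ℝ) + (l + 1) * (20 * ⌊Q⌋₊ + 4) + 11 ≤ Q * (140 + 24 * l) := by
      have h4 : (l + 1) * (20 * (⌊Q⌋₊ : ℝ) + 4) ≤ (l + 1) * (24 * Q) := by
        gcongr
        linarith
      nlinarith
    gcongr
  have hTQ : 1 ≤ T * Q := one_le_mul_of_one_le_of_one_le hT1 hQ1
  -- Since `TQ ≥ 1`, the start-up cost is absorbed: `(61 + 6l) + (140 + 24l) ≤ 231 l`.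
  have htotal : (10 + 4 * l) + ((50 + 2 * b) + (R : ℝ)) ≤ T * Q * (231 * l) := by
    have h3 : 60 + 6 * l + 1 ≤ T * Q * (61 + 6 * l) := by
      have : 0 ≤ 61 + 6 * l := by linarith
      nlinarith
    have h4 : 0 ≤ T * Q * (l - 1) := mul_nonneg (by linarith) (by linarith)
    nlinarith
  have hT2 : T ^ 2 ≤ (38 * l ^ 2 / φ ^ 2) ^ 2 := pow_le_pow_left₀ (by linarith) hTl 2
  push_cast
  calc (10 + 4 * l) + ((50 + 2 * b) + (R : ℝ)) ≤ T * Q * (231 * l) := htotal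
    _ = 231 * 1800 * (l * (l + 2)) * T ^ 2 * 2 ^ b := by rw [hQe]; ring
    _ ≤ 231 * 1800 * (l * (3 * l)) * (38 * l ^ 2 / φ ^ 2) ^ 2 * 2 ^ b := by
        gcongr; linarith
    _ = 231 * 5400 * 1444 * (l ^ 6 / φ ^ 4) * 2 ^ b := by field_simp; norm_num

/-- Every scale contributes at most `2c`, because the normalising factor is at least `1/2`; there
are `ℓ` scales. -/
theorem randomNibbleMean_le (hm : 1 < G.edges) {F : Fin n → ℕ → ℝ} {c : ℝ} (hc : 0 ≤ c)
    (hF : ∀ v, ∀ b ≤ G.ell, F v b ≤ c * 2 ^ b) : G.randomNibbleMean F ≤ 2 * c * G.ell := by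
  have hV : (0 : ℝ) < G.vol Finset.univ := by rw [vol_univ_eq]; linarith
  have hell := ell_pos hm
  have hN : (1 : ℝ) / 2 ≤ 1 - (1 / 2) ^ G.ell := by
    have : (1 / 2 : ℝ) ^ G.ell ≤ (1 / 2) ^ 1 :=
      pow_le_pow_of_le_one (by norm_num) (by norm_num) hell
    linarith
  change ∑ v, ∑ b ∈ Finset.Icc 1 G.ell, ((G.deg v : ℝ) / (G.vol Finset.univ : ℝ)) *
      ((1 / 2 : ℝ) ^ b / (1 - (1 / 2 : ℝ) ^ G.ell)) * F v b ≤ _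
  calc ∑ v, ∑ b ∈ Finset.Icc 1 G.ell, ((G.deg v : ℝ) / (G.vol Finset.univ : ℝ)) *
        ((1 / 2 : ℝ) ^ b / (1 - (1 / 2 : ℝ) ^ G.ell)) * F v b
      ≤ ∑ v, ∑ b ∈ Finset.Icc 1 G.ell, ((G.deg v : ℝ) / (G.vol Finset.univ : ℝ)) * (2 * c) := by
        refine Finset.sum_le_sum fun v _ => Finset.sum_le_sum fun b hb => ?_
        rw [mul_assoc]
        refine mul_le_mul_of_nonneg_left ?_ (by positivity)
        have hN0 : (0 : ℝ) < 1 - (1 / 2) ^ G.ell := by linarith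
        calc (1 / 2 : ℝ) ^ b / (1 - (1 / 2 : ℝ) ^ G.ell) * F v b
            ≤ (1 / 2 : ℝ) ^ b / (1 - (1 / 2 : ℝ) ^ G.ell) * (c * 2 ^ b) :=
              mul_le_mul_of_nonneg_left (hF v b (Finset.mem_Icc.1 hb).2) (by positivity)
          _ = ((1 / 2 : ℝ) * 2) ^ b * c / (1 - (1 / 2 : ℝ) ^ G.ell) := by rw [mul_pow]; ring
          _ = c / (1 - (1 / 2 : ℝ) ^ G.ell) := by norm_num
          _ ≤ 2 * c := by
              rw [div_le_iff₀ hN0]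
              nlinarith
    _ = 2 * c * G.ell := by
        simp only [Finset.sum_const, Nat.card_Icc, add_tsub_cancel_right, nsmul_eq_mul]
        rw [← Finset.mul_sum, ← Finset.sum_mul, ← Finset.sum_div, ← Nat.cast_sum]
        change (G.ell : ℝ) * ((G.vol Finset.univ : ℝ) / G.vol Finset.univ * (2 * c)) = _
        rw [div_self hV.ne']
        ring

/-- Rounding up is harmless although `log₂ m` may be below 1: `2m` is an integer above 2, so `m ≥
3/2` and `log₂ m ≥ 1/2`. -/
theorem ell_le_three_mul_logb (hm : 1 < G.edges) : (G.ell : ℝ) ≤ 3 * Real.logb 2 G.edges := by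
  have h32 : (3 : ℝ) / 2 ≤ G.edges := by
    have h1 : (2 : ℝ) < G.vol Finset.univ := by rw [vol_univ_eq]; linarith
    have h2 : 3 ≤ G.vol Finset.univ := by exact_mod_cast h1
    have h3 : (3 : ℝ) ≤ G.vol Finset.univ := by exact_mod_cast h2
    rw [vol_univ_eq] at h3
    linarith
  have h1 : (1 : ℝ) / 2 ≤ Real.logb 2 G.edges := by
    rw [Real.le_logb_iff_rpow_le one_lt_two (by linarith), ← Real.sqrt_eq_rpow]
    refine le_trans ?_ h32
    rw [Real.sqrt_le_left (by norm_num)]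
    norm_num
  linarith [ell_lt hm]

theorem randomNibbleMean_cost_le (hd : ∀ u, 0 < G.deg u) (hm : 1 < G.edges) {φ : ℝ}
    (hφ : 0 < φ) (hφ1 : φ < 1) :
    G.randomNibbleMean (fun v b => ((G.randomNibbleProgram φ v b).cost : ℝ)) ≤
      2 * (231 * 5400 * 1444) * 3 ^ 7 * ((Real.logb 2 G.edges) ^ 7 / φ ^ 4) := by
  have h := randomNibbleMean_le hm (c := 231 * 5400 * 1444 * (G.ell ^ 6 / φ ^ 4)) (by positivity)
    fun v b hb => randomNibbleProgram_cost_le hd hm hφ hφ1 v hb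
  refine h.trans ?_
  have h7 : (G.ell : ℝ) ^ 7 ≤ (3 * Real.logb 2 G.edges) ^ 7 :=
    pow_le_pow_left₀ (Nat.cast_nonneg _) (ell_le_three_mul_logb hm) 7
  calc 2 * (231 * 5400 * 1444 * ((G.ell : ℝ) ^ 6 / φ ^ 4)) * G.ell
      = 2 * (231 * 5400 * 1444) * ((G.ell : ℝ) ^ 7 / φ ^ 4) := by ring
    _ ≤ 2 * (231 * 5400 * 1444) * ((3 * Real.logb 2 G.edges) ^ 7 / φ ^ 4) := by gcongr
    _ = _ := by ring

end LoopGraph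

theorem mainTheorem3 :
    -- the program for RandomNibble has expected running time O(log^7 m / φ^4)
    (∃ K : ℝ, 0 < K ∧
      ∀ (n : ℕ) (G : LoopGraph n) (φ : ℝ), (∀ u, 0 < G.deg u) → 1 < G.edges → 0 < φ → φ < 1 →
        G.randomNibbleMean (fun v b => ((G.randomNibbleProgram φ v b).cost : ℝ)) ≤
          K * ((Real.logb 2 G.edges) ^ 7 / φ ^ 4)) ∧
    -- and it implements Nibble at the chosen vertex and scale
    (∀ (n : ℕ) (G : LoopGraph n) (φ : ℝ), (∀ u, 0 < G.deg u) → 1 < G.edges → 0 < φ → φ < 1 →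
      ∀ v : Fin n, ∀ b ∈ Finset.Icc 1 ⌈Real.logb 2 G.edges⌉₊,
        G.IsNibbleOutput φ v b (G.randomNibbleProgram φ v b).val.toFinset) ∧
    -- the guarantees hold for every way of running Nibble
    (∀ (n : ℕ) (G : LoopGraph n) (φ : ℝ), (∀ u, 0 < G.deg u) → 1 < G.edges → 0 < φ → φ < 1 →
      ∀ C : Fin n → ℕ → Finset (Fin n),
        (∀ v, ∀ b ∈ Finset.Icc 1 ⌈Real.logb 2 G.edges⌉₊, G.IsNibbleOutput φ v b (C v b)) →
        (∀ v, ∀ b ∈ Finset.Icc 1 ⌈Real.logb 2 G.edges⌉₊, (C v b).Nonempty →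
          G.conductance (C v b) ≤ φ ∧
          (G.vol (C v b) : ℝ) ≤ 5 / 6 * (G.vol Finset.univ : ℝ)) ∧
        (∀ S : Finset (Fin n),
          (G.vol S : ℝ) ≤ 2 / 3 * (G.vol Finset.univ : ℝ) →
          G.conductance S ≤ G.fOne φ →
          (∀ u ∈ S, ¬ (G.deg u = 1 ∧ G.loops u = 1)) →
          (G.vol S : ℝ) / (4 * (G.vol Finset.univ : ℝ)) ≤
            G.randomNibbleMean (fun v b => (G.vol (C v b ∩ S) : ℝ)))) := by
  refine ⟨⟨2 * (231 * 5400 * 1444) * 3 ^ 7, by norm_num, fun n G φ hd hm hφ hφ1 =>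
    LoopGraph.randomNibbleMean_cost_le hd hm hφ hφ1⟩, fun n G φ hd hm hφ _ v b _ =>
    LoopGraph.isNibbleOutput_program hd hm hφ v b, fun n G φ hd hm hφ hφ1 C hC => ⟨?_, ?_⟩⟩
  · exact fun v b hb hne => LoopGraph.conductance_le_of_isNibbleOutput (hC v b hb) hne
  · exact fun S hS hcond hloop => LoopGraph.randomNibble_overlap hd hm hφ hφ1 hC hS hcond hloop
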